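/- **Domains.** A *domain* is a partial order with a least element $\bot$ that is directed complete, has a supremum for every bounded pair, has only countably many finite (= compact) elements, and in which every element is the directed supremum of the finite elements below it. A subset $X$ of a domain $D$ is a *subdomain* if, with the restricted order, $X$ is a domain, $\bot_D\in X$, finite elements of $X$ are finite in $D$, and $X$ is closed under those suprema of pairs and of non-empty directed subsets of $X$ that exist in $D$. A *finitary projection* on $D$ is a Scott-continuous $p:D\to D$ with $p(p(x))=p(x)$ and $p(x)\sqsubseteq x$ such that, for all $x$ and all finite $c$, $c\sqsubseteq p(x)$ iff there is a finite $e$ with $c\sqsubseteq e\sqsubseteq x$ and $e=p(e)$ (finitary condition). An *effective presentation* of $D$ is an enumeration $e_0,e_1,\dots$ of exactly the finite elements for which "$e_m,e_n$ have an upper bound" and "$e_k$ is the supremum of $e_m,e_n$" are decidable in the indices; $p$ is *computable* with respect to it if $\{(m,n): e_n\sqsubseteq p(e_m)\}$ is recursively enumerable. *Scott's universal domain* $\mathcal U$ is the domain of ideals of the poset of non-empty finite unions of rational intervals $[r,s)$, $0\le r<s\le 1$, ordered by reverse inclusion. **Signatures.** Let $N$ (class names) and $L$ (labels) be countable sets.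 A *class signature* consists of a class name, a finite set of names of immediate supersignatures, a finite set of field signatures in $L\times N$ with distinct labels, and a finite set of method signatures in $L\times N^*\times N$ (label, parameter classes, result class) with distinct labels. A *signature environment* is a finite set $se$ of class signatures with distinct names that contains a signature for each name referenced in it, whose supersignature relation is acyclic, and in which each signature contains all field and method signatures of its supersignatures. A *signature closure* is a pair $(nm,se)$ of a name bound in a signature environment $se$ and $se$, such that every member of $se$ is accessible from $nm$ by references; $se(nm)$ is its root, and its fields and methods shapes are the sets of labels of the fields and of the methods of its root. For a name $n$ bound in $se$, $se\_clos(se,n)$ is $n$ together with the members of $se$ accessible from $n$. Subsigning $\trianglelefteq$ is the reflexive transitive closure, on signature closures, of the relation: $(nm_2,se_2)$ is related to $(nm_1,se_1)$ iff $se_1\subseteq se_2$ and $nm_1$ is a supersignature name of $se_2(nm_2)$. **Raw objects.** For a domain $D$, let $L\multimap D$ consist of $\bot$ and all functions from finite subsets of $L$ (shapes) to $D$, where those of equal shape are ordered pointwise and those of different shapes are unrelated; let $D^*$ consist of $\bot$ and all finite sequences in $D$, ordered componentwise at equal length and unrelated at different lengths. The preliminary object domain $\hat{\mathcal O}$ is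 the least solution (the limit of the iterates starting from the one-point domain) of $$\hat{\mathcal O}\cong\mathcal S\times(L\multimap\hat{\mathcal O})\times\bigl(L\multimap(\hat{\mathcal O}^*\to_{\text{strict}}\hat{\mathcal O})\bigr),$$ with $\mathcal S$ the flat domain of signature closures, $\times$ the strict product, and $\to_{\text{strict}}$ the domain of strict continuous functions. Thus every non-bottom object is a triple $(sc,fr,mr)$ of proper elements. **Filtering.** $\mathtt{filter}:\hat{\mathcal O}\to\hat{\mathcal O}$ is the (pointwise) least function satisfying the following recursive definition: $\mathtt{filter}(\bot)=\bot$; $\mathtt{filter}(sc,fr,mr)=\bot$ if the shapes of $fr$ and $mr$ are not the fields and methods shapes of $sc$; otherwise, for $sc=(nm,se)$, $\mathtt{filter}(sc,fr,mr)=(sc,fr',mr')$ with the same shapes, where $fr'(a)=F_{se\_clos(se,n)}(fr(a))$ for each field signature $(a,n)$ of the root, and $$mr'(b)(os)=F_{se\_clos(se,n)}\bigl(mr(b)(vos)\bigr)$$ for each method signature $(b,(n_1,\dots,n_k),n)$ of the root and each $os\in\hat{\mathcal O}^*$. Here $F_{ss}(o)=\mathtt{filter}(o)$ if $o$ is non-bottom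 and its signature closure subsigns $ss$, and $F_{ss}(o)=\bot$ otherwise; $vos$ is obtained from $os$ by applying componentwise $F_{se\_clos(se,nm)},F_{se\_clos(se,n_1)},\dots,F_{se\_clos(se,n_k)}$ if $os$ is a sequence of length $k+1$, and $vos=\bot$ otherwise. **Validity.** For a set $V$ of objects, the *validity clauses relative to $V$* hold for $o$ if $o=\bot$, or $o=(sc,fr,mr)$, the shapes of $fr,mr$ are those of $sc$, each $fr(a)$ with declared closure $ss$ conforms to $ss$ (it is $\bot$, or it is in $V$ and its signature closure subsigns $ss$), and for each method $m=mr(b)$ and each $os\in\hat{\mathcal O}^*$, $m(os)$ conforms to the declared result closure, and $m(os)=m(os')$ for some $os'\sqsubseteq os$ which is $\bot$ or a sequence that has the declared length and conforms componentwise to $sc$ (for the receiver) and the declared parameter closures. **Theorem.** $\hat{\mathcal O}$ is a domain, and $\mathtt{filter}$ exists and is a finitary projection on $\hat{\mathcal O}$: it is continuous, idempotent, below the identity, and satisfies the finitary condition. Let $\mathcal O=\mathtt{filter}(\hat{\mathcal O})$. Then $\mathcal O$ is the domain of valid objects: an object is in $\mathcal O$ iff it satisfies the validity clauses relative to $\mathcal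 O$, and a finite object is in $\mathcal O$ iff it is valid in the inductive sense (it lies in the least set $V$ that contains every object satisfying the validity clauses relative to $V$). The set $\mathcal O$ is a subdomain of $\hat{\mathcal O}$, and it is a computable one: $\hat{\mathcal O}$ has an effective presentation $(e_n)$ with respect to which $\mathtt{filter}$ is computable, and for some computable $r:\mathbb N\to\mathbb N$ the sequence $(e_{r(n)})$ is an effective presentation of $\mathcal O$. Moreover $\mathcal O$ is isomorphic to a subdomain of $\mathcal U$. -/

import Mathlib

namespace NOOP

open Set Relation

/-! ### Class signatures, signature environments and signature closures -/

section Signatures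

/-- The tuples (class name, names of the immediate supersignatures, field signatures, method
signatures). A field signature is a pair (field name, class name), a method signature a triple
(method name, class names of the parameters, class name of the result). Two signatures count as
equal as soon as their sequences of supersignature names, of field signatures and of method
signatures have the same members, so that finite sets represent these sequences. -/
structure ClassSig (N L : Type) where
  name : N
  supers : Finset N
  fields : Finset (L × N)
  methods : Finset (L × List N × N)

variable {N L : Type}

namespace ClassSig

/-- No field name and no method name is declared twice. -/
structure IsClassSig (s : ClassSig N L) : Prop where
  fields : ∀ f ∈ s.fields, ∀ g ∈ s.fields, f.1 = g.1 → f = g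
  methods : ∀ f ∈ s.methods, ∀ g ∈ s.methods, f.1 = g.1 → f = g

/-- The class names that are referenced in `s`. -/
def refs (s : ClassSig N L) : Set N :=
  {n | n ∈ s.supers ∨ (∃ f ∈ s.fields, n = f.2) ∨ ∃ m ∈ s.methods, n ∈ m.2.1 ∨ n = m.2.2}

end ClassSig

/-- The direct-reference relation of a set of class signatures. -/
def Adj (se : Finset (ClassSig N L)) (a b : N) : Prop := ∃ s ∈ se, s.name = a ∧ b ∈ s.refs

/-- The immediate supersignature relation of a set of class signatures. -/
def Super (se : Finset (ClassSig N L)) (a b : N) : Prop := ∃ s ∈ se, s.name = a ∧ b ∈ s.supers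

/-- Signature environments. -/
structure IsSigEnv (se : Finset (ClassSig N L)) : Prop where
  isClassSig : ∀ s ∈ se, s.IsClassSig
  name_inj : ∀ s ∈ se, ∀ t ∈ se, s.name = t.name → s = t
  closed : ∀ s ∈ se, ∀ n ∈ s.refs, ∃ t ∈ se, t.name = n
  acyclic : ∀ n, ¬ TransGen (Super se) n n
  fields_subset : ∀ s ∈ se, ∀ t ∈ se, t.name ∈ s.supers → t.fields ⊆ s.fields
  methods_subset : ∀ s ∈ se, ∀ t ∈ se, t.name ∈ s.supers → t.methods ⊆ s.methods

/-- The pair `(nm, se)` is a signature closure: `se` is a signature environment with a (root)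
signature of name `nm`, and it is minimal: all its members are accessible from the root. -/
structure IsSigClosure (nm : N) (se : Finset (ClassSig N L)) : Prop where
  isSigEnv : IsSigEnv se
  root : ∃ s ∈ se, s.name = nm
  minimal : ∀ s ∈ se, ReflTransGen (Adj se) nm s.name

/-- Signature closures. -/
structure SigClosure (N L : Type) where
  name : N
  env : Finset (ClassSig N L)
  isSigClosure : IsSigClosure name env

open scoped Classical in
/-- The members of `se` that are accessible from `n`. -/
noncomputable def accessible (se : Finset (ClassSig N L)) (n : N) : Finset (ClassSig N L) :=
  se.filter fun s => ReflTransGen (Adj se) n s.name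

theorem mem_accessible {se : Finset (ClassSig N L)} {n : N} {s : ClassSig N L} :
    s ∈ accessible se n ↔ s ∈ se ∧ ReflTransGen (Adj se) n s.name := by
  simp [accessible]

theorem isSigClosure_accessible {se : Finset (ClassSig N L)} (h : IsSigEnv se) {n : N}
    (hn : ∃ s ∈ se, s.name = n) : IsSigClosure n (accessible se n) where
  isSigEnv :=
    { isClassSig := fun s hs => h.isClassSig s (mem_accessible.1 hs).1
      name_inj := fun s hs t ht =>
        h.name_inj s (mem_accessible.1 hs).1 t (mem_accessible.1 ht).1
      closed := fun s hs m hm => by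
        obtain ⟨hs, hr⟩ := mem_accessible.1 hs
        obtain ⟨t, ht, rfl⟩ := h.closed s hs m hm
        exact ⟨t, mem_accessible.2 ⟨ht, hr.tail ⟨s, hs, rfl, hm⟩⟩, rfl⟩
      acyclic := fun m hm => h.acyclic m (TransGen.mono (fun _ _ hab => by
        obtain ⟨s, hs, hab⟩ := hab
        exact ⟨s, (mem_accessible.1 hs).1, hab⟩) _ _ hm)
      fields_subset := fun s hs t ht =>
        h.fields_subset s (mem_accessible.1 hs).1 t (mem_accessible.1 ht).1
      methods_subset := fun s hs t ht =>
        h.methods_subset s (mem_accessible.1 hs).1 t (mem_accessible.1 ht).1 }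
  root := by
    obtain ⟨s, hs, rfl⟩ := hn
    exact ⟨s, mem_accessible.2 ⟨hs, .refl⟩, rfl⟩
  minimal := by
    have key : ∀ m, ReflTransGen (Adj se) n m → ReflTransGen (Adj (accessible se n)) n m := by
      intro m hm
      induction hm with
      | refl => exact .refl
      | tail hab hbc ih =>
        obtain ⟨s, hs, rfl, hm⟩ := hbc
        exact ih.tail ⟨s, mem_accessible.2 ⟨hs, hab⟩, rfl, hm⟩
    exact fun s hs => key _ (mem_accessible.1 hs).2

namespace SigClosure

/-- The root class signature. -/
noncomputable def root (sc : SigClosure N L) : ClassSig N L := sc.isSigClosure.root.choose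

open scoped Classical in
/-- The signature closure of the class name `n` in the environment of `sc`. (Only names that are
bound in this environment occur as `n`; the value at other names is irrelevant.) -/
noncomputable def closAt (sc : SigClosure N L) (n : N) : SigClosure N L :=
  if h : ∃ s ∈ sc.env, s.name = n then
    ⟨n, accessible sc.env n, isSigClosure_accessible sc.isSigClosure.isSigEnv h⟩
  else sc

/-- `sc₂` is an immediate subsignature of `sc₁`: the environment of `sc₂` extends that of `sc₁`,
and the root signature of `sc₂` names `sc₁` as a supersignature. -/
def ImmSub (sc₂ sc₁ : SigClosure N L) : Prop := sc₁.env ⊆ sc₂.env ∧ sc₁.name ∈ sc₂.root.supers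

/-- The subsigning relation. -/
def Subsign : SigClosure N L → SigClosure N L → Prop := ReflTransGen ImmSub

/-- The fields shape. -/
def fieldShape (sc : SigClosure N L) : Set L := {a | ∃ f ∈ sc.root.fields, f.1 = a}

/-- The methods shape. -/
def methodShape (sc : SigClosure N L) : Set L := {b | ∃ m ∈ sc.root.methods, m.1 = b}

end SigClosure

end Signatures

/-! ### Domain constructors -/

/-- Directed completeness. -/
class DirComplete (α : Type) [PartialOrder α] : Prop where
  exists_isLUB : ∀ d : Set α, d.Nonempty → DirectedOn (· ≤ ·) d → ∃ a, IsLUB d a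

section Constructors

variable {α β γ : Type} [PartialOrder α] [PartialOrder β] [PartialOrder γ]

theorem directedOn_image {f : α → β} (hf : Monotone f) {d : Set α}
    (hd : DirectedOn (· ≤ ·) d) : DirectedOn (· ≤ ·) (f '' d) := by
  rintro _ ⟨x, hx, rfl⟩ _ ⟨y, hy, rfl⟩
  obtain ⟨z, hz, hxz, hyz⟩ := hd x hx y hy
  exact ⟨f z, ⟨z, hz, rfl⟩, hf hxz, hf hyz⟩

/-! ### Adding a bottom element -/

theorem directedOn_preimage_coe {d : Set (WithBot α)} (hd : DirectedOn (· ≤ ·) d) :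
    DirectedOn (· ≤ ·) {x : α | (x : WithBot α) ∈ d} := by
  intro x hx y hy
  obtain ⟨z, hz, hxz, hyz⟩ := hd _ hx _ hy
  induction z with
  | bot => simp at hxz
  | coe z => exact ⟨z, hz, WithBot.coe_le_coe.1 hxz, WithBot.coe_le_coe.1 hyz⟩

theorem isLUB_withBot_coe {d : Set (WithBot α)} {x0 x : α} (h0 : (x0 : WithBot α) ∈ d) :
    IsLUB d (x : WithBot α) ↔ IsLUB {x : α | (x : WithBot α) ∈ d} x := by
  constructor
  · intro h
    refine ⟨fun y hy => WithBot.coe_le_coe.1 (h.1 hy), fun y hy => ?_⟩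
    refine WithBot.coe_le_coe.1 (h.2 fun z hz => ?_)
    induction z with
    | bot => exact bot_le
    | coe z => exact WithBot.coe_le_coe.2 (hy hz)
  · intro h
    refine ⟨fun z hz => ?_, fun y hy => ?_⟩
    · induction z with
      | bot => exact bot_le
      | coe z => exact WithBot.coe_le_coe.2 (h.1 hz)
    · induction y with
      | bot => exact absurd (hy h0) (by simp)
      | coe y => exact WithBot.coe_le_coe.2 (h.2 fun z hz => WithBot.coe_le_coe.1 (hy hz))

instance [DirComplete α] : DirComplete (WithBot α) where
  exists_isLUB d hne hd := by
    by_cases h : ∃ x : α, (x : WithBot α) ∈ d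
    · obtain ⟨x0, h0⟩ := h
      obtain ⟨a, ha⟩ := DirComplete.exists_isLUB {x : α | (x : WithBot α) ∈ d} ⟨x0, h0⟩
        (directedOn_preimage_coe hd)
      exact ⟨a, (isLUB_withBot_coe h0).2 ha⟩
    · refine ⟨⊥, fun z hz => ?_, fun _ _ => bot_le⟩
      induction z with
      | bot => exact le_rfl
      | coe z => exact absurd ⟨z, hz⟩ h

theorem scottContinuous_withBot_map {f : α → β} (hf : ScottContinuous f) :
    ScottContinuous (WithBot.map f) := by
  intro d hne hd a ha
  by_cases h : ∃ x : α, (x : WithBot α) ∈ d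
  · obtain ⟨x0, h0⟩ := h
    induction a with
    | bot => exact absurd (ha.1 h0) (by simp)
    | coe a =>
      have := hf (nonempty_of_mem (mem_ofPred_eq ▸ h0 : x0 ∈ {x : α | (x : WithBot α) ∈ d}))
        (directedOn_preimage_coe hd) ((isLUB_withBot_coe h0).1 ha)
      refine (isLUB_withBot_coe (x0 := f x0) (mem_image_of_mem (WithBot.map f) h0)).2 ?_
      convert this using 1
      ext y
      constructor
      · rintro ⟨z, hz, e⟩
        induction z with
        | bot => simp at e
        | coe z => exact ⟨z, hz, by simpa using e⟩
      · rintro ⟨z, hz, rfl⟩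
        exact ⟨_, hz, rfl⟩
  · have hd' : d = {⊥} := by
      refine (hne.subset_singleton_iff).1 fun z hz => ?_
      induction z with
      | bot => rfl
      | coe z => exact absurd ⟨z, hz⟩ h
    subst hd'
    obtain rfl : a = ⊥ := ha.unique isLUB_singleton
    simp

/-! ### Disjoint sums -/

section Sigma

variable {ι : Type} {P Q : ι → Type} [∀ i, PartialOrder (P i)] [∀ i, PartialOrder (Q i)]

theorem directedOn_preimage_mk {d : Set (Σ i, P i)} (hd : DirectedOn (· ≤ ·) d) (i : ι) :
    DirectedOn (· ≤ ·) {x : P i | (⟨i, x⟩ : Σ i, P i) ∈ d} := by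
  intro x hx y hy
  obtain ⟨⟨j, z⟩, hz, hxz, hyz⟩ := hd _ hx _ hy
  cases hxz with
  | fiber _ _ w h => exact ⟨w, hz, h, Sigma.mk_le_mk_iff.1 hyz⟩

theorem fst_eq_of_directedOn {d : Set (Σ i, P i)} (hd : DirectedOn (· ≤ ·) d) {x y : Σ i, P i}
    (hx : x ∈ d) (hy : y ∈ d) : x.1 = y.1 := by
  obtain ⟨z, hz, ⟨_, _, _, _⟩, ⟨_, _, _, _⟩⟩ := hd _ hx _ hy
  rfl

theorem isLUB_sigma_mk {d : Set (Σ i, P i)} (hd : DirectedOn (· ≤ ·) d) {i : ι} {x0 x : P i}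
    (h0 : (⟨i, x0⟩ : Σ i, P i) ∈ d) :
    IsLUB d ⟨i, x⟩ ↔ IsLUB {x : P i | (⟨i, x⟩ : Σ i, P i) ∈ d} x := by
  constructor
  · intro h
    refine ⟨fun y hy => Sigma.mk_le_mk_iff.1 (h.1 hy), fun y hy => ?_⟩
    refine Sigma.mk_le_mk_iff.1 (h.2 ?_)
    rintro ⟨j, z⟩ hz
    obtain rfl : i = j := fst_eq_of_directedOn hd h0 hz
    exact Sigma.mk_le_mk_iff.2 (hy hz)
  · intro h
    constructor
    · rintro ⟨j, z⟩ hz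
      obtain rfl : i = j := fst_eq_of_directedOn hd h0 hz
      exact Sigma.mk_le_mk_iff.2 (h.1 hz)
    · rintro ⟨j, y⟩ hy
      obtain ⟨_, _, _, _⟩ := hy h0
      exact Sigma.mk_le_mk_iff.2 (h.2 fun z hz => Sigma.mk_le_mk_iff.1 (hy hz))

instance [∀ i, DirComplete (P i)] : DirComplete (Σ i, P i) where
  exists_isLUB d hne hd := by
    obtain ⟨⟨i, x0⟩, h0⟩ := hne
    obtain ⟨a, ha⟩ := DirComplete.exists_isLUB _ ⟨x0, h0⟩ (directedOn_preimage_mk hd i)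
    exact ⟨⟨i, a⟩, (isLUB_sigma_mk hd h0).2 ha⟩

theorem scottContinuous_sigma_map {f : ∀ i, P i → Q i} (hf : ∀ i, ScottContinuous (f i)) :
    ScottContinuous (Sigma.map id f : (Σ i, P i) → Σ i, Q i) := by
  have hmono : Monotone (Sigma.map id f : (Σ i, P i) → Σ i, Q i) := by
    rintro _ _ ⟨i, x, y, h⟩
    exact Sigma.mk_le_mk_iff.2 ((hf i).monotone h)
  rintro d ⟨⟨i, x0⟩, h0⟩ hd ⟨j, a⟩ ha
  obtain ⟨_, _, _, _⟩ := ha.1 h0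
  refine (isLUB_sigma_mk (directedOn_image hmono hd) (x0 := f i x0) ⟨_, h0, rfl⟩).2 ?_
  convert hf i ⟨x0, h0⟩ (directedOn_preimage_mk hd i) ((isLUB_sigma_mk hd h0).1 ha) using 1
  ext y
  constructor
  · rintro ⟨⟨j, z⟩, hz, e⟩
    obtain rfl : i = j := fst_eq_of_directedOn hd h0 hz
    exact ⟨z, hz, eq_of_heq (Sigma.mk.inj e).2⟩
  · rintro ⟨z, hz, rfl⟩
    exact ⟨_, hz, rfl⟩

end Sigma

/-! ### Products -/

instance [DirComplete α] [DirComplete β] : DirComplete (α × β) where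
  exists_isLUB d hne hd := by
    obtain ⟨a, ha⟩ := DirComplete.exists_isLUB (Prod.fst '' d) (hne.image _)
      (directedOn_image monotone_fst hd)
    obtain ⟨b, hb⟩ := DirComplete.exists_isLUB (Prod.snd '' d) (hne.image _)
      (directedOn_image monotone_snd hd)
    exact ⟨(a, b), isLUB_prod.2 ⟨ha, hb⟩⟩

instance {ι : Type} [DirComplete α] : DirComplete (ι → α) where
  exists_isLUB d hne hd := by
    have := fun i => DirComplete.exists_isLUB (Function.eval i '' d) (hne.image _)
      (directedOn_image (Function.monotone_eval i) hd)
    choose a ha using this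
    exact ⟨a, isLUB_pi.2 ha⟩

theorem scottContinuous_pi_map {ι : Type} {f : α → β} (hf : ScottContinuous f) :
    ScottContinuous (fun (r : ι → α) i => f (r i)) := by
  intro d hne hd a ha
  refine isLUB_pi.2 fun i => ?_
  have := hf (hne.image _) (directedOn_image (Function.monotone_eval i) hd) (isLUB_pi.1 ha i)
  rw [image_image] at this ⊢
  exact this

/-! ### Strict continuous functions -/

/-- The domain of strict continuous functions, ordered pointwise. -/
structure StrictFun (α β : Type) [PartialOrder α] [OrderBot α] [PartialOrder β] [OrderBot β] :
    Type where
  toFun : α → β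
  continuous : ScottContinuous toFun
  strict : toFun ⊥ = ⊥

namespace StrictFun

variable [OrderBot α] [OrderBot β] [OrderBot γ]

instance : CoeFun (StrictFun α β) (fun _ => α → β) := ⟨toFun⟩

theorem ext {f g : StrictFun α β} (h : ∀ x, f x = g x) : f = g := by
  obtain ⟨f, _, _⟩ := f
  obtain ⟨g, _, _⟩ := g
  obtain rfl : f = g := funext h
  rfl

instance : PartialOrder (StrictFun α β) where
  le f g := ∀ x, f x ≤ g x
  le_refl f x := le_rfl
  le_trans f g h hfg hgh x := (hfg x).trans (hgh x)
  le_antisymm f g hfg hgf := ext fun x => (hfg x).antisymm (hgf x)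

theorem le_def {f g : StrictFun α β} : f ≤ g ↔ ∀ x, f x ≤ g x := Iff.rfl

theorem mono (f : StrictFun α β) : Monotone f := f.continuous.monotone

theorem monotone_eval (x : α) : Monotone (fun f : StrictFun α β => f x) := fun _ _ h => h x

instance : OrderBot (StrictFun α β) where
  bot := ⟨fun _ => ⊥, .const ⊥, rfl⟩
  bot_le _ _ := bot_le

/-- Composition. -/
def comp (g : StrictFun β γ) (f : StrictFun α β) : StrictFun α γ where
  toFun x := g (f x)
  continuous := f.continuous.comp g.continuous
  strict := by rw [f.strict, g.strict]

theorem isLUB_of_pointwise {d : Set (StrictFun α β)} {f : StrictFun α β}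
    (h : ∀ x, IsLUB ((fun g : StrictFun α β => g x) '' d) (f x)) : IsLUB d f :=
  ⟨fun g hg x => (h x).1 ⟨g, hg, rfl⟩,
    fun g hg x => (h x).2 (by rintro _ ⟨k, hk, rfl⟩; exact hg hk x)⟩

theorem exists_pointwise [DirComplete β] {d : Set (StrictFun α β)} (hne : d.Nonempty)
    (hd : DirectedOn (· ≤ ·) d) :
    ∃ f : StrictFun α β, ∀ x, IsLUB ((fun g : StrictFun α β => g x) '' d) (f x) := by
  have := fun x => DirComplete.exists_isLUB ((fun g : StrictFun α β => g x) '' d) (hne.image _)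
    (directedOn_image (monotone_eval x) hd)
  choose f hf using this
  refine ⟨⟨f, ?_, ?_⟩, hf⟩
  · intro s hsne hs a ha
    constructor
    · rintro _ ⟨x, hx, rfl⟩
      refine (hf x).2 ?_
      rintro _ ⟨g, hg, rfl⟩
      exact (g.mono (ha.1 hx)).trans ((hf a).1 ⟨g, hg, rfl⟩)
    · intro b hb
      refine (hf a).2 ?_
      rintro _ ⟨g, hg, rfl⟩
      refine (g.continuous hsne hs ha).2 ?_
      rintro _ ⟨x, hx, rfl⟩
      exact ((hf x).1 ⟨g, hg, rfl⟩).trans (hb ⟨x, hx, rfl⟩)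
  · refine le_bot_iff.1 ((hf ⊥).2 ?_)
    rintro _ ⟨g, hg, rfl⟩
    exact g.strict.le

theorem isLUB_pointwise [DirComplete β] {d : Set (StrictFun α β)} (hne : d.Nonempty)
    (hd : DirectedOn (· ≤ ·) d) {f : StrictFun α β} (h : IsLUB d f) (x : α) :
    IsLUB ((fun g : StrictFun α β => g x) '' d) (f x) := by
  obtain ⟨f', hf'⟩ := exists_pointwise hne hd
  rw [h.unique (isLUB_of_pointwise hf')]
  exact hf' x

instance [DirComplete β] : DirComplete (StrictFun α β) where
  exists_isLUB _ hne hd :=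
    let ⟨f, hf⟩ := exists_pointwise hne hd
    ⟨f, isLUB_of_pointwise hf⟩

/-- The action `f ↦ v ∘ f ∘ u`. -/
def conj {α' β' : Type} [PartialOrder α'] [OrderBot α'] [PartialOrder β'] [OrderBot β']
    (u : StrictFun α' α) (v : StrictFun β β') (f : StrictFun α β) : StrictFun α' β' :=
  v.comp (f.comp u)

theorem scottContinuous_conj [DirComplete β] {α' β' : Type} [PartialOrder α'] [OrderBot α']
    [PartialOrder β'] [OrderBot β'] (u : StrictFun α' α) (v : StrictFun β β') :
    ScottContinuous (conj u v) := by
  intro d hne hd f hf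
  refine isLUB_of_pointwise fun x => ?_
  have := v.continuous (hne.image _) (directedOn_image (monotone_eval (u x)) hd)
    (isLUB_pointwise hne hd hf (u x))
  rw [image_image] at this ⊢
  exact this

end StrictFun

end Constructors

/-! ### Sequences, records and the right-hand side of the domain equation -/

section Equation

/-- The domain `α*` of finite sequences: a new bottom element together with the sequences of each
length `n`, which are ordered componentwise; sequences of different lengths are unrelated. -/
abbrev Seq (α : Type) : Type := WithBot (Σ n : ℕ, Fin n → α)

/-- The proper (non-bottom) elements of the record domain `L ⊸ α`: a shape, i.e. a finite set `s`
of labels (it serves as the tag), with a function on it (a strict function on the flat domain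
`s ∪ {⊥}`). Records of different shapes are unrelated; records of the same shape are ordered
pointwise. -/
abbrev ProperRec (L α : Type) : Type := Σ s : Finset L, (s → α)

/-- The record domain `L ⊸ α`. -/
abbrev Rec (L α : Type) : Type := WithBot (ProperRec L α)

/-- The domain `α* → α` of strict continuous functions. -/
abbrev Meth (α : Type) [PartialOrder α] [OrderBot α] : Type := StrictFun (Seq α) α

/-- The strict product `S × (L ⊸ α) × (L ⊸ (α* → α))`, where `S` stands for the flat domain
`S ∪ {⊥}`: a bottom element and the triples of proper elements. -/
abbrev RHS (S L α : Type) [PartialOrder α] [OrderBot α] : Type :=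
  WithBot (Σ _ : S, ProperRec L α × ProperRec L (Meth α))

/-- Memberwise application. -/
def ProperRec.map {L α β : Type} (f : α → β) : ProperRec L α → ProperRec L β :=
  Sigma.map id fun _ r i => f (r i)

theorem ProperRec.scottContinuous_map {L α β : Type} [PartialOrder α] [PartialOrder β]
    {f : α → β} (hf : ScottContinuous f) :
    ScottContinuous (ProperRec.map f : ProperRec L α → ProperRec L β) :=
  scottContinuous_sigma_map fun _ => scottContinuous_pi_map hf

variable {S L α β γ : Type} [PartialOrder α] [OrderBot α] [PartialOrder β] [OrderBot β]
  [PartialOrder γ] [OrderBot γ]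

/-- Componentwise application. -/
def Seq.map (f : StrictFun α β) : StrictFun (Seq α) (Seq β) where
  toFun := WithBot.map (Sigma.map id fun _ r i => f (r i))
  continuous := scottContinuous_withBot_map
    (scottContinuous_sigma_map fun _ => scottContinuous_pi_map f.continuous)
  strict := rfl

/-- The functorial action of the right-hand side: it applies `v` to the fields and
`m ↦ v ∘ m ∘ u*` to the methods. -/
def RHS.map [DirComplete α] (u : StrictFun β α) (v : StrictFun α β) :
    StrictFun (RHS S L α) (RHS S L β) where
  toFun := WithBot.map (Sigma.map id fun _ =>
    Prod.map (ProperRec.map v) (ProperRec.map (StrictFun.conj (Seq.map u) v)))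
  continuous := scottContinuous_withBot_map (scottContinuous_sigma_map fun _ =>
    ScottContinuous.prod (ProperRec.scottContinuous_map v.continuous)
      (ProperRec.scottContinuous_map (StrictFun.scottContinuous_conj _ _)))
  strict := rfl

theorem Seq.map_comp (g : StrictFun β γ) (f : StrictFun α β) :
    Seq.map (g.comp f) = (Seq.map g).comp (Seq.map f) := by
  refine StrictFun.ext fun x => ?_
  induction x using WithBot.recBotCoe with
  | bot => rfl
  | coe x => rfl

theorem Seq.map_mono {f g : StrictFun α β} (h : f ≤ g) : Seq.map f ≤ Seq.map g := by
  intro x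
  induction x using WithBot.recBotCoe with
  | bot => exact le_rfl
  | coe x => exact WithBot.coe_le_coe.2 (Sigma.mk_le_mk_iff.2 fun i => h _)

theorem RHS.map_comp [DirComplete α] [DirComplete β] (u : StrictFun β α) (v : StrictFun α β)
    (u' : StrictFun γ β) (v' : StrictFun β γ) :
    (RHS.map u' v' : StrictFun (RHS S L β) (RHS S L γ)).comp (RHS.map u v) =
      RHS.map (u.comp u') (v'.comp v) := by
  refine StrictFun.ext fun x => ?_
  induction x using WithBot.recBotCoe with
  | bot => rfl
  | coe x =>
    have : ∀ m : Meth α, StrictFun.conj (Seq.map u') v' (StrictFun.conj (Seq.map u) v m) =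
        StrictFun.conj (Seq.map (u.comp u')) (v'.comp v) m := by
      intro m
      rw [Seq.map_comp]
      rfl
    obtain ⟨s, ⟨A, f⟩, ⟨B, m⟩⟩ := x
    exact congrArg (fun k => ((⟨s, ⟨A, fun a => v' (v (f a))⟩, ⟨B, k⟩⟩ :
      Σ _ : S, ProperRec L γ × ProperRec L (Meth γ)) : RHS S L γ)) (funext fun b => this (m b))

theorem RHS.map_mono [DirComplete α] {u u' : StrictFun β α} {v v' : StrictFun α β} (hu : u ≤ u')
    (hv : v ≤ v') : (RHS.map u v : StrictFun (RHS S L α) (RHS S L β)) ≤ RHS.map u' v' := by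
  intro x
  induction x using WithBot.recBotCoe with
  | bot => exact le_rfl
  | coe x =>
    refine WithBot.coe_le_coe.2 (Sigma.mk_le_mk_iff.2 ⟨Sigma.mk_le_mk_iff.2 fun a => hv _,
      Sigma.mk_le_mk_iff.2 fun b os => ?_⟩)
    exact (v.mono ((x.2.2.2 b).mono (Seq.map_mono hu os))).trans (hv _)

end Equation

/-! ### The least solution of the domain equation -/

section Solution

/-- A pointed directed-complete partial order. -/
structure Dom : Type 1 where
  carrier : Type
  [po : PartialOrder carrier]
  [bot : OrderBot carrier]
  [dc : DirComplete carrier]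

attribute [instance] Dom.po Dom.bot Dom.dc

instance : DirComplete PUnit where
  exists_isLUB _ _ _ := ⟨⟨⟩, fun _ _ => le_rfl, fun _ _ => le_rfl⟩

variable (S L : Type)

/-- The iterates of the right-hand side, starting from the one-point domain. -/
def level : ℕ → Dom
  | 0 => ⟨PUnit⟩
  | n + 1 => ⟨RHS S L (level n).carrier⟩

/-- The carrier of the `n`-th iterate. -/
abbrev Level (n : ℕ) : Type := (level S L n).carrier

/-- The canonical map between iterates: for `i ≤ j` the embedding of the `i`-th iterate into the
`j`-th one, for `j ≤ i` the corresponding projection. -/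
def link : ∀ i j : ℕ, StrictFun (Level S L i) (Level S L j)
  | 0, _ => ⊥
  | _ + 1, 0 => ⊥
  | i + 1, j + 1 => (RHS.map (link j i) (link i j) :
      StrictFun (RHS S L (Level S L i)) (RHS S L (Level S L j)))
  termination_by i j => i + j

theorem link_succ (i j : ℕ) : link S L (i + 1) (j + 1) =
    (RHS.map (link S L j i) (link S L i j) :
      StrictFun (RHS S L (Level S L i)) (RHS S L (Level S L j))) := by
  rw [link]

theorem link_zero_left (j : ℕ) : link S L 0 j = ⊥ := by rw [link]

theorem link_zero_right (i : ℕ) : link S L i 0 = ⊥ :=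
  StrictFun.ext fun _ => rfl

theorem link_comp_le : ∀ i j k : ℕ, (link S L j k).comp (link S L i j) ≤ link S L i k
  | 0, j, k => fun x => by
      rw [link_zero_left, link_zero_left]
      exact (link S L j k).strict.le
  | _ + 1, j, 0 => fun _ => le_rfl
  | i + 1, 0, k + 1 => fun _ => by
      rw [link_zero_left]
      exact bot_le
  | i + 1, j + 1, k + 1 => by
      rw [link_succ, link_succ, link_succ]
      refine le_of_eq_of_le (RHS.map_comp _ _ _ _) (RHS.map_mono ?_ ?_)
      · exact link_comp_le k j i
      · exact link_comp_le i j k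
  termination_by i j k => i + j + k

theorem link_comp : ∀ i j k : ℕ, min i k ≤ j → (link S L j k).comp (link S L i j) = link S L i k
  | 0, j, k, _ => StrictFun.ext fun x => by
      rw [link_zero_left, link_zero_left]
      exact (link S L j k).strict
  | _ + 1, j, 0, _ => StrictFun.ext fun _ => rfl
  | i + 1, 0, k + 1, h => by omega
  | i + 1, j + 1, k + 1, h => by
      rw [link_succ, link_succ, link_succ]
      refine (RHS.map_comp _ _ _ _).trans ?_
      rw [link_comp k j i (by omega), link_comp i j k (by omega)]
  termination_by i j k => i + j + k

/-- The least solution of the domain equation: the limit of the iterates along the projections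
(equivalently, their colimit along the embeddings). An element is a sequence of compatible
approximations. -/
structure PreObj : Type where
  val : ∀ n, Level S L n
  compat : ∀ i j, j ≤ i → link S L i j (val i) = val j

namespace PreObj

variable {S L}

theorem ext {x y : PreObj S L} (h : ∀ n, x.val n = y.val n) : x = y := by
  obtain ⟨x, _⟩ := x
  obtain ⟨y, _⟩ := y
  obtain rfl : x = y := funext h
  rfl

instance : PartialOrder (PreObj S L) where
  le x y := ∀ n, x.val n ≤ y.val n
  le_refl x n := le_rfl
  le_trans x y z hxy hyz n := (hxy n).trans (hyz n)
  le_antisymm x y hxy hyx := ext fun n => (hxy n).antisymm (hyx n)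

theorem monotone_val (n : ℕ) : Monotone fun x : PreObj S L => x.val n := fun _ _ h => h n

theorem le_def {x y : PreObj S L} : x ≤ y ↔ ∀ n, x.val n ≤ y.1 n := Iff.rfl

theorem link_self_apply (x : PreObj S L) (n : ℕ) : link S L n n (x.val n) = x.val n := x.compat n n le_rfl

instance : OrderBot (PreObj S L) where
  bot := ⟨fun _ => ⊥, fun i j _ => (link S L i j).strict⟩
  bot_le _ _ := bot_le

theorem isLUB_of_pointwise {d : Set (PreObj S L)} {a : PreObj S L}
    (h : ∀ n, IsLUB ((fun x : PreObj S L => x.val n) '' d) (a.val n)) : IsLUB d a :=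
  ⟨fun x hx n => (h n).1 ⟨x, hx, rfl⟩,
    fun b hb n => (h n).2 (by rintro _ ⟨x, hx, rfl⟩; exact hb hx n)⟩

theorem isLUB_image_of_pointwise {β : Type} {f : β → PreObj S L} {d : Set β} {a : β}
    (h : ∀ n, IsLUB ((fun y => (f y).val n) '' d) ((f a).val n)) : IsLUB (f '' d) (f a) :=
  isLUB_of_pointwise fun n => by
    have := h n
    rw [image_image]
    exact this

theorem exists_pointwise {d : Set (PreObj S L)} (hne : d.Nonempty)
    (hd : DirectedOn (· ≤ ·) d) :
    ∃ a : PreObj S L, ∀ n, IsLUB ((fun x : PreObj S L => x.val n) '' d) (a.val n) := by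
  have hdir := fun n => directedOn_image (monotone_val n) hd
  have := fun n => DirComplete.exists_isLUB _ (hne.image _) (hdir n)
  choose a ha using this
  refine ⟨⟨a, fun i j hij => ?_⟩, ha⟩
  have h := (link S L i j).continuous (hne.image _) (hdir i) (ha i)
  rw [image_image] at h
  refine h.unique ?_
  have e : (fun x : PreObj S L => link S L i j (x.val i)) = fun x => x.val j :=
    funext fun x => x.compat i j hij
  rw [e]
  exact ha j

theorem isLUB_pointwise {d : Set (PreObj S L)} (hne : d.Nonempty)
    (hd : DirectedOn (· ≤ ·) d) {a : PreObj S L} (h : IsLUB d a) (n : ℕ) :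
    IsLUB ((fun x : PreObj S L => x.val n) '' d) (a.val n) := by
  obtain ⟨a', ha'⟩ := exists_pointwise hne hd
  rw [h.unique (isLUB_of_pointwise ha')]
  exact ha' n

instance : DirComplete (PreObj S L) where
  exists_isLUB _ hne hd :=
    let ⟨a, ha⟩ := exists_pointwise hne hd
    ⟨a, isLUB_of_pointwise ha⟩

/-- The projection onto the `n`-th iterate. -/
def proj (n : ℕ) : StrictFun (PreObj S L) (Level S L n) where
  toFun x := x.val n
  continuous _ hne hd _ ha := isLUB_pointwise hne hd ha n
  strict := rfl

/-- The embedding of the `n`-th iterate. -/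
def emb (n : ℕ) : StrictFun (Level S L n) (PreObj S L) where
  toFun x := ⟨fun k => link S L n k x, fun i j hij =>
    congrArg (fun f : StrictFun _ _ => f x) (link_comp S L n i j (by omega))⟩
  continuous d hne hd a ha := isLUB_image_of_pointwise fun k =>
    (link S L n k).continuous hne hd ha
  strict := ext fun k => (link S L n k).strict

theorem emb_comp_link {i j : ℕ} (h : j ≤ i) : (emb i).comp (link S L j i) = emb j :=
  StrictFun.ext fun x => ext fun k =>
    congrArg (fun f : StrictFun _ _ => f x) (link_comp S L j i k (by omega))

theorem link_comp_proj {i j : ℕ} (h : j ≤ i) : (link S L i j).comp (proj i) = proj j :=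
  StrictFun.ext fun x => x.compat i j h

theorem proj_comp_emb (i j : ℕ) : (proj j).comp (emb i) = link S L i j := rfl

/-- The coordinates of `fold`. -/
def foldCoord : ∀ n, StrictFun (RHS S L (PreObj S L)) (Level S L n)
  | 0 => ⊥
  | k + 1 => (RHS.map (emb k) (proj k) :
      StrictFun (RHS S L (PreObj S L)) (RHS S L (Level S L k)))

/-- The solution map of the domain equation; it is an order isomorphism, see `foldIso` below. -/
def fold : StrictFun (RHS S L (PreObj S L)) (PreObj S L) where
  toFun y := ⟨fun n => foldCoord n y, fun i j hij => by
    cases j with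
    | zero => rfl
    | succ j =>
      cases i with
      | zero => omega
      | succ i =>
        have hij' : j ≤ i := by omega
        rw [link_succ]
        have := RHS.map_comp (S := S) (L := L) (emb i) (proj i) (link S L j i) (link S L i j)
        rw [emb_comp_link hij', link_comp_proj hij'] at this
        exact congrArg (fun f : StrictFun _ _ => f y) this⟩
  continuous d hne hd a ha := isLUB_image_of_pointwise fun k =>
    (foldCoord k).continuous hne hd ha
  strict := ext fun k => (foldCoord k).strict

theorem emb_proj_le (n : ℕ) (x : PreObj S L) : emb n (proj n x) ≤ x := by
  intro k
  have h : link S L n k (link S L (max n k) n (x.val (max n k))) ≤ _ :=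
    link_comp_le S L (max n k) n k (x.val (max n k))
  rw [x.compat (max n k) n (le_max_left _ _), x.compat (max n k) k (le_max_right _ _)] at h
  exact h

theorem emb_proj_apply {n k : ℕ} (h : k ≤ n) (x : PreObj S L) :
    (emb n (proj n x)).val k = x.val k := x.compat n k h

theorem link_succ_le (n : ℕ) (x : PreObj S L) : link S L n (n + 1) (x.val n) ≤ x.val (n + 1) :=
  emb_proj_le n x (n + 1)

theorem emb_proj_mono (x : PreObj S L) : Monotone fun n => emb n (proj n x) := by
  intro m n h
  have := (emb n).mono (show link S L m n (x.val m) ≤ x.val n from emb_proj_le m x n)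
  refine le_of_eq_of_le ?_ this
  exact congrArg (fun f : StrictFun _ _ => f (x.val m)) (emb_comp_link h).symm

theorem isLUB_emb_proj (x : PreObj S L) : IsLUB (range fun n => emb n (proj n x)) x := by
  refine ⟨by rintro _ ⟨n, rfl⟩; exact emb_proj_le n x, fun y hy n => ?_⟩
  exact (emb_proj_apply le_rfl x).ge.trans (hy ⟨n, rfl⟩ n)

theorem isLUB_seq_emb_proj (os : Seq (PreObj S L)) :
    IsLUB (range fun n => Seq.map (emb n) (Seq.map (proj n) os)) os := by
  induction os using WithBot.recBotCoe with
  | bot =>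
    refine ⟨by rintro _ ⟨n, rfl⟩; exact le_rfl, fun _ _ => bot_le⟩
  | coe x =>
    obtain ⟨n, v⟩ := x
    constructor
    · rintro _ ⟨k, rfl⟩
      exact WithBot.coe_le_coe.2 (Sigma.mk_le_mk_iff.2 fun i => emb_proj_le k (v i))
    · intro y hy
      induction y using WithBot.recBotCoe with
      | bot => exact absurd (hy ⟨0, rfl⟩) (by simp [Seq.map])
      | coe y =>
        obtain ⟨m, w⟩ := y
        have h0 := WithBot.coe_le_coe.1 (hy ⟨0, rfl⟩)
        obtain ⟨_, _, _, _⟩ := h0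
        refine WithBot.coe_le_coe.2 (Sigma.mk_le_mk_iff.2 fun i => ?_)
        refine (isLUB_emb_proj (v i)).2 ?_
        rintro _ ⟨k, rfl⟩
        exact Sigma.mk_le_mk_iff.1 (WithBot.coe_le_coe.1 (hy ⟨k, rfl⟩)) i

theorem fold_map_val (x : PreObj S L) (n k : ℕ) :
    (fold (RHS.map (proj n) (emb n) (x.val (n + 1)))).val (k + 1) =
      link S L (n + 1) (k + 1) (x.val (n + 1)) := by
  rw [link_succ]
  exact congrArg (fun f : StrictFun (RHS S L (Level S L n)) (RHS S L (Level S L k)) =>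
    f (x.val (n + 1))) (RHS.map_comp (S := S) (L := L) (proj n) (emb n) (emb k) (proj k))

theorem fold_surjective : Function.Surjective (fold : RHS S L (PreObj S L) → PreObj S L) := by
  intro x
  let z : ℕ → RHS S L (PreObj S L) := fun n => RHS.map (proj n) (emb n) (x.val (n + 1))
  have hz : Monotone z := by
    refine monotone_nat_of_le_succ fun n => ?_
    have e : x.val (n + 1) = (RHS.map (link S L n (n + 1)) (link S L (n + 1) n) :
        StrictFun (RHS S L (Level S L (n + 1))) (RHS S L (Level S L n))) (x.val (n + 1 + 1)) := by
      rw [← link_succ]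
      exact (x.compat _ _ (by omega)).symm
    have h := RHS.map_mono (S := S) (L := L)
      (u := (link S L n (n + 1)).comp (proj n)) (u' := proj (n + 1))
      (v := (emb n).comp (link S L (n + 1) n)) (v' := emb (n + 1))
      (fun a => link_succ_le n a) (fun a k => link_comp_le S L (n + 1) n k a)
    rw [← RHS.map_comp] at h
    exact le_of_eq_of_le (congrArg (RHS.map (proj n) (emb n) :
      StrictFun (RHS S L (Level S L n)) (RHS S L (PreObj S L))) e) (h _)
  have hdir : DirectedOn (· ≤ ·) (range z) := hz.directed_le.directedOn_range
  obtain ⟨y, hy⟩ := DirComplete.exists_isLUB (range z) (range_nonempty z) hdir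
  refine ⟨y, (fold.continuous (range_nonempty z) hdir hy).unique ?_⟩
  have hle : ∀ n, fold (z n) ≤ x := by
    intro n k
    cases k with
    | zero => exact le_rfl
    | succ k =>
      rw [fold_map_val]
      exact emb_proj_le (n + 1) x (k + 1)
  refine ⟨by rintro _ ⟨_, ⟨n, rfl⟩, rfl⟩; exact hle n, fun b hb k => ?_⟩
  cases k with
  | zero => exact le_rfl
  | succ k =>
    have := hb ⟨_, ⟨k, rfl⟩, rfl⟩ (k + 1)
    rw [fold_map_val, link_self_apply] at this
    exact this

theorem le_of_fold_le {y y' : RHS S L (PreObj S L)} (h : fold y ≤ fold y') : y ≤ y' := by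
  have hk : ∀ k, (RHS.map (emb k) (proj k) : StrictFun (RHS S L (PreObj S L)) _) y ≤
      (RHS.map (emb k) (proj k) : StrictFun (RHS S L (PreObj S L)) _) y' := fun k => h (k + 1)
  induction y using WithBot.recBotCoe with
  | bot => exact bot_le
  | coe y =>
    induction y' using WithBot.recBotCoe with
    | bot => exact absurd (hk 0) (WithBot.not_coe_le_bot _)
    | coe y' =>
      obtain ⟨s, ⟨A, f⟩, ⟨B, m⟩⟩ := y
      obtain ⟨s', ⟨A', f'⟩, ⟨B', m'⟩⟩ := y'
      have hs : ∀ k, _ := fun k => WithBot.coe_le_coe.1 (hk k)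
      obtain rfl : s = s' := by obtain ⟨h, _⟩ := Sigma.le_def.1 (hs 0); exact h
      have hp : ∀ k, ((ProperRec.map (proj k) ⟨A, f⟩,
          ProperRec.map (StrictFun.conj (Seq.map (emb k)) (proj k)) ⟨B, m⟩) :
            ProperRec L (Level S L k) × ProperRec L (Meth (Level S L k))) ≤
          (ProperRec.map (proj k) ⟨A', f'⟩,
            ProperRec.map (StrictFun.conj (Seq.map (emb k)) (proj k)) ⟨B', m'⟩) :=
        fun k => Sigma.mk_le_mk_iff.1 (hs k)
      obtain rfl : A = A' := by obtain ⟨h, _⟩ := Sigma.le_def.1 (hp 0).1; exact h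
      obtain rfl : B = B' := by obtain ⟨h, _⟩ := Sigma.le_def.1 (hp 0).2; exact h
      have hf : ∀ k a, (f a).val k ≤ (f' a).val k := fun k => Sigma.mk_le_mk_iff.1 (hp k).1
      have hm : ∀ k b os, (m b (Seq.map (emb k) os)).val k ≤ (m' b (Seq.map (emb k) os)).val k :=
        fun k => Sigma.mk_le_mk_iff.1 (hp k).2
      refine WithBot.coe_le_coe.2 (Sigma.mk_le_mk_iff.2 ⟨Sigma.mk_le_mk_iff.2 fun a k => hf k a,
        Sigma.mk_le_mk_iff.2 fun b os => ?_⟩)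
      have hmono : Monotone fun n => Seq.map (emb n) (Seq.map (proj n) os) := by
        intro i j hij
        have hij' : (emb i).comp (proj i) ≤ (emb j).comp (proj j) :=
          fun x : PreObj S L => emb_proj_mono x hij
        have := Seq.map_mono hij' os
        rw [Seq.map_comp, Seq.map_comp] at this
        exact this
      have hlub := isLUB_seq_emb_proj os
      refine ((m b).continuous (range_nonempty _) hmono.directed_le.directedOn_range hlub).2 ?_
      rintro _ ⟨_, ⟨n, rfl⟩, rfl⟩ k
      have h1 := hm (max n k) b (Seq.map (proj (max n k)) os)
      have h2 := (link S L (max n k) k).mono h1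
      rw [PreObj.compat _ _ _ (le_max_right _ _), PreObj.compat _ _ _ (le_max_right _ _)] at h2
      exact ((m b).mono (hmono (le_max_left n k)) k).trans
        (h2.trans ((m' b).mono (hlub.1 ⟨_, rfl⟩) k))

/-- The domain equation: the right-hand side, formed over the domain `PreObj S L`, is isomorphic
to `PreObj S L`. -/
noncomputable def foldIso : RHS S L (PreObj S L) ≃o PreObj S L where
  toEquiv := Equiv.ofBijective fold
    ⟨fun _ _ h => (le_of_fold_le h.le).antisymm (le_of_fold_le h.ge), fold_surjective⟩
  map_rel_iff' := ⟨le_of_fold_le, fun h => fold.mono h⟩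

end PreObj

end Solution

/-! ### Objects, filtering and validity -/

section Objects

/-- The preliminary domain of raw objects, the solution of
`Obj = S × (L ⊸ Obj) × (L ⊸ (Obj* → Obj))`, where `S` is the flat domain of signature closures. -/
abbrev Obj (N L : Type) : Type := PreObj (SigClosure N L) L

variable {N L : Type}

/-- The non-bottom object with signature closure `sc`, fields record `fr` and methods
record `mr`. -/
def mkObj (sc : SigClosure N L) (fr : ProperRec L (Obj N L)) (mr : ProperRec L (Meth (Obj N L))) :
    Obj N L :=
  PreObj.fold
    (WithBot.some (⟨sc, fr, mr⟩ :
      Σ _ : SigClosure N L, ProperRec L (Obj N L) × ProperRec L (Meth (Obj N L))))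

/-- The object `o` is non-bottom, and its signature closure subsigns `ss`. -/
def SubsignsTo (o : Obj N L) (ss : SigClosure N L) : Prop :=
  ∃ sc fr mr, o = mkObj sc fr mr ∧ sc.Subsign ss

/-- The shapes of the two records are those of the signature closure. -/
def ShapesMatch (sc : SigClosure N L) (fr : ProperRec L (Obj N L))
    (mr : ProperRec L (Meth (Obj N L))) : Prop :=
  (fr.1 : Set L) = sc.fieldShape ∧ (mr.1 : Set L) = sc.methodShape

/-- The signature closures that `sc` prescribes for the arguments of its method `b`; the first one
is that of `sc` itself, for the receiver. -/
noncomputable def argSigs (sc : SigClosure N L) (b : L × List N × N) : List (SigClosure N L) :=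
  (sc.name :: b.2.1).map sc.closAt

open scoped Classical in
/-- The function `filter-obj-sig`, relative to a filtering function `φ`. -/
noncomputable def filterObjSig (φ : Obj N L → Obj N L) (ss : SigClosure N L) (o : Obj N L) :
    Obj N L :=
  if SubsignsTo o ss then φ o else ⊥

/-- Componentwise application of `filter-obj-sig` to a list of signature closures and a sequence
of objects; it diverges if the lengths differ. -/
noncomputable def filterSeq (φ : Obj N L → Obj N L) (ins : List (SigClosure N L)) :
    Seq (Obj N L) → Seq (Obj N L)
  | ⊥ => ⊥
  | WithBot.some ⟨n, v⟩ =>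
    if h : n = ins.length then
      WithBot.some ⟨n, fun i => filterObjSig φ (ins.get (i.cast h)) (v i)⟩
    else ⊥

/-- The recursive equations of the filtering function. -/
structure FilterEqs (φ : Obj N L → Obj N L) : Prop where
  bot : φ ⊥ = ⊥
  mismatch : ∀ sc fr mr, ¬ ShapesMatch sc fr mr → φ (mkObj sc fr mr) = ⊥
  matching : ∀ sc fr mr, ShapesMatch sc fr mr →
    ∃ (fr' : fr.1 → Obj N L) (mr' : mr.1 → Meth (Obj N L)),
      φ (mkObj sc fr mr) = mkObj sc ⟨fr.1, fr'⟩ ⟨mr.1, mr'⟩ ∧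
      (∀ f ∈ sc.root.fields, ∀ h : f.1 ∈ fr.1,
        fr' ⟨f.1, h⟩ = filterObjSig φ (sc.closAt f.2) (fr.2 ⟨f.1, h⟩)) ∧
      (∀ b ∈ sc.root.methods, ∀ h : b.1 ∈ mr.1, ∀ os : Seq (Obj N L),
        mr' ⟨b.1, h⟩ os = filterObjSig φ (sc.closAt b.2.2)
          (mr.2 ⟨b.1, h⟩ (filterSeq φ (argSigs sc b) os)))

/-- The filtering function: the least solution of the recursive equations. -/
def IsFilter (φ : Obj N L → Obj N L) : Prop := IsLeast {ψ | FilterEqs ψ} φ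

/-- `o` is bottom, or a member of `V` whose signature closure subsigns `ss`. -/
def ConformsTo (V : Set (Obj N L)) (ss : SigClosure N L) (o : Obj N L) : Prop :=
  o = ⊥ ∨ (o ∈ V ∧ SubsignsTo o ss)

/-- The sequence is bottom, or it has as many components as `ins`, and they conform. -/
def SeqConformsTo (V : Set (Obj N L)) (ins : List (SigClosure N L)) (os : Seq (Obj N L)) : Prop :=
  os = ⊥ ∨ ∃ v : Fin ins.length → Obj N L, os = WithBot.some ⟨ins.length, v⟩ ∧
    ∀ i, ConformsTo V (ins.get i) (v i)

/-- The method takes in conforming sequences (whatever it returns for `os`, it returns already for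
a conforming sequence that approximates `os`), and it returns conforming objects. -/
def MethConformsTo (V : Set (Obj N L)) (ins : List (SigClosure N L)) (out : SigClosure N L)
    (m : Meth (Obj N L)) : Prop :=
  ∀ os, (∃ os' ≤ os, SeqConformsTo V ins os' ∧ m os' = m os) ∧ ConformsTo V out (m os)

/-- The clauses of the definition of validity of `o`, where `V` stands for the set of valid
objects. -/
def ValidClauses (V : Set (Obj N L)) (o : Obj N L) : Prop :=
  o = ⊥ ∨ ∃ sc fr mr, o = mkObj sc fr mr ∧ ShapesMatch sc fr mr ∧
    (∀ f ∈ sc.root.fields, ∀ h : f.1 ∈ fr.1, ConformsTo V (sc.closAt f.2) (fr.2 ⟨f.1, h⟩)) ∧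
    ∀ b ∈ sc.root.methods, ∀ h : b.1 ∈ mr.1,
      MethConformsTo V (argSigs sc b) (sc.closAt b.2.2) (mr.2 ⟨b.1, h⟩)

/-- The inductively defined validity predicate. -/
def IndValid (o : Obj N L) : Prop :=
  ∀ V : Set (Obj N L), (∀ p, ValidClauses V p → p ∈ V) → o ∈ V

end Objects

/-! ### Domains, subdomains and finitary projections -/

section DomainTheory

/-- Domains (Scott domains): pointed, directed complete, bounded complete, with a countable set of
finite (compact) elements, such that every element is the directed supremum of the finite elements
below it. -/
structure IsScottDomain (D : Type) [PartialOrder D] : Prop where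
  exists_isBot : ∃ b : D, IsBot b
  exists_isLUB_directed : ∀ d : Set D, d.Nonempty → DirectedOn (· ≤ ·) d → ∃ a, IsLUB d a
  exists_isLUB_pair : ∀ x y : D, BddAbove {x, y} → ∃ z, IsLUB {x, y} z
  countable : {c : D | IsCompactElement c}.Countable
  directed : ∀ x : D, DirectedOn (· ≤ ·) {c : D | IsCompactElement c ∧ c ≤ x}
  isLUB : ∀ x : D, IsLUB {c : D | IsCompactElement c ∧ c ≤ x} x

variable {D : Type} [PartialOrder D]

/-- The subdomain relation: with the restricted order, `X` is a domain with the same bottom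
element, its finite elements are finite in `D`, and consistency of pairs, their suprema and
directed suprema in `X` are those of `D`. -/
structure IsSubdomain (X : Set D) : Prop where
  isScottDomain : IsScottDomain X
  bot_mem : ∀ b : D, IsBot b → b ∈ X
  compact : ∀ c : X, IsCompactElement c → IsCompactElement (c : D)
  pair_mem : ∀ x ∈ X, ∀ y ∈ X, ∀ z : D, IsLUB {x, y} z → z ∈ X
  directed_mem : ∀ d ⊆ X, d.Nonempty → DirectedOn (· ≤ ·) d → ∀ a : D, IsLUB d a → a ∈ X

/-- Finitary projections. In `finitary`, the finite elements below `p x` are determined by the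
finite fixed points of `p` below `x`. -/
structure IsFinitaryProjection (p : D → D) : Prop where
  continuous : ScottContinuous p
  idem : ∀ x, p (p x) = p x
  le_self : ∀ x, p x ≤ x
  finitary : ∀ x c, IsCompactElement c →
    (c ≤ p x ↔ ∃ e, IsCompactElement e ∧ e ≤ x ∧ e = p e ∧ c ≤ e)

/-- `e` enumerates (possibly with repetitions) the finite elements, and the consistency and the
supremum relation on the indices are decidable. -/
structure IsEffectivePresentation (e : ℕ → D) : Prop where
  range_eq : range e = {c | IsCompactElement c}
  consistent : ComputablePred fun q : ℕ × ℕ => BddAbove {e q.1, e q.2}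
  isLUB : ComputablePred fun q : ℕ × ℕ × ℕ => IsLUB {e q.1, e q.2.1} (e q.2.2)

/-- The map `p` is computable with respect to the effective presentation `e`. -/
def IsComputableMap (e : ℕ → D) (p : D → D) : Prop :=
  REPred fun q : ℕ × ℕ => e q.2 ≤ p (e q.1)

/-- `X` is a computable subdomain of `D` with respect to the effective presentation `e` of `D`: it
has an effective presentation, from which the indices in `e` can be computed. -/
def IsComputableSubdomain (e : ℕ → D) (X : Set D) : Prop :=
  IsSubdomain X ∧ ∃ r : ℕ → ℕ, Computable r ∧ ∃ h : ∀ n, e (r n) ∈ X,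
    IsEffectivePresentation fun n => (⟨e (r n), h n⟩ : X)

/-- The finitary basis of Scott's universal domain: the non-empty finite unions of half-open
intervals `[r, s)` of rational numbers, `0 ≤ r < s ≤ 1`. -/
structure UBasis : Type where
  carrier : Set ℚ
  nonempty : carrier.Nonempty
  isUnion : ∃ F : Finset (ℚ × ℚ), (∀ q ∈ F, 0 ≤ q.1 ∧ q.1 < q.2 ∧ q.2 ≤ 1) ∧
    carrier = ⋃ q ∈ F, Ico q.1 q.2

/-- Smaller sets carry more information. -/
instance : Preorder UBasis where
  le x y := y.carrier ⊆ x.carrier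
  le_refl _ := Subset.rfl
  le_trans _ _ _ hxy hyz := hyz.trans hxy

/-- Scott's universal domain: the ideals of the finitary basis, ordered by inclusion. -/
abbrev Universal : Type := Order.Ideal UBasis

end DomainTheory

end NOOP

/-!
The domain `Obj N L` is the limit of a chain of projections, and everything about raw objects is
proved by induction along this chain. A non-bottom object is a header (a signature closure and two
shapes) together with a continuous function at each slot, where a slot is a field or the restriction
of a method to the sequences of a given length (`le_iff`, `exists_mk`). The truncations `cut n`
satisfy `cut (n + 1) x = (v ↦ cut n (x (cut n v)))` slotwise (`ap_cut`). By induction on `n`, bounded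
sets have suprema (`exists_isLUB`), and every object is the directed supremum of the finite joins of
atoms below it (`isLUB_approx`); an atom is a step object, which returns a given atom for arguments
above given finite joins of atoms. Hence the compact objects are the finite joins of atoms, and
`Obj N L` is a Scott domain (`isScottDomain`).

The recursive equations of filtering turn continuous functions into continuous functions, and their
least solution `filter` is the supremum of its Kleene approximations. The main step is that one
unfolding of the equations preserves finitary projections (`Unfolds.isFinitaryProjection`): if a
compact object is below a filtered value of `x`, then it is so at compact fixed arguments, and the
corresponding step object is a compact fixed point below `x`. Suprema of chains inherit the property
(`isFinitaryProjection_filter`). Validity of the fixed points is read off the recursive equations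
(`mem_range_filter_iff`); a compact fixed point is fixed already by an approximation, and induction
on the number of the latter gives validity in the inductive sense (`mem_of_closed`). The image of a
finitary projection is always a subdomain (`IsFinitaryProjection.isSubdomain`).

Atoms are coded by numbers. A list of atoms is consistent if and only if the headers agree and,
whenever the arguments of some of its atoms are consistent, so are their results
(`con_iff_conStep`), which is a recursion on codes; so consistency is decidable. Whether an atom is
below a filtered join of atoms satisfies a similar recursion (`below_iff_belowStep`). It only
involves positive occurrences of itself and of the subsigning relation. Reachability in the
infinite graph of signature closures is recursively enumerable, hence so is the graph of `filter`
(`rePred_below`); with no filtering at all, the same recursion decides the order on the compact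
objects. The compact elements of the image are the compact fixed points, and `e ≤ filter e` is
recursively enumerable, so they can be enumerated computably
(`IsFinitaryProjection.isComputableSubdomain`).

Finally, every Scott domain embeds in the universal domain (`IsScottDomain.exists_universal`). For
an enumeration of the compact elements, the unit interval is split along with the set of compact
elements, according to which of them are above the `n`-th one; a compact element is represented by
the union of the cells of those above it.
-/

namespace NOOP

open Set Relation

/-! ### Continuity of elementary maps -/

section Continuity

variable {α β γ : Type} [PartialOrder α] [PartialOrder β] [PartialOrder γ]

theorem scottContinuous_coe : ScottContinuous (WithBot.some : α → WithBot α) := by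
  intro d hne hd a ha
  obtain ⟨x, hx⟩ := hne
  refine (isLUB_withBot_coe (x0 := x) (mem_image_of_mem _ hx)).2 ?_
  convert ha using 1
  ext y
  simp

theorem scottContinuous_sigma_mk {ι : Type} {P : ι → Type} [∀ i, PartialOrder (P i)] (i : ι) :
    ScottContinuous (fun x : P i => (⟨i, x⟩ : Σ i, P i)) := by
  intro d hne hd a ha
  obtain ⟨x, hx⟩ := hne
  refine (isLUB_sigma_mk (directedOn_image (f := fun x : P i => (⟨i, x⟩ : Σ i, P i))
    (fun x y h => Sigma.le_def.2 ⟨rfl, h⟩) hd) (x0 := x) (mem_image_of_mem _ hx)).2 ?_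
  convert ha using 1
  ext y
  simp

/-- A strict map on sequences is continuous if it is so at each length. -/
theorem scottContinuous_of_lengths [OrderBot β] {f : Seq α → β} (h0 : f ⊥ = ⊥)
    (hf : ∀ n, ScottContinuous fun v : Fin n → α =>
      f (WithBot.some (⟨n, v⟩ : Σ n : ℕ, Fin n → α))) : ScottContinuous f := by
  intro d hne hd a ha
  by_cases h : ∃ x : Σ n : ℕ, Fin n → α, (x : Seq α) ∈ d
  · obtain ⟨⟨n, x0⟩, hx0⟩ := h
    induction a using WithBot.recBotCoe with
    | bot => exact absurd (ha.1 hx0) (by simp)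
    | coe a =>
      have hd' := directedOn_preimage_coe hd
      have ha' := (isLUB_withBot_coe hx0).1 ha
      obtain ⟨m, a⟩ := a
      obtain ⟨_, _, _, _⟩ := ha'.1 hx0
      have h2 := (isLUB_sigma_mk hd' hx0).1 ha'
      have h3 := hf n ⟨x0, hx0⟩ (directedOn_preimage_mk hd' n) h2
      refine ⟨?_, fun b hb => h3.2 ?_⟩
      · rintro _ ⟨z, hz, rfl⟩
        induction z using WithBot.recBotCoe with
        | bot => simp [h0]
        | coe z =>
          obtain ⟨k, z⟩ := z
          obtain rfl : n = k := fst_eq_of_directedOn hd' hx0 hz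
          exact h3.1 ⟨z, hz, rfl⟩
      · rintro _ ⟨z, hz, rfl⟩
        exact hb ⟨_, hz, rfl⟩
  · have hd' : d = {⊥} := by
      refine (hne.subset_singleton_iff).1 fun z hz => ?_
      induction z using WithBot.recBotCoe with
      | bot => rfl
      | coe z => exact absurd ⟨z, hz⟩ h
    subst hd'
    obtain rfl : a = ⊥ := ha.unique isLUB_singleton
    simp

/-- The strict continuous function on sequences that is given by its restrictions to the sequences
of each length. -/
def Meth.ofLengths [OrderBot α] (g : ∀ n, (Fin n → α) → α) (hg : ∀ n, ScottContinuous (g n)) :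
    Meth α where
  toFun
    | ⊥ => ⊥
    | WithBot.some ⟨n, v⟩ => g n v
  continuous := scottContinuous_of_lengths rfl hg
  strict := rfl

end Continuity

/-! ### Raw objects as headers with functions on slots -/

section Api

/-- The tag of a non-bottom object: the signature closure and the two shapes. -/
abbrev Header (S L : Type) : Type := S × Finset L × Finset L

/-- A slot of an object: a field, or the restriction of a method to the sequences of a given
length. The number is the arity; a field is treated as a function of arity `0`. -/
abbrev Slot (L : Type) : Type := (L ⊕ L) × ℕ

variable {S L : Type}

/-- The slots that an object with the given header has. -/
def Slot.Allowed (h : Header S L) : Slot L → Prop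
  | (Sum.inl a, n) => a ∈ h.2.1 ∧ n = 0
  | (Sum.inr b, _) => b ∈ h.2.2

namespace RHS

variable {α : Type} [PartialOrder α] [OrderBot α]

/-- The header of an element of the right-hand side of the domain equation. -/
def hd : RHS S L α → Option (Header S L)
  | ⊥ => none
  | WithBot.some ⟨s, fr, mr⟩ => some (s, fr.1, mr.1)

open scoped Classical in
/-- The function at a slot; it is `⊥` at slots that the element does not have. -/
noncomputable def ap : RHS S L α → (σ : Slot L) → (Fin σ.2 → α) → α
  | ⊥, _, _ => ⊥
  | WithBot.some ⟨_, fr, _⟩, (Sum.inl a, n), _ => if h : a ∈ fr.1 ∧ n = 0 then fr.2 ⟨a, h.1⟩ else ⊥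
  | WithBot.some ⟨_, _, mr⟩, (Sum.inr b, n), v =>
    if h : b ∈ mr.1 then mr.2 ⟨b, h⟩ (WithBot.some ⟨n, v⟩) else ⊥

theorem le_iff {x y : RHS S L α} :
    x ≤ y ↔ x = ⊥ ∨ (hd x = hd y ∧ ∀ σ v, ap x σ v ≤ ap y σ v) := by
  induction x using WithBot.recBotCoe with
  | bot => simp
  | coe x =>
    obtain ⟨s, ⟨A, f⟩, ⟨B, m⟩⟩ := x
    induction y using WithBot.recBotCoe with
    | bot => simp [hd]
    | coe y =>
      obtain ⟨s', ⟨A', f'⟩, ⟨B', m'⟩⟩ := y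
      simp only [WithBot.coe_ne_bot, false_or]
      constructor
      · intro h
        have h := WithBot.coe_le_coe.1 h
        obtain rfl : s = s' := by obtain ⟨h, _⟩ := Sigma.le_def.1 h; exact h
        have h := Sigma.mk_le_mk_iff.1 h
        obtain rfl : A = A' := by obtain ⟨h, _⟩ := Sigma.le_def.1 h.1; exact h
        obtain rfl : B = B' := by obtain ⟨h, _⟩ := Sigma.le_def.1 h.2; exact h
        have h1 := Sigma.mk_le_mk_iff.1 h.1
        have h2 := Sigma.mk_le_mk_iff.1 h.2
        refine ⟨rfl, ?_⟩
        rintro ⟨a | b, n⟩ v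
        · simp only [ap]
          split_ifs
          · exact h1 _
          · exact le_rfl
        · simp only [ap]
          split_ifs
          · exact h2 _ _
          · exact le_rfl
      · rintro ⟨h, h'⟩
        simp only [hd, Option.some.injEq, Prod.mk.injEq] at h
        obtain ⟨rfl, rfl, rfl⟩ := h
        refine WithBot.coe_le_coe.2 (Sigma.mk_le_mk_iff.2 ⟨Sigma.mk_le_mk_iff.2 fun a => ?_,
          Sigma.mk_le_mk_iff.2 fun b os => ?_⟩)
        · have := h' (Sum.inl a, 0) Fin.elim0
          simpa [ap] using this
        · induction os using WithBot.recBotCoe with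
          | bot => rw [(m b).strict]; exact bot_le
          | coe os =>
            have := h' (Sum.inr b, os.1) os.2
            simpa [ap] using this

theorem continuous_ap (x : RHS S L α) (σ : Slot L) : ScottContinuous (ap x σ) := by
  induction x using WithBot.recBotCoe with
  | bot => exact .const ⊥
  | coe x =>
    obtain ⟨s, ⟨A, f⟩, ⟨B, m⟩⟩ := x
    obtain ⟨a | b, n⟩ := σ
    · by_cases h : a ∈ A ∧ n = 0
      · have : ap (WithBot.some ⟨s, ⟨A, f⟩, ⟨B, m⟩⟩ : RHS S L α) (Sum.inl a, n) =
          fun _ => f ⟨a, h.1⟩ := by funext v; simp only [ap]; rw [dif_pos h]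
        rw [this]
        exact .const _
      · have : ap (WithBot.some ⟨s, ⟨A, f⟩, ⟨B, m⟩⟩ : RHS S L α) (Sum.inl a, n) =
          fun _ => ⊥ := by funext v; simp only [ap]; rw [dif_neg h]
        rw [this]
        exact .const _
    · by_cases h : b ∈ B
      · have : ap (WithBot.some ⟨s, ⟨A, f⟩, ⟨B, m⟩⟩ : RHS S L α) (Sum.inr b, n) =
          fun v => m ⟨b, h⟩ (WithBot.some ⟨n, v⟩) := by funext v; simp only [ap]; rw [dif_pos h]
        rw [this]
        exact ((scottContinuous_sigma_mk n).comp scottContinuous_coe).comp (m ⟨b, h⟩).continuous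
      · have : ap (WithBot.some ⟨s, ⟨A, f⟩, ⟨B, m⟩⟩ : RHS S L α) (Sum.inr b, n) =
          fun _ => ⊥ := by funext v; simp only [ap]; rw [dif_neg h]
        rw [this]
        exact .const _

theorem ap_of_not_allowed {x : RHS S L α} {h : Header S L} (hx : hd x = some h) {σ : Slot L}
    (hσ : ¬ σ.Allowed h) (v : Fin σ.2 → α) : ap x σ v = ⊥ := by
  induction x using WithBot.recBotCoe with
  | bot => rfl
  | coe x =>
    obtain ⟨s, ⟨A, f⟩, ⟨B, m⟩⟩ := x
    simp only [hd, Option.some.injEq] at hx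
    subst hx
    obtain ⟨a | b, n⟩ := σ
    · exact dif_neg hσ
    · exact dif_neg hσ

theorem exists_mk (h : Header S L) (M : (σ : Slot L) → (Fin σ.2 → α) → α)
    (hM : ∀ σ, ScottContinuous (M σ)) :
    ∃ x : RHS S L α, hd x = some h ∧ ∀ σ v, σ.Allowed h → ap x σ v = M σ v := by
  refine ⟨WithBot.some ⟨h.1, ⟨h.2.1, fun a => M (Sum.inl a, 0) Fin.elim0⟩,
    ⟨h.2.2, fun b => Meth.ofLengths (fun n => M (Sum.inr b, n)) fun n => hM _⟩⟩, rfl, ?_⟩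
  rintro ⟨a | b, n⟩ v hσ
  · obtain ⟨ha, rfl⟩ : a ∈ h.2.1 ∧ n = 0 := hσ
    obtain rfl : v = Fin.elim0 := funext fun i => i.elim0
    exact dif_pos ⟨ha, rfl⟩
  · exact dif_pos hσ

theorem hd_map [DirComplete α] (u : StrictFun α α) (x : RHS S L α) :
    hd ((RHS.map u u : StrictFun (RHS S L α) (RHS S L α)) x) = hd x := by
  induction x using WithBot.recBotCoe with
  | bot => rfl
  | coe x => rfl

theorem ap_map [DirComplete α] (u : StrictFun α α) (x : RHS S L α) (σ : Slot L)
    (v : Fin σ.2 → α) :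
    ap ((RHS.map u u : StrictFun (RHS S L α) (RHS S L α)) x) σ v =
      u (ap x σ fun i => u (v i)) := by
  induction x using WithBot.recBotCoe with
  | bot => exact u.strict.symm
  | coe x =>
    obtain ⟨s, ⟨A, f⟩, ⟨B, m⟩⟩ := x
    obtain ⟨a | b, n⟩ := σ
    · by_cases h : a ∈ A ∧ n = 0
      · have e : ap (WithBot.some ⟨s, ⟨A, f⟩, ⟨B, m⟩⟩ : RHS S L α) (Sum.inl a, n)
          (fun i => u (v i)) = f ⟨a, h.1⟩ := dif_pos h
        rw [e]
        exact dif_pos h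
      · have e : ap (WithBot.some ⟨s, ⟨A, f⟩, ⟨B, m⟩⟩ : RHS S L α) (Sum.inl a, n)
          (fun i => u (v i)) = ⊥ := dif_neg h
        rw [e, u.strict]
        exact dif_neg h
    · by_cases h : b ∈ B
      · have e : ap (WithBot.some ⟨s, ⟨A, f⟩, ⟨B, m⟩⟩ : RHS S L α) (Sum.inr b, n)
          (fun i => u (v i)) = m ⟨b, h⟩ (WithBot.some ⟨n, fun i => u (v i)⟩) := dif_pos h
        rw [e]
        exact dif_pos h
      · have e : ap (WithBot.some ⟨s, ⟨A, f⟩, ⟨B, m⟩⟩ : RHS S L α) (Sum.inr b, n)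
          (fun i => u (v i)) = ⊥ := dif_neg h
        rw [e, u.strict]
        exact dif_neg h

end RHS

namespace PreObj

local notation "O" => PreObj S L

/-- The header of an object. -/
noncomputable def hd (x : O) : Option (Header S L) := RHS.hd (foldIso.symm x)

/-- The function of an object at a slot. -/
noncomputable def ap (x : O) (σ : Slot L) : (Fin σ.2 → O) → O := RHS.ap (foldIso.symm x) σ

theorem hd_eq_none {x : O} : hd x = none ↔ x = ⊥ := by
  obtain ⟨y, rfl⟩ := (foldIso (S := S) (L := L)).surjective x
  rw [hd, foldIso.symm_apply_apply]
  induction y using WithBot.recBotCoe with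
  | bot => simp [RHS.hd]
  | coe y =>
    simp only [RHS.hd, reduceCtorEq, false_iff]
    rw [← (foldIso (S := S) (L := L)).map_bot]
    exact fun h => WithBot.coe_ne_bot (foldIso.injective h)

@[simp] theorem hd_bot : hd (⊥ : O) = none := hd_eq_none.2 rfl

theorem ne_bot_of_hd {x : O} {h : Header S L} (hx : hd x = some h) : x ≠ ⊥ := by
  rintro rfl
  simp at hx

theorem exists_hd {x : O} (hx : x ≠ ⊥) : ∃ h, hd x = some h :=
  Option.ne_none_iff_exists'.1 fun h => hx (hd_eq_none.1 h)

@[simp] theorem ap_bot (σ : Slot L) (v : Fin σ.2 → O) : ap ⊥ σ v = ⊥ := by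
  rw [ap, (foldIso (S := S) (L := L)).symm.map_bot]
  rfl

theorem le_iff {x y : O} : x ≤ y ↔ x = ⊥ ∨ (hd x = hd y ∧ ∀ σ v, ap x σ v ≤ ap y σ v) := by
  rw [← (foldIso (S := S) (L := L)).symm.le_iff_le, RHS.le_iff]
  have : (foldIso (S := S) (L := L)).symm x = ⊥ ↔ x = ⊥ := by
    exact map_eq_bot_iff foldIso.symm
  rw [this]
  rfl

theorem le_of_hd {x y : O} {h : Header S L} (hx : hd x = some h) :
    x ≤ y ↔ hd y = some h ∧ ∀ σ v, ap x σ v ≤ ap y σ v := by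
  rw [le_iff, hx]
  constructor
  · rintro (rfl | h')
    · simp at hx
    · exact ⟨h'.1.symm, h'.2⟩
  · exact fun h' => .inr ⟨h'.1.symm, h'.2⟩

theorem hd_of_le {x y : O} {h : Header S L} (hx : hd x = some h) (hxy : x ≤ y) :
    hd y = some h := ((le_of_hd hx).1 hxy).1

/-- Below an object with a header there are only `⊥` and objects with the same header. -/
theorem hd_of_ge {x y : O} {h : Header S L} (hy : hd y = some h) (hxy : x ≤ y) (hx : x ≠ ⊥) :
    hd x = some h := by
  rcases le_iff.1 hxy with h' | h'
  · exact absurd h' hx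
  · rw [h'.1, hy]

theorem ap_mono {x y : O} (hxy : x ≤ y) (σ : Slot L) (v : Fin σ.2 → O) : ap x σ v ≤ ap y σ v := by
  rcases le_iff.1 hxy with rfl | h'
  · simp
  · exact h'.2 σ v

theorem ext_hd_ap {x y : O} (h1 : hd x = hd y) (h2 : ∀ σ v, ap x σ v = ap y σ v) : x = y :=
  le_antisymm (le_iff.2 (.inr ⟨h1, fun σ v => (h2 σ v).le⟩))
    (le_iff.2 (.inr ⟨h1.symm, fun σ v => (h2 σ v).ge⟩))

theorem continuous_ap (x : O) (σ : Slot L) : ScottContinuous (ap x σ) := RHS.continuous_ap _ _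

theorem ap_monotone (x : O) (σ : Slot L) : Monotone (ap x σ) := (continuous_ap x σ).monotone

theorem ap_of_not_allowed {x : O} {h : Header S L} (hx : hd x = some h) {σ : Slot L}
    (hσ : ¬ σ.Allowed h) (v : Fin σ.2 → O) : ap x σ v = ⊥ := RHS.ap_of_not_allowed hx hσ v

theorem exists_mk (h : Header S L) (M : (σ : Slot L) → (Fin σ.2 → O) → O)
    (hM : ∀ σ, ScottContinuous (M σ)) :
    ∃ x : O, hd x = some h ∧ ∀ σ v, σ.Allowed h → ap x σ v = M σ v := by
  obtain ⟨y, h1, h2⟩ := RHS.exists_mk h M hM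
  refine ⟨foldIso y, ?_, ?_⟩
  · rwa [hd, foldIso.symm_apply_apply]
  · intro σ v hσ
    rw [ap, foldIso.symm_apply_apply]
    exact h2 σ v hσ

/-- Suprema of directed sets of objects are computed slotwise. -/
theorem isLUB_ap {d : Set O} (hne : d.Nonempty) (hd' : DirectedOn (· ≤ ·) d) {a : O}
    (ha : IsLUB d a) (σ : Slot L) (v : Fin σ.2 → O) :
    IsLUB ((fun x => ap x σ v) '' d) (ap a σ v) := by
  by_cases hx : ∃ x ∈ d, x ≠ ⊥
  · obtain ⟨x0, hx0, hb⟩ := hx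
    obtain ⟨h, hh⟩ := exists_hd hb
    have hha : hd a = some h := hd_of_le hh (ha.1 hx0)
    have hdir : ∀ σ v, DirectedOn (· ≤ ·) ((fun x => ap x σ v) '' d) := fun σ v =>
      directedOn_image (fun x y hxy => ap_mono hxy σ v) hd'
    choose M hM using fun (σ : Slot L) (v : Fin σ.2 → O) =>
      DirComplete.exists_isLUB _ (hne.image fun x => ap x σ v) (hdir σ v)
    have hMc : ∀ σ, ScottContinuous (M σ) := by
      intro σ s hs hsd w hw
      constructor
      · rintro _ ⟨u, hu, rfl⟩
        refine (hM σ u).2 ?_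
        rintro _ ⟨x, hx, rfl⟩
        exact (ap_monotone x σ (hw.1 hu)).trans ((hM σ w).1 ⟨x, hx, rfl⟩)
      · intro b hb
        refine (hM σ w).2 ?_
        rintro _ ⟨x, hx, rfl⟩
        refine (continuous_ap x σ hs hsd hw).2 ?_
        rintro _ ⟨u, hu, rfl⟩
        exact ((hM σ u).1 ⟨x, hx, rfl⟩).trans (hb ⟨u, hu, rfl⟩)
    obtain ⟨z, hz1, hz2⟩ := exists_mk h M hMc
    have hdx : ∀ x ∈ d, x ≠ ⊥ → hd x = some h := fun x hx hxb => hd_of_ge hha (ha.1 hx) hxb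
    have hz : a = z := by
      refine ha.unique ⟨?_, ?_⟩
      · intro x hx
        refine le_iff.2 (or_iff_not_imp_left.2 fun hxb => ⟨by rw [hdx x hx hxb, hz1], ?_⟩)
        intro σ v
        by_cases hσ : σ.Allowed h
        · rw [hz2 σ v hσ]
          exact (hM σ v).1 ⟨x, hx, rfl⟩
        · rw [ap_of_not_allowed (hdx x hx hxb) hσ]
          exact bot_le
      · intro u hu
        refine (le_of_hd hz1).2 ⟨hd_of_le hh (hu hx0), fun σ v => ?_⟩
        by_cases hσ : σ.Allowed h
        · rw [hz2 σ v hσ]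
          refine (hM σ v).2 ?_
          rintro _ ⟨x, hx, rfl⟩
          exact ap_mono (hu hx) σ v
        · rw [ap_of_not_allowed hz1 hσ]
          exact bot_le
    by_cases hσ : σ.Allowed h
    · rw [hz, hz2 σ v hσ]
      exact hM σ v
    · rw [ap_of_not_allowed hha hσ]
      refine ⟨?_, fun _ _ => bot_le⟩
      rintro _ ⟨x, hx, rfl⟩
      rw [← ap_of_not_allowed hha hσ v]
      exact ap_mono (ha.1 hx) σ v
  · push Not at hx
    obtain rfl : a = ⊥ := le_bot_iff.1 (ha.2 fun x hx' => (hx x hx').le)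
    refine ⟨?_, fun _ _ => by simp⟩
    rintro _ ⟨x, hx', rfl⟩
    simp [hx x hx']

/-! ### The approximating projections -/

/-- The `n`-th projection of the limit onto (the image of) the `n`-th iterate. -/
def cut (n : ℕ) : StrictFun O O := (emb n).comp (proj n)

theorem cut_zero (x : O) : cut 0 x = ⊥ :=
  ext fun k => by
    change link S L 0 k (x.val 0) = ⊥
    rw [link_zero_left]
    rfl

theorem cut_le (n : ℕ) (x : O) : cut n x ≤ x := emb_proj_le n x

theorem isLUB_cut (x : O) : IsLUB (range fun n => cut n x) x := isLUB_emb_proj x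

theorem cut_mono (x : O) : Monotone fun n => cut n x := emb_proj_mono x

/-- The truncations are transported by the functor of the domain equation. -/
theorem cut_succ_fold (n : ℕ) (y : RHS S L O) :
    cut (n + 1) (fold y) =
      fold ((RHS.map (cut n) (cut n) : StrictFun (RHS S L O) (RHS S L O)) y) := by
  refine ext fun k => ?_
  cases k with
  | zero => rfl
  | succ k =>
    have h1 := RHS.map_comp (S := S) (L := L) (emb n) (proj n) (link S L k n) (link S L n k)
    have h2 := RHS.map_comp (S := S) (L := L) (cut n) (cut n : StrictFun O O) (emb k) (proj k)
    have e1 : (cut n : StrictFun O O).comp (emb k) = (emb n).comp (link S L k n) := rfl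
    have e2 : (proj k).comp (cut n : StrictFun O O) = (link S L n k).comp (proj n) := rfl
    rw [e1, e2] at h2
    rw [← h2] at h1
    change link S L (n + 1) (k + 1) ((RHS.map (emb n) (proj n) :
      StrictFun (RHS S L O) (RHS S L (Level S L n))) y) = _
    rw [link_succ]
    exact congrArg (fun f : StrictFun (RHS S L O) (RHS S L (Level S L k)) => f y) h1

theorem foldIso_symm_cut (n : ℕ) (x : O) : foldIso.symm (cut (n + 1) x) =
    (RHS.map (cut n) (cut n) : StrictFun (RHS S L O) (RHS S L O)) (foldIso.symm x) := by
  rw [OrderIso.symm_apply_eq]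
  obtain ⟨y, rfl⟩ := (foldIso (S := S) (L := L)).surjective x
  rw [foldIso.symm_apply_apply]
  exact cut_succ_fold n y

theorem hd_cut (n : ℕ) (x : O) : hd (cut (n + 1) x) = hd x := by
  rw [hd, foldIso_symm_cut, RHS.hd_map]
  rfl

/-- Truncation at rank `n + 1` truncates arguments and results at rank `n`. All inductions on the
construction of the domain use this equation. -/
theorem ap_cut (n : ℕ) (x : O) (σ : Slot L) (v : Fin σ.2 → O) :
    ap (cut (n + 1) x) σ v = cut n (ap x σ fun i => cut n (v i)) := by
  rw [ap, foldIso_symm_cut, RHS.ap_map]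
  rfl

theorem cut_cut (n : ℕ) (x : O) : cut n (cut n x) = cut n x := by
  refine ext fun k => ?_
  change link S L n k (link S L n n (x.val n)) = link S L n k (x.val n)
  rw [link_self_apply]

end PreObj

end Api

/-! ### Compact elements -/

section Compact

variable {D : Type} [PartialOrder D]

theorem exists_upper_of_finite {s : Set D} (hne : s.Nonempty) (hs : DirectedOn (· ≤ ·) s)
    {A : Set D} (hA : A.Finite) (h : ∀ c ∈ A, ∃ x ∈ s, c ≤ x) : ∃ x ∈ s, ∀ c ∈ A, c ≤ x := by
  induction A, hA using Set.Finite.induction_on with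
  | empty =>
    obtain ⟨x, hx⟩ := hne
    exact ⟨x, hx, by simp⟩
  | @insert a A _ _ ih =>
    obtain ⟨x, hx, hxA⟩ := ih fun c hc => h c (.inr hc)
    obtain ⟨y, hy, hay⟩ := h a (.inl rfl)
    obtain ⟨z, hz, hxz, hyz⟩ := hs x hx y hy
    refine ⟨z, hz, ?_⟩
    rintro c (rfl | hc)
    · exact hay.trans hyz
    · exact (hxA c hc).trans hxz

theorem isCompactElement_of_isLUB {A : Set D} (hA : A.Finite) (hc : ∀ c ∈ A, IsCompactElement c)
    {a : D} (ha : IsLUB A a) : IsCompactElement a := by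
  intro s u hne hs hu hau
  obtain ⟨x, hx, hxA⟩ := exists_upper_of_finite hne hs hA fun c hcA =>
    hc c hcA s u hne hs hu ((ha.1 hcA).trans hau)
  exact ⟨x, hx, ha.2 hxA⟩

theorem isCompactElement_bot [OrderBot D] : IsCompactElement (⊥ : D) :=
  fun _ _ ⟨x, hx⟩ _ _ _ => ⟨x, hx, bot_le⟩

theorem exists_upper_of_finite_pi {ι : Type} [Finite ι] {s : Set (ι → D)} (hne : s.Nonempty)
    (hs : DirectedOn (· ≤ ·) s) {v : ι → D} (h : ∀ i, ∃ w ∈ s, v i ≤ w i) : ∃ w ∈ s, v ≤ w := by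
  choose w hw hvw using h
  obtain ⟨x, hx, hxA⟩ := exists_upper_of_finite hne hs (finite_range w)
    (by rintro _ ⟨i, rfl⟩; exact ⟨w i, hw i, le_rfl⟩)
  exact ⟨x, hx, fun i => (hvw i).trans (hxA _ ⟨i, rfl⟩ i)⟩

/-- A finite tuple of compact elements is compact in the pointwise order. -/
theorem isCompactElement_pi {ι : Type} [Finite ι] {v : ι → D} (hv : ∀ i, IsCompactElement (v i)) :
    IsCompactElement v := by
  intro s u hne hs hu hvu
  refine exists_upper_of_finite_pi hne hs fun i => ?_
  obtain ⟨_, ⟨w, hw, rfl⟩, hvw⟩ := hv i _ (u i) (hne.image _)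
    (directedOn_image (Function.monotone_eval i) hs) (isLUB_pi.1 hu i) (hvu i)
  exact ⟨w, hw, hvw⟩

theorem isLUB_univ_pi {ι : Type} {A : ι → Set D} (hne : ∀ i, (A i).Nonempty) {a : ι → D}
    (h : ∀ i, IsLUB (A i) (a i)) : IsLUB (univ.pi A) a := by
  refine isLUB_pi.2 fun i => ?_
  have : Function.eval i '' univ.pi A = A i :=
    eval_image_univ_pi (univ_pi_nonempty_iff.2 hne)
  rw [this]
  exact h i

theorem directedOn_univ_pi {ι : Type} {A : ι → Set D} (h : ∀ i, DirectedOn (· ≤ ·) (A i)) :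
    DirectedOn (· ≤ ·) (univ.pi A) := by
  intro x hx y hy
  choose z hz hxz hyz using fun i => h i (x i) (hx i trivial) (y i) (hy i trivial)
  exact ⟨z, fun i _ => hz i, hxz, hyz⟩

end Compact

namespace PreObj

variable {S L : Type}

local notation "O" => PreObj S L

/-! ### Bounded completeness -/

/-- A supremum of objects with a common header can be formed slotwise: it suffices that every slot
of `z` holds the suprema of the values of the members of `A`. -/
theorem isLUB_of_slots {A : Set O} {h : Header S L} {x0 : O} (hx0 : x0 ∈ A)
    (hA : ∀ x ∈ A, x ≠ ⊥ → hd x = some h) (hx0' : x0 ≠ ⊥) {z : O} (hz : hd z = some h)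
    (hz' : ∀ σ v, σ.Allowed h → IsLUB ((fun x => ap x σ v) '' A) (ap z σ v)) : IsLUB A z := by
  refine ⟨fun x hx => le_iff.2 (or_iff_not_imp_left.2 fun hxb => ⟨by rw [hA x hx hxb, hz], ?_⟩),
    fun u hu => (le_of_hd hz).2 ⟨hd_of_le (hA x0 hx0 hx0') (hu hx0), ?_⟩⟩
  · intro σ v
    by_cases hσ : σ.Allowed h
    · exact (hz' σ v hσ).1 ⟨x, hx, rfl⟩
    · rw [ap_of_not_allowed (hA x hx hxb) hσ]
      exact bot_le
  · intro σ v
    by_cases hσ : σ.Allowed h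
    · refine (hz' σ v hσ).2 ?_
      rintro _ ⟨x, hx, rfl⟩
      exact ap_mono (hu hx) σ v
    · rw [ap_of_not_allowed hz hσ]
      exact bot_le

/-- A pointwise supremum of continuous functions is continuous. -/
theorem scottContinuous_of_isLUB {α β : Type} [PartialOrder α] [PartialOrder β]
    {F : Set (α → β)} (hF : ∀ f ∈ F, ScottContinuous f) {g : α → β}
    (hg : ∀ x, IsLUB ((fun f : α → β => f x) '' F) (g x)) : ScottContinuous g := by
  intro s hs hsd w hw
  constructor
  · rintro _ ⟨u, hu, rfl⟩
    refine (hg u).2 ?_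
    rintro _ ⟨f, hf, rfl⟩
    exact ((hF f hf).monotone (hw.1 hu)).trans ((hg w).1 ⟨f, hf, rfl⟩)
  · intro b hb
    refine (hg w).2 ?_
    rintro _ ⟨f, hf, rfl⟩
    refine (hF f hf hs hsd hw).2 ?_
    rintro _ ⟨u, hu, rfl⟩
    exact ((hg u).1 ⟨f, hf, rfl⟩).trans (hb ⟨u, hu, rfl⟩)

/-- Bounded sets of objects of finite rank have suprema: by induction on the rank, since the
values of an object of rank `n + 1` have rank `n`, and suprema can be formed slotwise. -/
theorem exists_isLUB_of_cut_eq : ∀ (n : ℕ) (A : Set O), (∀ x ∈ A, cut n x = x) → BddAbove A →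
    ∃ a, IsLUB A a
  | 0, A, hA, _ => ⟨⊥, fun x hx => by rw [← hA x hx, cut_zero], fun _ _ => bot_le⟩
  | n + 1, A, hA, ⟨u, hu⟩ => by
    by_cases hx : ∃ x ∈ A, x ≠ ⊥
    · obtain ⟨x0, hx0, hx0'⟩ := hx
      obtain ⟨h, hh⟩ := exists_hd hx0'
      have hhu := hd_of_le hh (hu hx0)
      have key : ∀ (σ : Slot L) (v : Fin σ.2 → O), ∃ a, IsLUB ((fun x => ap x σ v) '' A) a := by
        intro σ v
        refine exists_isLUB_of_cut_eq n _ ?_ ⟨ap u σ v, ?_⟩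
        · rintro _ ⟨x, hx, rfl⟩
          dsimp only
          rw [← hA x hx, ap_cut, cut_cut]
        · rintro _ ⟨x, hx, rfl⟩
          exact ap_mono (hu hx) σ v
      choose M hM using key
      obtain ⟨z, hz1, hz2⟩ := exists_mk h M fun σ =>
        scottContinuous_of_isLUB (F := (fun x => ap x σ) '' A)
          (by rintro _ ⟨x, _, rfl⟩; exact continuous_ap x σ)
          (fun v => by rw [image_image]; exact hM σ v)
      refine ⟨z, isLUB_of_slots hx0 (fun x hx hxb => hd_of_ge hhu (hu hx) hxb) hx0' hz1 ?_⟩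
      intro σ v hσ
      rw [hz2 σ v hσ]
      exact hM σ v
    · push Not at hx
      exact ⟨⊥, fun x hx' => (hx x hx').le, fun _ _ => bot_le⟩

/-- Bounded sets of objects have suprema: the supremum is the limit of the suprema of the
truncations. -/
theorem exists_isLUB {A : Set O} (hA : BddAbove A) : ∃ a, IsLUB A a := by
  obtain ⟨u, hu⟩ := hA
  have key : ∀ n, ∃ a, IsLUB (cut n '' A) a := fun n =>
    exists_isLUB_of_cut_eq n _ (by rintro _ ⟨x, _, rfl⟩; exact cut_cut n x)
      ⟨u, by rintro _ ⟨x, hx, rfl⟩; exact (cut_le n x).trans (hu hx)⟩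
  choose a ha using key
  have hmono : Monotone a := by
    intro m n hmn
    refine (ha m).2 ?_
    rintro _ ⟨x, hx, rfl⟩
    exact (cut_mono x hmn).trans ((ha n).1 ⟨x, hx, rfl⟩)
  obtain ⟨b, hb⟩ := DirComplete.exists_isLUB (range a) (range_nonempty a)
    hmono.directed_le.directedOn_range
  refine ⟨b, fun x hx => (isLUB_cut x).2 ?_, fun c hc => hb.2 ?_⟩
  · rintro _ ⟨n, rfl⟩
    exact ((ha n).1 ⟨x, hx, rfl⟩).trans (hb.1 ⟨n, rfl⟩)
  · rintro _ ⟨n, rfl⟩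
    refine (ha n).2 ?_
    rintro _ ⟨x, hx, rfl⟩
    exact (cut_le n x).trans (hc hx)

open scoped Classical in
/-- The supremum of a bounded set of objects, and `⊥` for an unbounded set. -/
noncomputable def lub (A : Set O) : O := if h : ∃ a, IsLUB A a then h.choose else ⊥

theorem isLUB_lub {A : Set O} (hA : BddAbove A) : IsLUB A (lub A) := by
  have h := exists_isLUB hA
  rw [lub, dif_pos h]
  exact h.choose_spec

/-! ### Step objects -/

/-- The object with header `h` that is `⊥` at all slots. -/
noncomputable def head (h : Header S L) : O :=
  (exists_mk h (fun _ _ => ⊥) fun _ => .const ⊥).choose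

@[simp] theorem hd_head (h : Header S L) : hd (head h) = some h :=
  (exists_mk h (fun _ _ => ⊥) fun _ => .const ⊥).choose_spec.1

@[simp] theorem ap_head (h : Header S L) (σ : Slot L) (v : Fin σ.2 → O) :
    ap (head h) σ v = ⊥ := by
  by_cases hσ : σ.Allowed h
  · exact (exists_mk h (fun _ _ => ⊥) fun _ => .const ⊥).choose_spec.2 σ v hσ
  · exact ap_of_not_allowed (hd_head h) hσ v

theorem head_le_iff {h : Header S L} {x : O} : head h ≤ x ↔ hd x = some h := by
  rw [le_of_hd (hd_head h)]
  simp

open scoped Classical in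
theorem exists_step (h : Header S L) (σ : Slot L) {v : Fin σ.2 → O}
    (hv : ∀ i, IsCompactElement (v i)) (e : O) :
    ∃ x : O, hd x = some h ∧ ∀ (σ' : Slot L) (v' : Fin σ'.2 → O), σ'.Allowed h →
      ap x σ' v' =
        if (⟨σ, v⟩ : Σ σ : Slot L, Fin σ.2 → O) ≤ ⟨σ', v'⟩ then e else ⊥ := by
  refine exists_mk h _ fun σ' => ?_
  by_cases hσ : σ = σ'
  · subst hσ
    intro d hne hd' a ha
    constructor
    · rintro _ ⟨w, hw, rfl⟩
      dsimp only
      split_ifs with h1 h2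
      · exact le_rfl
      · exact absurd (h1.trans (Sigma.mk_le_mk_iff.2 (ha.1 hw))) h2
      · exact bot_le
      · exact bot_le
    · intro b hb
      dsimp only
      split_ifs with h1
      · obtain ⟨w, hw, hvw⟩ := isCompactElement_pi hv d a hne hd' ha (Sigma.mk_le_mk_iff.1 h1)
        have := hb ⟨w, hw, rfl⟩
        dsimp only at this
        rwa [if_pos (Sigma.mk_le_mk_iff.2 hvw)] at this
      · exact bot_le
  · have : ∀ v', ¬ (⟨σ, v⟩ : Σ σ : Slot L, Fin σ.2 → O) ≤ ⟨σ', v'⟩ := fun v' hle => by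
      obtain ⟨h, _⟩ := Sigma.le_def.1 hle
      exact hσ h
    simp only [this, if_false]
    exact .const ⊥

open scoped Classical in
/-- The least object with header `h` whose function at the slot `σ` returns (at least) `e` for the
compact arguments `v`. -/
noncomputable def step (h : Header S L) (σ : Slot L) (v : Fin σ.2 → O) (e : O) : O :=
  if hv : ∀ i, IsCompactElement (v i) then (exists_step h σ hv e).choose else ⊥

theorem hd_step {h : Header S L} {σ : Slot L} {v : Fin σ.2 → O}
    (hv : ∀ i, IsCompactElement (v i)) {e : O} : hd (step h σ v e) = some h := by
  rw [step, dif_pos hv]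
  exact (exists_step h σ hv e).choose_spec.1

open scoped Classical in
theorem ap_step {h : Header S L} {σ : Slot L} {v : Fin σ.2 → O}
    (hv : ∀ i, IsCompactElement (v i)) {e : O} {σ' : Slot L} {v' : Fin σ'.2 → O}
    (hσ' : σ'.Allowed h) :
    ap (step h σ v e) σ' v' =
      if (⟨σ, v⟩ : Σ σ : Slot L, Fin σ.2 → O) ≤ ⟨σ', v'⟩ then e else ⊥ := by
  rw [step, dif_pos hv]
  exact (exists_step h σ hv e).choose_spec.2 σ' v' hσ'

theorem ap_step_of_le {h : Header S L} {σ : Slot L} {v : Fin σ.2 → O}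
    (hv : ∀ i, IsCompactElement (v i)) {e : O} {v' : Fin σ.2 → O} (hσ : σ.Allowed h)
    (hvv' : v ≤ v') :
    ap (step h σ v e) σ v' = e := by
  rw [ap_step hv hσ, if_pos (Sigma.mk_le_mk_iff.2 hvv')]

theorem step_le_iff {h : Header S L} {σ : Slot L} {v : Fin σ.2 → O}
    (hv : ∀ i, IsCompactElement (v i)) {e : O} {x : O} :
    step h σ v e ≤ x ↔ hd x = some h ∧ (σ.Allowed h → e ≤ ap x σ v) := by
  rw [le_of_hd (hd_step hv)]
  refine and_congr_right fun _ => ⟨fun hx hσ => ?_, fun hx σ' v' => ?_⟩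
  · have := hx σ v
    rwa [ap_step_of_le hv hσ le_rfl] at this
  · by_cases hσ' : σ'.Allowed h
    · rw [ap_step hv hσ']
      split_ifs with hle
      · cases hle with
        | fiber _ _ _ hle => exact (hx hσ').trans (ap_monotone x σ hle)
      · exact bot_le
    · rw [ap_of_not_allowed (hd_step hv) hσ']
      exact bot_le

theorem isCompactElement_step {h : Header S L} {σ : Slot L} {v : Fin σ.2 → O}
    (hv : ∀ i, IsCompactElement (v i)) {e : O} (he : IsCompactElement e) :
    IsCompactElement (step h σ v e) := by
  intro d a hne hd' ha hle
  obtain ⟨h1, h2⟩ := (step_le_iff hv).1 hle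
  have hne' : ∃ x ∈ d, hd x = some h := by
    by_contra hcon
    push Not at hcon
    have : a = ⊥ := le_bot_iff.1 (ha.2 fun x hx => by
      by_contra hxb
      exact hcon x hx (hd_of_ge h1 (ha.1 hx) fun h0 => hxb h0.le))
    exact ne_bot_of_hd h1 this
  obtain ⟨x, hx, hxh⟩ := hne'
  by_cases hσ : σ.Allowed h
  · obtain ⟨_, ⟨y, hy, rfl⟩, hey⟩ := he _ _ (hne.image _)
      (directedOn_image (fun x y hxy => ap_mono hxy σ v) hd') (isLUB_ap hne hd' ha σ v) (h2 hσ)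
    obtain ⟨z, hz, hxz, hyz⟩ := hd' x hx y hy
    exact ⟨z, hz, (step_le_iff hv).2 ⟨hd_of_le hxh hxz, fun _ => hey.trans (ap_mono hyz σ v)⟩⟩
  · exact ⟨x, hx, (step_le_iff hv).2 ⟨hxh, fun h' => absurd h' hσ⟩⟩


theorem isCompactElement_head (h : Header S L) : IsCompactElement (head h : O) := by
  intro d a hne hd' ha hle
  by_contra hcon
  push Not at hcon
  have h1 := head_le_iff.1 hle
  have : a = ⊥ := le_bot_iff.1 (ha.2 fun x hx => by
    by_contra hxb
    exact hcon x hx (head_le_iff.2 (hd_of_ge h1 (ha.1 hx) fun h0 => hxb h0.le)))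
  exact ne_bot_of_hd h1 this

end PreObj

/-! ### Codes of compact objects -/

section Codes

/-- What an atom consists of: the code of a header and possibly a slot, a finite list of atoms for
each argument, and an atom for the result. An atom is coded by a number; it stands for the step
object with these data. -/
abbrev AtomData (L : Type) : Type := ℕ × Option (Slot L × List (List ℕ) × ℕ)

variable {S L : Type} [Primcodable L]

/-- The data of the atom with the given code. A number that is not a code stands for a bare header;
`decode₂` rejects such numbers, so that the atoms occurring in an atom have smaller codes. -/
def atomData (L : Type) [Primcodable L] (n : ℕ) : AtomData L :=
  (Encodable.decode₂ (AtomData L) n).getD (0, none)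

/-- The code of the header of an atom. -/
def hdCode (L : Type) [Primcodable L] (n : ℕ) : ℕ := (atomData L n).1

/-- The slot of an atom. -/
def slotOf (L : Type) [Primcodable L] (n : ℕ) : Option (Slot L) := (atomData L n).2.map fun b => b.1

/-- The atoms required of the `i`-th argument. -/
def argOf (L : Type) [Primcodable L] (n i : ℕ) : List ℕ :=
  ((atomData L n).2.map fun b => b.2.1.getD i []).getD []

/-- The atom that is returned. -/
def resOf (L : Type) [Primcodable L] (n : ℕ) : ℕ := ((atomData L n).2.map fun b => b.2.2).getD 0

theorem atomData_encode (d : AtomData L) : atomData L (Encodable.encode d) = d := by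
  simp [atomData]

theorem encode_mem_lt {l : List ℕ} {z : ℕ} (hz : z ∈ l) : z < Encodable.encode l := by
  induction l with
  | nil => simp at hz
  | cons a l ih =>
    rw [Encodable.encode_list_cons, Encodable.encode_nat]
    rcases List.mem_cons.1 hz with rfl | hz
    · exact Nat.lt_succ_of_le (Nat.left_le_pair _ _)
    · exact (ih hz).trans (Nat.lt_succ_of_le (Nat.right_le_pair _ _))

theorem encode_mem_lt' {l : List (List ℕ)} {m : List ℕ} (hm : m ∈ l) :
    Encodable.encode m < Encodable.encode l := by
  induction l with
  | nil => simp at hm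
  | cons a l ih =>
    rw [Encodable.encode_list_cons]
    rcases List.mem_cons.1 hm with rfl | hm
    · exact Nat.lt_succ_of_le (Nat.left_le_pair _ _)
    · exact (ih hm).trans (Nat.lt_succ_of_le (Nat.right_le_pair _ _))

theorem atomData_lt {n : ℕ} {b : Slot L × List (List ℕ) × ℕ} (h : (atomData L n).2 = some b) :
    b.2.2 < n ∧ ∀ l ∈ b.2.1, ∀ z ∈ l, z < n := by
  rw [atomData] at h
  cases hd : Encodable.decode₂ (AtomData L) n with
  | none => simp [hd] at h
  | some d =>
    rw [hd, Option.getD_some] at h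
    have hn : Encodable.encode d = n := Encodable.mem_decode₂.1 hd
    obtain ⟨k, o⟩ := d
    obtain rfl : o = some b := h
    have h1 : Encodable.encode b < n := by
      have e : Encodable.encode ((k, some b) : AtomData L) =
        Nat.pair k (Encodable.encode b).succ := rfl
      rw [← hn, e]
      exact lt_of_lt_of_le (Nat.lt_succ_self _) (Nat.right_le_pair _ _)
    have h2 : Encodable.encode b.2 ≤ Encodable.encode b := by
      obtain ⟨b1, b2⟩ := b
      rw [Encodable.encode_prod_val]
      exact Nat.right_le_pair _ _
    have h3 : b.2.2 ≤ Encodable.encode b.2 ∧ Encodable.encode b.2.1 ≤ Encodable.encode b.2 := by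
      obtain ⟨b1, b2, b3⟩ := b
      rw [Encodable.encode_prod_val]
      exact ⟨Nat.right_le_pair _ _, Nat.left_le_pair _ _⟩
    refine ⟨by omega, fun l hl z hz => ?_⟩
    have := encode_mem_lt hz
    have := encode_mem_lt' hl
    omega

theorem resOf_lt {n : ℕ} {σ : Slot L} (h : slotOf L n = some σ) : resOf L n < n := by
  obtain ⟨b, hb, _⟩ := Option.map_eq_some_iff.1 h
  rw [resOf, hb]
  exact (atomData_lt hb).1

theorem argOf_lt {n i z : ℕ} (h : z ∈ argOf L n i) : z < n := by
  rw [argOf] at h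
  cases hb : (atomData L n).2 with
  | none => simp [hb] at h
  | some b =>
    simp only [hb, Option.map_some, Option.getD_some] at h
    by_cases hi : i < b.2.1.length
    · rw [List.getD_eq_getElem _ _ hi] at h
      exact (atomData_lt hb).2 _ (List.getElem_mem hi) z h
    · rw [List.getD_eq_default _ _ (by omega)] at h
      simp at h

namespace PreObj

local notation "O" => PreObj S L

variable (hof : ℕ → Header S L)

open scoped Classical in
/-- The object denoted by an atom, where the atoms occurring in it denote the values of `f`. If the
requirements on an argument are inconsistent, the step function is void. -/
noncomputable def denOf (f : ℕ → O) (n : ℕ) : O :=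
  match slotOf L n with
  | none => head (hof (hdCode L n))
  | some σ =>
    if ∀ i < σ.2, BddAbove (f '' {z | z ∈ argOf L n i}) then
      step (hof (hdCode L n)) σ (fun i => lub (f '' {z | z ∈ argOf L n i})) (f (resOf L n))
    else head (hof (hdCode L n))

/-- The object denoted by an atom. -/
noncomputable def den (n : ℕ) : O := denOf hof (fun z => if z < n then den z else ⊥) n
termination_by n

theorem den_eq (n : ℕ) : den hof n = denOf hof (den hof) n := by
  rw [den, denOf, denOf]
  cases h : slotOf L n with
  | none => rfl
  | some σ =>
    have e : ∀ i, (fun z => if z < n then den hof z else ⊥) '' {z | z ∈ argOf L n i} =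
        den hof '' {z | z ∈ argOf L n i} := fun i =>
      image_congr fun z hz => if_pos (argOf_lt hz)
    have e' : (∀ i < σ.2, BddAbove ((fun z => if z < n then den hof z else ⊥) ''
        {z | z ∈ argOf L n i})) ↔ ∀ i < σ.2, BddAbove (den hof '' {z | z ∈ argOf L n i}) := by
      simp only [e]
    by_cases hc : ∀ i < σ.2, BddAbove (den hof '' {z | z ∈ argOf L n i})
    · simp only [if_pos hc, if_pos (e'.2 hc), e, resOf_lt h, if_true]
    · simp only [if_neg hc, if_neg fun h => hc (e'.1 h)]

/-- The consistency of a finite list of atoms. -/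
def Con (X : List ℕ) : Prop := BddAbove (den hof '' {z | z ∈ X})

/-- The supremum of a consistent finite list of atoms, and `⊥` for an inconsistent one. -/
noncomputable def join (X : List ℕ) : O := lub (den hof '' {z | z ∈ X})

variable {hof}

theorem isLUB_join {X : List ℕ} (hX : Con hof X) :
    IsLUB (den hof '' {z | z ∈ X}) (join hof X) := isLUB_lub hX

theorem con_iff {X : List ℕ} : Con hof X ↔ ∃ u, ∀ z ∈ X, den hof z ≤ u := by
  simp [Con, BddAbove, upperBounds, Set.Nonempty]

theorem den_le_join {X : List ℕ} (hX : Con hof X) {z : ℕ} (hz : z ∈ X) :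
    den hof z ≤ join hof X := (isLUB_join hX).1 ⟨z, hz, rfl⟩

theorem join_le_iff {X : List ℕ} (hX : Con hof X) {u : O} :
    join hof X ≤ u ↔ ∀ z ∈ X, den hof z ≤ u := by
  rw [isLUB_le_iff (isLUB_join hX)]
  simp [upperBounds]

theorem con_nil : Con hof [] := con_iff.2 ⟨⊥, by simp⟩

@[simp] theorem join_nil : join hof [] = ⊥ :=
  le_bot_iff.1 ((join_le_iff con_nil).2 (by simp))

theorem Con.mono {X Y : List ℕ} (hY : Con hof Y) (h : X ⊆ Y) : Con hof X := by
  obtain ⟨u, hu⟩ := con_iff.1 hY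
  exact con_iff.2 ⟨u, fun z hz => hu z (h hz)⟩

theorem isCompactElement_join_of {X : List ℕ} (h : ∀ z ∈ X, IsCompactElement (den hof z)) :
    IsCompactElement (join hof X) := by
  by_cases hX : Con hof X
  · exact isCompactElement_of_isLUB ((List.finite_toSet X).image _)
      (by rintro _ ⟨z, hz, rfl⟩; exact h z hz) (isLUB_join hX)
  · have : join hof X = ⊥ := by
      rw [join, lub, dif_neg]
      rintro ⟨a, ha⟩
      exact hX ⟨a, ha.1⟩
    rw [this]
    exact isCompactElement_bot

theorem isCompactElement_den (n : ℕ) : IsCompactElement (den hof n) := by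
  induction n using Nat.strong_induction_on with
  | _ n ih =>
    rw [den_eq, denOf]
    cases h : slotOf L n with
    | none => exact isCompactElement_head _
    | some σ =>
      dsimp only
      split_ifs
      · exact isCompactElement_step
          (fun i => isCompactElement_join_of fun z hz => ih z (argOf_lt hz)) (ih _ (resOf_lt h))
      · exact isCompactElement_head _

theorem isCompactElement_join (X : List ℕ) : IsCompactElement (join hof X) :=
  isCompactElement_join_of fun z _ => isCompactElement_den z

theorem den_le_iff {n : ℕ} {x : O} :
    den hof n ≤ x ↔ hd x = some (hof (hdCode L n)) ∧
      ∀ σ, slotOf L n = some σ → σ.Allowed (hof (hdCode L n)) →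
        (∀ i < σ.2, Con hof (argOf L n i)) →
          den hof (resOf L n) ≤ ap x σ fun i => join hof (argOf L n i) := by
  rw [den_eq, denOf]
  cases h : slotOf L n with
  | none => simp [head_le_iff]
  | some σ =>
    dsimp only
    split_ifs with hc
    · refine (step_le_iff fun i => isCompactElement_join _).trans ?_
      refine and_congr_right fun _ => ⟨fun h2 σ' e hσ' _ => ?_, fun h2 hσ => h2 σ rfl hσ hc⟩
      obtain rfl := Option.some_injective _ e
      exact h2 hσ'
    · rw [head_le_iff]
      refine ⟨fun h2 => ⟨h2, fun σ' e _ h3 => ?_⟩, fun h2 => h2.1⟩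
      obtain rfl := Option.some_injective _ e
      exact absurd h3 hc

theorem hd_den (n : ℕ) : hd (den hof n) = some (hof (hdCode L n)) := (den_le_iff.1 le_rfl).1

/-- There is an atom for each step object with finite joins of atoms as its arguments. -/
theorem exists_den_le_iff (k : ℕ) (σ : Slot L) (X : Fin σ.2 → List ℕ) (hX : ∀ i, Con hof (X i))
    (t : ℕ) : ∃ n, hdCode L n = k ∧ ∀ x : O, den hof n ≤ x ↔ hd x = some (hof k) ∧
      (σ.Allowed (hof k) → den hof t ≤ ap x σ fun i => join hof (X i)) := by
  have hd1 := atomData_encode ((k, some (σ, List.ofFn X, t)) : AtomData L)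
  refine ⟨_, congrArg Prod.fst hd1, fun x => ?_⟩
  generalize Encodable.encode ((k, some (σ, List.ofFn X, t)) : AtomData L) = n at hd1
  have e1 : hdCode L n = k := by rw [hdCode, hd1]
  have e2 : slotOf L n = some σ := by rw [slotOf, hd1]; rfl
  have e3 : resOf L n = t := by rw [resOf, hd1]; rfl
  have e4 : ∀ i : Fin σ.2, argOf L n i = X i := fun i => by
    rw [argOf, hd1]
    simp
  rw [den_le_iff, e1, e2, e3]
  refine and_congr_right fun _ => ?_
  simp only [Option.some.injEq, forall_eq', e4]
  exact forall_congr' fun _ => imp_iff_right fun i hi => (e4 ⟨i, hi⟩) ▸ hX ⟨i, hi⟩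

theorem exists_den_eq_head (k : ℕ) : ∃ n, ∀ x : O, den hof n ≤ x ↔ hd x = some (hof k) := by
  have hd1 := atomData_encode ((k, none) : AtomData L)
  refine ⟨Encodable.encode ((k, none) : AtomData L), fun x => ?_⟩
  generalize Encodable.encode ((k, none) : AtomData L) = n at hd1
  have e1 : hdCode L n = k := by rw [hdCode, hd1]
  have e2 : slotOf L n = none := by rw [slotOf, hd1]; rfl
  rw [den_le_iff, e1, e2]
  simp

/-! ### Objects are suprema of atoms -/

/-- The finite joins of atoms below `x`. -/
def approx (hof : ℕ → Header S L) (x : O) : Set O :=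
  {w | ∃ X : List ℕ, (∀ k ∈ X, den hof k ≤ x) ∧ w = join hof X}

theorem approx_nonempty (x : O) : (approx hof x).Nonempty := ⟨join hof [], [], by simp, rfl⟩

theorem le_of_mem_approx {x w : O} (hw : w ∈ approx hof x) : w ≤ x := by
  obtain ⟨X, hX, rfl⟩ := hw
  exact (join_le_iff (con_iff.2 ⟨x, hX⟩)).2 hX

theorem directedOn_approx (x : O) : DirectedOn (· ≤ ·) (approx hof x) := by
  rintro _ ⟨X, hX, rfl⟩ _ ⟨Y, hY, rfl⟩
  have hXY : ∀ k ∈ X ++ Y, den hof k ≤ x := fun k hk =>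
    (List.mem_append.1 hk).elim (hX k) (hY k)
  have hc : Con hof (X ++ Y) := con_iff.2 ⟨x, hXY⟩
  refine ⟨_, ⟨X ++ Y, hXY, rfl⟩, ?_, ?_⟩
  · exact (join_le_iff (con_iff.2 ⟨x, hX⟩)).2 fun z hz => den_le_join hc (by simp [hz])
  · exact (join_le_iff (con_iff.2 ⟨x, hY⟩)).2 fun z hz => den_le_join hc (by simp [hz])

theorem den_mem_approx {x : O} {k : ℕ} (hk : den hof k ≤ x) : den hof k ∈ approx hof x := by
  have hc : Con hof [k] := con_iff.2 ⟨x, by simpa using hk⟩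
  exact ⟨[k], by simpa using hk, le_antisymm (den_le_join hc (by simp))
    ((join_le_iff hc).2 (by simp))⟩

/-- Every truncation of `x` is below each upper bound of the finite joins of atoms below `x`. By
induction on the rank: a value of `x` at truncated arguments is approximated by its values at
finite joins of atoms, and each atom below such a value yields an atom below `x`. -/
theorem cut_le_of_approx (hsurj : Function.Surjective hof) :
    ∀ (n : ℕ) (x u : O), u ∈ upperBounds (approx hof x) → cut n x ≤ u
  | 0, x, u, _ => by rw [cut_zero]; exact bot_le
  | n + 1, x, u, hu => by
    by_cases hx : x = ⊥
    · rw [hx, (cut (n + 1)).strict]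
      exact bot_le
    obtain ⟨h, hh⟩ := exists_hd hx
    obtain ⟨k, rfl⟩ := hsurj h
    have hdu : hd u = some (hof k) := by
      obtain ⟨m, hm⟩ := exists_den_eq_head (hof := hof) k
      exact (hm u).1 (hu (den_mem_approx ((hm x).2 hh)))
    refine (le_of_hd ((hd_cut n x).trans hh)).2 ⟨hdu, fun σ v => ?_⟩
    by_cases hσ : σ.Allowed (hof k)
    swap
    · rw [ap_of_not_allowed ((hd_cut n x).trans hh) hσ]
      exact bot_le
    rw [ap_cut]
    -- `a i` is the supremum of the atoms below `v i`
    choose a ha using fun i => DirComplete.exists_isLUB (approx hof (v i))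
      (approx_nonempty _) (directedOn_approx _)
    have hne : ∀ i, (approx hof (v i)).Nonempty := fun i => approx_nonempty _
    have hpne := univ_pi_nonempty_iff.2 hne
    have hdir := directedOn_univ_pi fun i => directedOn_approx (hof := hof) (v i)
    have hlub := isLUB_univ_pi hne ha
    have h1 : (fun i => cut n (v i)) ≤ a := fun i =>
      cut_le_of_approx hsurj n (v i) (a i) (ha i).1
    refine ((cut n).mono (ap_monotone x σ h1)).trans ?_
    have hc := (continuous_ap x σ).comp (cut n).continuous hpne hdir hlub
    refine hc.2 ?_
    rintro _ ⟨w, hw, rfl⟩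
    refine cut_le_of_approx hsurj n (ap x σ w) _ ?_
    rintro _ ⟨Y, hY, rfl⟩
    refine (join_le_iff (con_iff.2 ⟨_, hY⟩)).2 fun t ht => ?_
    choose X hX using fun i => hw i trivial
    have hXc : ∀ i, Con hof (X i) := fun i => con_iff.2 ⟨_, (hX i).1⟩
    have hwX : w = fun i => join hof (X i) := funext fun i => (hX i).2
    obtain ⟨m, _, hm⟩ := exists_den_le_iff k σ X hXc t
    have hmx : den hof m ≤ x := (hm x).2 ⟨hh, fun _ => by rw [← hwX]; exact hY t ht⟩
    have := ((hm u).1 (hu (den_mem_approx hmx))).2 hσ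
    rw [← hwX] at this
    exact this.trans (ap_monotone u σ fun i => le_of_mem_approx (hw i trivial))

/-- Every object is the supremum of the finite joins of atoms below it. -/
theorem isLUB_approx (hsurj : Function.Surjective hof) (x : O) : IsLUB (approx hof x) x :=
  ⟨fun _ hw => le_of_mem_approx hw, fun u hu => (isLUB_cut x).2 (by
    rintro _ ⟨n, rfl⟩
    exact cut_le_of_approx hsurj n x u hu)⟩

/-- The compact objects are finite joins of atoms. -/
theorem exists_eq_join (hsurj : Function.Surjective hof) {c : O} (hc : IsCompactElement c) :
    ∃ X, Con hof X ∧ c = join hof X := by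
  obtain ⟨w, hw, hcw⟩ := hc _ c (approx_nonempty c) (directedOn_approx c) (isLUB_approx hsurj c)
    le_rfl
  obtain rfl := le_antisymm hcw (le_of_mem_approx hw)
  obtain ⟨X, hX, hcX⟩ := hw
  exact ⟨X, con_iff.2 ⟨_, hX⟩, hcX⟩

/-- An inequality can be tested on atoms. -/
theorem le_of_forall_den (hsurj : Function.Surjective hof) {x y : O}
    (h : ∀ n, den hof n ≤ x → den hof n ≤ y) : x ≤ y :=
  (isLUB_approx hsurj x).2 (by
    rintro _ ⟨X, hX, rfl⟩
    exact (join_le_iff (con_iff.2 ⟨x, hX⟩)).2 fun z hz => h z (hX z hz))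

end PreObj

end Codes

namespace PreObj

variable {S L : Type}

local notation "O" => PreObj S L

theorem exists_primcodable (α : Type) [Countable α] : Nonempty (Primcodable α) := by
  rcases finite_or_infinite α with h | h
  · obtain ⟨n, ⟨e⟩⟩ := Finite.exists_equiv_fin α
    exact ⟨Primcodable.ofEquiv _ e⟩
  · obtain ⟨e⟩ := nonempty_equiv_of_countable (α := α) (β := ℕ)
    exact ⟨Primcodable.ofEquiv _ e⟩

theorem eq_bot_of_isEmpty [IsEmpty S] (x : O) : x = ⊥ := by
  by_contra hx
  obtain ⟨h, _⟩ := exists_hd hx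
  exact isEmptyElim h.1

/-- The domain of raw objects is a Scott domain. -/
theorem isScottDomain [Countable S] [Countable L] : IsScottDomain O where
  exists_isBot := ⟨⊥, fun _ => bot_le⟩
  exists_isLUB_directed := DirComplete.exists_isLUB
  exists_isLUB_pair _ _ h := exists_isLUB h
  countable := by
    rcases isEmpty_or_nonempty S with hS | hS
    · exact (countable_singleton (⊥ : O)).mono fun x _ => eq_bot_of_isEmpty x
    · obtain ⟨hL⟩ := exists_primcodable L
      obtain ⟨hof, hsurj⟩ := exists_surjective_nat (Header S L)
      refine (countable_range (join hof)).mono fun c hc => ?_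
      obtain ⟨X, _, rfl⟩ := exists_eq_join hsurj hc
      exact ⟨X, rfl⟩
  directed x := by
    rintro c ⟨hc, hcx⟩ d ⟨hd, hdx⟩
    obtain ⟨z, hz⟩ := exists_isLUB (A := {c, d}) ⟨x, by rintro _ (rfl | rfl) <;> assumption⟩
    refine ⟨z, ⟨isCompactElement_of_isLUB (toFinite _) ?_ hz, hz.2 ?_⟩, hz.1 (.inl rfl),
      hz.1 (.inr rfl)⟩ <;> rintro _ (rfl | rfl) <;> assumption
  isLUB x := by
    refine ⟨fun c hc => hc.2, fun u hu => ?_⟩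
    rcases isEmpty_or_nonempty S with hS | hS
    · rw [eq_bot_of_isEmpty x]
      exact bot_le
    · obtain ⟨hL⟩ := exists_primcodable L
      obtain ⟨hof, hsurj⟩ := exists_surjective_nat (Header S L)
      exact le_of_forall_den hsurj fun n hn =>
        (hu ⟨isCompactElement_den n, hn⟩ : den hof n ≤ u)

end PreObj

/-! ### Suprema of finite sets of atoms -/

namespace PreObj

variable {S L : Type} [Primcodable L] {hof : ℕ → Header S L}

local notation "O" => PreObj S L

/-- The atoms of `X` at the slot `σ` that fire at the argument `v`. -/
def active (hof : ℕ → Header S L) (X : List ℕ) (σ : Slot L) (v : Fin σ.2 → O) : Set ℕ :=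
  {j | j ∈ X ∧ slotOf L j = some σ ∧ ∀ i : Fin σ.2, ∀ z ∈ argOf L j i, den hof z ≤ v i}

/-- The value of the supremum of atoms at `v` is the supremum of the results of the atoms that fire
at `v`, and the supremum of the atoms exists if all these suprema do. -/
theorem exists_isLUB_active {X : List ℕ} (hX : X ≠ []) {h : Header S L}
    (hh : ∀ j ∈ X, hof (hdCode L j) = h)
    (hb : ∀ σ : Slot L, σ.Allowed h → ∀ v : Fin σ.2 → O,
      BddAbove ((fun j => den hof (resOf L j)) '' active hof X σ v)) :
    ∃ z, IsLUB (den hof '' {j | j ∈ X}) z ∧ hd z = some h ∧ ∀ σ v, σ.Allowed h →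
      IsLUB ((fun j => den hof (resOf L j)) '' active hof X σ v) (ap z σ v) := by
  classical
  let f : ∀ σ : Slot L, (Fin σ.2 → O) → O := fun σ v =>
    if σ.Allowed h then lub ((fun j => den hof (resOf L j)) '' active hof X σ v) else ⊥
  have hf : ∀ σ v, σ.Allowed h →
      IsLUB ((fun j => den hof (resOf L j)) '' active hof X σ v) (f σ v) := fun σ v hσ => by
    dsimp only [f]
    rw [if_pos hσ]
    exact isLUB_lub (hb σ hσ v)
  have hcont : ∀ σ, ScottContinuous (f σ) := by
    intro σ
    by_cases hσ : σ.Allowed h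
    swap
    · have : f σ = fun _ => ⊥ := funext fun v => if_neg hσ
      rw [this]
      exact .const ⊥
    intro d hne hd a ha
    constructor
    · rintro _ ⟨v, hv, rfl⟩
      refine (hf σ v hσ).2 ?_
      rintro _ ⟨j, ⟨hj1, hj2, hj3⟩, rfl⟩
      exact (hf σ a hσ).1 ⟨j, ⟨hj1, hj2, fun i z hz => (hj3 i z hz).trans (ha.1 hv i)⟩, rfl⟩
    · intro u hu
      refine (hf σ a hσ).2 ?_
      rintro _ ⟨j, ⟨hj1, hj2, hj3⟩, rfl⟩
      -- finitely many requirements are met already at an element of the directed set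
      have hc : ∀ i : Fin σ.2, Con hof (argOf L j i) := fun i => con_iff.2 ⟨_, hj3 i⟩
      obtain ⟨v, hv, hle⟩ := isCompactElement_pi
        (fun i : Fin σ.2 => isCompactElement_join (hof := hof) (argOf L j i)) d a hne hd ha
        fun i => (join_le_iff (hc i)).2 (hj3 i)
      exact ((hf σ v hσ).1 ⟨j, ⟨hj1, hj2, fun i z hz => (den_le_join (hc i) hz).trans (hle i)⟩,
        rfl⟩).trans (hu ⟨v, hv, rfl⟩)
  obtain ⟨z, hz, hzf⟩ := exists_mk h f hcont
  have hzl : ∀ σ v, σ.Allowed h →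
      IsLUB ((fun j => den hof (resOf L j)) '' active hof X σ v) (ap z σ v) := fun σ v hσ => by
    rw [hzf σ v hσ]
    exact hf σ v hσ
  refine ⟨z, ⟨?_, fun u hu => ?_⟩, hz, hzl⟩
  · rintro _ ⟨j, hj, rfl⟩
    refine den_le_iff.2 ⟨hz.trans (congrArg some (hh j hj).symm), fun σ hσ ha hc => ?_⟩
    rw [hh j hj] at ha
    exact (hzl σ _ ha).1 ⟨j, ⟨hj, hσ, fun i w hw => den_le_join (hc i i.2) hw⟩, rfl⟩
  · have hu' : ∀ j ∈ X, hd u = some h := fun j hj => by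
      rw [← hh j hj]
      exact (den_le_iff.1 (hu ⟨j, hj, rfl⟩)).1
    obtain ⟨j0, hj0⟩ := List.exists_mem_of_ne_nil X hX
    refine (le_of_hd hz).2 ⟨hu' j0 hj0, fun σ v => ?_⟩
    by_cases hσ : σ.Allowed h
    swap
    · rw [ap_of_not_allowed hz hσ]
      exact bot_le
    refine (hzl σ v hσ).2 ?_
    rintro _ ⟨j, ⟨hj1, hj2, hj3⟩, rfl⟩
    have hc : ∀ i < σ.2, Con hof (argOf L j i) := fun i hi => con_iff.2 ⟨_, hj3 ⟨i, hi⟩⟩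
    refine ((den_le_iff.1 (hu ⟨j, hj1, rfl⟩)).2 σ hj2 ((hh j hj1).symm ▸ hσ) hc).trans ?_
    exact ap_monotone u σ fun i => (join_le_iff (hc i i.2)).2 (hj3 i)

theorem hof_eq_of_hd_join {X : List ℕ} (hX : Con hof X) {h : Header S L}
    (hh : hd (join hof X) = some h) {j : ℕ} (hj : j ∈ X) : hof (hdCode L j) = h := by
  have := (den_le_iff.1 (den_le_join hX hj)).1
  rw [hh] at this
  exact (Option.some_injective _ this).symm

/-- The value of a consistent join of atoms is the supremum of the results of the atoms that
fire. -/
theorem isLUB_ap_join {X : List ℕ} (hX : Con hof X) {h : Header S L}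
    (hh : hd (join hof X) = some h) {σ : Slot L} (hσ : σ.Allowed h) (v : Fin σ.2 → O) :
    IsLUB ((fun j => den hof (resOf L j)) '' active hof X σ v) (ap (join hof X) σ v) := by
  have hne : X ≠ [] := by
    rintro rfl
    simp at hh
  have hb : ∀ σ : Slot L, σ.Allowed h → ∀ v : Fin σ.2 → O,
      BddAbove ((fun j => den hof (resOf L j)) '' active hof X σ v) := by
    refine fun σ hσ v => ⟨ap (join hof X) σ v, ?_⟩
    rintro _ ⟨j, ⟨hj1, hj2, hj3⟩, rfl⟩
    have hc : ∀ i < σ.2, Con hof (argOf L j i) := fun i hi => con_iff.2 ⟨_, hj3 ⟨i, hi⟩⟩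
    refine ((den_le_iff.1 (den_le_join hX hj1)).2 σ hj2
      ((hof_eq_of_hd_join hX hh hj1).symm ▸ hσ) hc).trans ?_
    exact ap_monotone _ σ fun i => (join_le_iff (hc i i.2)).2 (hj3 i)
  obtain ⟨z, hz, _, hz'⟩ := exists_isLUB_active hne (fun j hj => hof_eq_of_hd_join hX hh hj) hb
  rw [(isLUB_join hX).unique hz]
  exact hz' σ v hσ

theorem hd_join_of_mem {X : List ℕ} (hX : Con hof X) {j : ℕ} (hj : j ∈ X) :
    hd (join hof X) = some (hof (hdCode L j)) := (den_le_iff.1 (den_le_join hX hj)).1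

theorem exists_mem_of_hd_join {X : List ℕ} {h : Header S L} (hh : hd (join hof X) = some h) :
    ∃ j, j ∈ X := by
  refine List.exists_mem_of_ne_nil X ?_
  rintro rfl
  simp at hh

/-- The value of a supremum of atoms is the supremum of the results of some of them. -/
theorem exists_sublist_ap_join {X : List ℕ} (hX : Con hof X) {h : Header S L}
    (hh : hd (join hof X) = some h) {σ : Slot L} (hσ : σ.Allowed h) (v : Fin σ.2 → O) :
    ∃ J ∈ X.sublists', (∀ j ∈ J, j ∈ active hof X σ v) ∧ Con hof (J.map (resOf L)) ∧
      ap (join hof X) σ v = join hof (J.map (resOf L)) := by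
  classical
  have hl := isLUB_ap_join hX hh hσ v
  have hJ : ∀ {j}, j ∈ X.filter (fun j => j ∈ active hof X σ v) ↔ j ∈ active hof X σ v := by
    intro j
    simp only [List.mem_filter, decide_eq_true_eq]
    exact ⟨fun h => h.2, fun h => ⟨h.1, h⟩⟩
  have e : den hof '' {z | z ∈ (X.filter fun j => j ∈ active hof X σ v).map (resOf L)} =
      (fun j => den hof (resOf L j)) '' active hof X σ v := by
    ext x
    constructor
    · rintro ⟨z, hz, rfl⟩
      obtain ⟨j, hj, rfl⟩ := List.mem_map.1 hz
      exact ⟨j, hJ.1 hj, rfl⟩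
    · rintro ⟨j, hj, rfl⟩
      exact ⟨_, List.mem_map.2 ⟨j, hJ.2 hj, rfl⟩, rfl⟩
  rw [← e] at hl
  have hc : Con hof ((X.filter fun j => j ∈ active hof X σ v).map (resOf L)) := ⟨_, hl.1⟩
  exact ⟨_, List.mem_sublists'.2 List.filter_sublist, fun j hj => hJ.1 hj, hc,
    hl.unique (isLUB_join hc)⟩

/-- The values of a compact object are compact: they are finite suprema of results of atoms. -/
theorem isCompactElement_ap [Countable S] {o : O} (ho : IsCompactElement o) (σ : Slot L)
    (v : Fin σ.2 → O) : IsCompactElement (ap o σ v) := by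
  by_cases hb : o = ⊥
  · rw [hb, ap_bot]
    exact isCompactElement_bot
  obtain ⟨h, hh⟩ := exists_hd hb
  by_cases hσ : σ.Allowed h
  swap
  · rw [ap_of_not_allowed hh hσ]
    exact isCompactElement_bot
  have : Nonempty (Header S L) := ⟨h⟩
  obtain ⟨hof, hsurj⟩ := exists_surjective_nat (Header S L)
  obtain ⟨X, hX, rfl⟩ := exists_eq_join hsurj ho
  refine isCompactElement_of_isLUB (((List.finite_toSet X).subset fun j hj => hj.1).image _) ?_
    (isLUB_ap_join hX hh hσ v)
  rintro _ ⟨j, _, rfl⟩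
  exact isCompactElement_den _

/-- The atom `j` has a slot, and its header allows it. -/
def Act (hof : ℕ → Header S L) (j : ℕ) : Prop :=
  ∃ σ, slotOf L j = some σ ∧ σ.Allowed (hof (hdCode L j))

/-- The number of arguments at the slot of an atom. -/
def numArgs (L : Type) [Primcodable L] (j : ℕ) : ℕ := ((slotOf L j).map fun σ => σ.2).getD 0

theorem numArgs_eq {j : ℕ} {σ : Slot L} (h : slotOf L j = some σ) : numArgs L j = σ.2 := by
  simp [numArgs, h]

/-- One unfolding of the recursive characterization of consistency, relative to a predicate `P` in
place of the consistency of the lists of results and of arguments. -/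
def ConStep (hof : ℕ → Header S L) (P : List ℕ → Prop) (X : List ℕ) : Prop :=
  (∀ i ∈ X, ∀ j ∈ X, hof (hdCode L i) = hof (hdCode L j)) ∧
  ∀ J ∈ X.sublists', (∀ j ∈ J, Act hof j) → (∀ i ∈ J, ∀ j ∈ J, slotOf L i = slotOf L j) →
    ∀ k ∈ J, (∀ i ∈ List.range (numArgs L k), P (J.flatMap fun j => argOf L j i)) →
      P (J.map (resOf L))

/-- A list of atoms is consistent if the headers agree and, whenever the arguments of some of its
atoms at a common slot are consistent, then so are their results. -/
theorem con_iff_conStep {X : List ℕ} : Con hof X ↔ ConStep hof (Con hof) X := by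
  classical
  constructor
  · intro hX
    refine ⟨fun i hi j hj => Option.some_injective _
      ((hd_join_of_mem hX hi).symm.trans (hd_join_of_mem hX hj)), ?_⟩
    intro J hJX hJ1 hJ2 k hk hc
    have hJX : J ⊆ X := (List.mem_sublists'.1 hJX).subset
    obtain ⟨σ, hσ, ha⟩ := hJ1 k hk
    rw [numArgs_eq hσ] at hc
    simp only [List.mem_range] at hc
    have hl := isLUB_ap_join hX (hd_join_of_mem hX (hJX hk)) ha
      fun i : Fin σ.2 => join hof (J.flatMap fun j => argOf L j i)
    refine con_iff.2 ⟨ap (join hof X) σ fun i : Fin σ.2 =>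
      join hof (J.flatMap fun j => argOf L j i), fun z hz => ?_⟩
    obtain ⟨j, hj, rfl⟩ := List.mem_map.1 hz
    exact hl.1 ⟨j, ⟨hJX hj, (hJ2 j hj k hk).trans hσ,
      fun i z hz => den_le_join (hc i i.2) (List.mem_flatMap.2 ⟨j, hj, hz⟩)⟩, rfl⟩
  · rintro ⟨h1, h2⟩
    rcases eq_or_ne X [] with rfl | hne
    · exact con_nil
    obtain ⟨j0, hj0⟩ := List.exists_mem_of_ne_nil X hne
    have hh : ∀ j ∈ X, hof (hdCode L j) = hof (hdCode L j0) := fun j hj => h1 j hj j0 hj0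
    obtain ⟨z, hz, _⟩ := exists_isLUB_active hne hh fun σ hσ v => by
      -- the atoms that fire at `v` form a sublist
      let J := X.filter fun j => j ∈ active hof X σ v
      have hJ : ∀ {j}, j ∈ J ↔ j ∈ active hof X σ v := fun {j} => by
        simp only [J, List.mem_filter, decide_eq_true_eq]
        exact ⟨fun h => h.2, fun h => ⟨h.1, h⟩⟩
      rcases eq_or_ne J [] with hJ0 | hJ0
      · have : active hof X σ v = ∅ := eq_empty_of_forall_notMem fun j hj => by
          have := hJ.2 hj
          simp [hJ0] at this
        rw [this, image_empty]
        exact bddAbove_empty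
      obtain ⟨k, hk⟩ := List.exists_mem_of_ne_nil J hJ0
      obtain ⟨u, hu⟩ := con_iff.1 (h2 J (List.mem_sublists'.2 List.filter_sublist)
        (fun j hj => ⟨σ, (hJ.1 hj).2.1, (hh j (hJ.1 hj).1).symm ▸ hσ⟩)
        (fun i hi j hj => (hJ.1 hi).2.1.trans (hJ.1 hj).2.1.symm) k hk (fun i hi => by
          rw [numArgs_eq (hJ.1 hk).2.1, List.mem_range] at hi
          refine con_iff.2 ⟨v ⟨i, hi⟩, fun z hz => ?_⟩
          obtain ⟨j, hj, hz⟩ := List.mem_flatMap.1 hz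
          exact (hJ.1 hj).2.2 ⟨i, hi⟩ z hz))
      refine ⟨u, ?_⟩
      rintro _ ⟨j, hj, rfl⟩
      exact hu _ (List.mem_map.2 ⟨j, hJ.2 hj, rfl⟩)
    exact ⟨z, hz.1⟩

end PreObj

/-! ### Images of finitary projections -/

section Projections

variable {D : Type} [PartialOrder D]

omit [PartialOrder D] in
theorem mem_range_iff_of_idem {p : D → D} (idem : ∀ x, p (p x) = p x) {x : D} :
    x ∈ range p ↔ p x = x :=
  ⟨by rintro ⟨y, rfl⟩; exact idem y, fun h => ⟨x, h⟩⟩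

section

variable {p : D → D} (mono : Monotone p) (idem : ∀ x, p (p x) = p x) (le_self : ∀ x, p x ≤ x)
include mono idem le_self

/-- Suprema of sets of fixed points of a projection are fixed points. -/
theorem isLUB_mem_range {A : Set D} (hA : A ⊆ range p) {a : D} (ha : IsLUB A a) : a ∈ range p := by
  refine (mem_range_iff_of_idem idem).2 ((le_self a).antisymm (ha.2 fun x hx => ?_))
  rw [← (mem_range_iff_of_idem idem).1 (hA hx)]
  exact mono (ha.1 hx)

theorem isLUB_range_iff {A : Set (range p)} {a : range p} :
    IsLUB A a ↔ IsLUB (Subtype.val '' A) (a : D) := by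
  constructor
  · intro h
    refine ⟨?_, fun b hb => ?_⟩
    · rintro _ ⟨x, hx, rfl⟩
      exact h.1 hx
    · have hpb : (⟨p b, b, rfl⟩ : range p) ∈ upperBounds A := fun x hx => by
        have hx' := (mem_range_iff_of_idem idem).1 x.2
        change (x : D) ≤ p b
        rw [← hx']
        exact mono (hb ⟨x, hx, rfl⟩)
      exact le_trans (h.2 hpb : (a : D) ≤ p b) (le_self b)
  · intro h
    exact ⟨fun x hx => h.1 ⟨x, hx, rfl⟩, fun b hb => h.2 (by
      rintro _ ⟨x, hx, rfl⟩
      exact hb hx)⟩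

omit le_self in
theorem bddAbove_range_iff {A : Set (range p)} :
    BddAbove A ↔ BddAbove (Subtype.val '' A : Set D) := by
  constructor
  · rintro ⟨b, hb⟩
    exact ⟨b, by rintro _ ⟨x, hx, rfl⟩; exact hb hx⟩
  · rintro ⟨b, hb⟩
    refine ⟨⟨p b, b, rfl⟩, fun x hx => ?_⟩
    have hx' := (mem_range_iff_of_idem idem).1 x.2
    change (x : D) ≤ p b
    rw [← hx']
    exact mono (hb ⟨x, hx, rfl⟩)

end

theorem IsScottDomain.isLUB_pair_compact {x y z : D} (hx : IsCompactElement x)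
    (hy : IsCompactElement y) (hz : IsLUB {x, y} z) : IsCompactElement z :=
  isCompactElement_of_isLUB (toFinite _) (by rintro _ (rfl | rfl) <;> assumption) hz

namespace IsFinitaryProjection

variable {p : D → D} (hp : IsFinitaryProjection p)
include hp

/-- The compact fixed points of a finitary projection below `x` are directed, since the supremum of
two of them is a fixed point. -/
theorem directedOn_fixed (hD : IsScottDomain D) (x : D) :
    DirectedOn (· ≤ ·) {e | IsCompactElement e ∧ e ≤ x ∧ p e = e} := by
  rintro c ⟨hc, hcx, hpc⟩ d ⟨hd, hdx, hpd⟩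
  obtain ⟨z, hz⟩ := hD.exists_isLUB_pair c d ⟨x, by rintro _ (rfl | rfl) <;> assumption⟩
  refine ⟨z, ⟨IsScottDomain.isLUB_pair_compact hc hd hz, hz.2 ?_, ?_⟩, hz.1 (.inl rfl),
    hz.1 (.inr rfl)⟩
  · rintro _ (rfl | rfl) <;> assumption
  · refine (mem_range_iff_of_idem hp.idem).1
      (isLUB_mem_range hp.continuous.monotone hp.idem hp.le_self ?_ hz)
    rintro _ (rfl | rfl)
    · exact ⟨_, hpc⟩
    · exact ⟨_, hpd⟩

theorem fixed_nonempty (hD : IsScottDomain D) (x : D) :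
    {e | IsCompactElement e ∧ e ≤ x ∧ p e = e}.Nonempty := by
  obtain ⟨b, hb⟩ := hD.exists_isBot
  exact ⟨b, fun s u hne _ _ _ => ⟨_, hne.some_mem, hb _⟩, hb x, (hp.le_self b).antisymm (hb _)⟩

/-- The finitary condition says that `p x` is the supremum of the compact fixed points below `x`. -/
theorem isLUB_fixed (hD : IsScottDomain D) (x : D) :
    IsLUB {e | IsCompactElement e ∧ e ≤ x ∧ p e = e} (p x) := by
  refine ⟨?_, fun u hu => (hD.isLUB (p x)).2 ?_⟩
  · rintro e ⟨_, hex, hpe⟩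
    rw [← hpe]
    exact hp.continuous.monotone hex
  · rintro c ⟨hc, hcx⟩
    obtain ⟨e, he, hex, hpe, hce⟩ := (hp.finitary x c hc).1 hcx
    exact hce.trans (hu ⟨he, hex, hpe.symm⟩)

/-- Compactness in the image of a finitary projection is compactness in the domain. -/
theorem isCompactElement_range_iff (hD : IsScottDomain D) {c : range p} :
    IsCompactElement c ↔ IsCompactElement (c : D) := by
  constructor
  · intro hc
    have hpc := (mem_range_iff_of_idem hp.idem).1 c.2
    set K := {e : D | IsCompactElement e ∧ e ≤ c ∧ p e = e} with hK
    have hval : Subtype.val '' {e : range p | (e : D) ∈ K} = K := by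
      ext e
      simp only [mem_image, Subtype.exists, mem_ofPred_eq]
      exact ⟨by rintro ⟨a, _, h, rfl⟩; exact h, fun h => ⟨e, ⟨e, h.2.2⟩, h, rfl⟩⟩
    have hlub : IsLUB {e : range p | (e : D) ∈ K} c := by
      rw [isLUB_range_iff hp.continuous.monotone hp.idem hp.le_self, hval, ← hpc, hK, hpc]
      have := hp.isLUB_fixed hD c
      rwa [hpc] at this
    obtain ⟨e0, h0⟩ := hp.fixed_nonempty hD c
    obtain ⟨e, he, hce⟩ := hc _ c ⟨⟨e0, ⟨e0, h0.2.2⟩⟩, h0⟩ (by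
      intro x hx y hy
      obtain ⟨z, hz, hxz, hyz⟩ := hp.directedOn_fixed hD c x hx y hy
      exact ⟨⟨z, ⟨z, hz.2.2⟩⟩, hz, hxz, hyz⟩) hlub le_rfl
    have : (c : D) = e := le_antisymm hce he.2.1
    rw [this]
    exact he.1
  · intro hc s u hne hs hu hcu
    obtain ⟨_, ⟨x, hx, rfl⟩, hcx⟩ := hc _ u (hne.image _)
      (directedOn_image (f := Subtype.val) (fun _ _ h => h) hs)
      ((isLUB_range_iff hp.continuous.monotone hp.idem hp.le_self).1 hu) hcu
    exact ⟨x, hx, hcx⟩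

/-- The image of a finitary projection is a subdomain. -/
theorem isSubdomain (hD : IsScottDomain D) : IsSubdomain (range p) := by
  have mono := hp.continuous.monotone
  have hfix : ∀ x : range p, p x = x := fun x => (mem_range_iff_of_idem hp.idem).1 x.2
  have hbot : ∀ b : D, IsBot b → b ∈ range p := fun b hb =>
    ⟨b, (hp.le_self b).antisymm (hb _)⟩
  have hlub := fun (x : range p) =>
    isLUB_range_iff (A := {c : range p | IsCompactElement c ∧ c ≤ x})
    (a := x) mono hp.idem hp.le_self
  have hval : ∀ x : range p, Subtype.val '' {c : range p | IsCompactElement c ∧ c ≤ x} =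
      {e : D | IsCompactElement e ∧ e ≤ x ∧ p e = e} := by
    intro x
    ext e
    constructor
    · rintro ⟨c, ⟨hc, hcx⟩, rfl⟩
      exact ⟨(hp.isCompactElement_range_iff hD).1 hc, hcx, hfix c⟩
    · rintro ⟨he, hex, hpe⟩
      exact ⟨⟨e, e, hpe⟩, ⟨(hp.isCompactElement_range_iff hD).2 he, hex⟩, rfl⟩
  refine ⟨⟨?_, ?_, ?_, ?_, ?_, ?_⟩, hbot, fun c => (hp.isCompactElement_range_iff hD).1, ?_, ?_⟩
  · obtain ⟨b, hb⟩ := hD.exists_isBot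
    exact ⟨⟨b, hbot b hb⟩, fun x => hb x⟩
  · intro d hne hd
    obtain ⟨a, ha⟩ := hD.exists_isLUB_directed _ (hne.image Subtype.val)
      (directedOn_image (f := Subtype.val) (fun _ _ h => h) hd)
    have ha' := isLUB_mem_range mono hp.idem hp.le_self
      (by rintro _ ⟨x, _, rfl⟩; exact x.2) ha
    exact ⟨⟨a, ha'⟩, (isLUB_range_iff mono hp.idem hp.le_self).2 ha⟩
  · intro x y hxy
    rw [bddAbove_range_iff mono hp.idem, image_pair] at hxy
    obtain ⟨a, ha⟩ := hD.exists_isLUB_pair _ _ hxy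
    have ha' := isLUB_mem_range mono hp.idem hp.le_self
      (by rintro _ (rfl | rfl); exacts [x.2, y.2]) ha
    refine ⟨⟨a, ha'⟩, (isLUB_range_iff mono hp.idem hp.le_self).2 ?_⟩
    rwa [image_pair]
  · refine (hD.countable.preimage Subtype.val_injective).mono fun c hc => ?_
    exact (hp.isCompactElement_range_iff hD).1 hc
  · intro x c hc d hd
    have h := hval x
    obtain ⟨z, hz, hcz, hdz⟩ := hp.directedOn_fixed hD x c (h ▸ ⟨c, hc, rfl⟩) d (h ▸ ⟨d, hd, rfl⟩)
    exact ⟨⟨z, z, hz.2.2⟩, ⟨(hp.isCompactElement_range_iff hD).2 hz.1, hz.2.1⟩, hcz, hdz⟩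
  · intro x
    rw [hlub, hval]
    have := hp.isLUB_fixed hD x
    rwa [hfix] at this
  · intro x hx y hy z hz
    exact isLUB_mem_range mono hp.idem hp.le_self (by rintro _ (rfl | rfl) <;> assumption) hz
  · intro d hd _ _ a ha
    exact isLUB_mem_range mono hp.idem hp.le_self hd ha

end IsFinitaryProjection

/-- Being a Scott domain is invariant under order isomorphisms. -/
theorem IsScottDomain.of_orderIso {E : Type} [PartialOrder E] (hD : IsScottDomain D) (f : D ≃o E) :
    IsScottDomain E := by
  have hc : ∀ {E F : Type} [PartialOrder E] [PartialOrder F] (g : E ≃o F) (c : E),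
      IsCompactElement c → IsCompactElement (g c) := by
    intro E F _ _ g c hc s u hne hs hu hcu
    obtain ⟨_, ⟨x, hx, rfl⟩, hcx⟩ := hc (g.symm '' s) (g.symm u) (hne.image _)
      (directedOn_image g.symm.monotone hs) (g.symm.isLUB_image'.2 hu)
      (g.le_symm_apply.2 hcu)
    exact ⟨x, hx, g.le_symm_apply.1 hcx⟩
  have himg : ∀ x, f '' {c | IsCompactElement c ∧ c ≤ x} = {c | IsCompactElement c ∧ c ≤ f x} := by
    intro x
    ext c
    constructor
    · rintro ⟨c, ⟨h1, h2⟩, rfl⟩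
      exact ⟨hc f c h1, f.monotone h2⟩
    · rintro ⟨h1, h2⟩
      exact ⟨f.symm c, ⟨hc f.symm c h1, f.symm_apply_le.2 h2⟩, f.apply_symm_apply c⟩
  refine ⟨?_, ?_, ?_, ?_, ?_, ?_⟩
  · obtain ⟨b, hb⟩ := hD.exists_isBot
    exact ⟨f b, fun x => f.le_symm_apply.1 (hb _)⟩
  · intro d hne hd
    obtain ⟨a, ha⟩ := hD.exists_isLUB_directed _ (hne.image f.symm)
      (directedOn_image f.symm.monotone hd)
    refine ⟨f a, ?_⟩
    rwa [← f.symm.isLUB_image', f.symm_apply_apply]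
  · rintro x y ⟨b, hb⟩
    have hbdd : BddAbove {f.symm x, f.symm y} := by
      refine ⟨f.symm b, ?_⟩
      rintro _ (rfl | rfl)
      · exact f.symm.monotone (hb (.inl rfl))
      · exact f.symm.monotone (hb (.inr rfl))
    obtain ⟨a, ha⟩ := hD.exists_isLUB_pair _ _ hbdd
    refine ⟨f a, ?_⟩
    rwa [← f.symm.isLUB_image', f.symm_apply_apply, image_pair]
  · refine (hD.countable.image f).mono fun c h => (mem_image _ _ _).2 ?_
    exact ⟨f.symm c, hc f.symm c h, f.apply_symm_apply c⟩
  · intro x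
    obtain ⟨x, rfl⟩ := f.surjective x
    rw [← himg]
    exact directedOn_image f.monotone (hD.directed x)
  · intro x
    obtain ⟨x, rfl⟩ := f.surjective x
    rw [← himg]
    exact f.isLUB_image'.2 (hD.isLUB x)

end Projections

/-! ### Scott's universal domain -/

section UniversalDomain

section Cells

variable {K : Type}

/-- A non-empty interval `[l, r)`, with the non-empty part of `K` that it represents. Splitting `K`
by a sequence of sets, and the interval `[0, 1)` along with it, yields for each of these sets a
union of intervals, such that the sets and the unions have the same Boolean combinations empty. -/
structure Cell (K : Type) : Type where
  l : ℚ
  r : ℚ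
  part : Set K
  zero_le : 0 ≤ l
  lt : l < r
  le_one : r ≤ 1
  nonempty : part.Nonempty

/-- The interval of a cell. -/
def Cell.ival (t : Cell K) : Set ℚ := Ico t.l t.r

open scoped Classical in
/-- A cell whose part meets both `P` and its complement is halved. -/
noncomputable def Cell.split (P : Set K) (t : Cell K) : List (Cell K) :=
  if h : (t.part ∩ P).Nonempty ∧ (t.part \ P).Nonempty then
    [⟨t.l, (t.l + t.r) / 2, t.part ∩ P, t.zero_le, by linarith [t.lt],
        by linarith [t.lt, t.le_one], h.1⟩,
      ⟨(t.l + t.r) / 2, t.r, t.part \ P, by linarith [t.lt, t.zero_le], by linarith [t.lt],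
        t.le_one, h.2⟩]
  else [t]

theorem Cell.split_subset {P : Set K} {t u : Cell K} (hu : u ∈ t.split P) :
    u.ival ⊆ t.ival ∧ u.part ⊆ t.part := by
  rw [Cell.split] at hu
  split_ifs at hu with h
  · have := t.lt
    rcases List.mem_pair.1 hu with rfl | rfl
    · exact ⟨Ico_subset_Ico le_rfl (by linarith), inter_subset_left⟩
    · exact ⟨Ico_subset_Ico (by linarith) le_rfl, sdiff_subset⟩
  · rw [List.mem_singleton.1 hu]
    exact ⟨Subset.rfl, Subset.rfl⟩

theorem Cell.split_decides {P : Set K} {t u : Cell K} (hu : u ∈ t.split P) :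
    u.part ⊆ P ∨ Disjoint u.part P := by
  rw [Cell.split] at hu
  split_ifs at hu with h
  · rcases List.mem_pair.1 hu with rfl | rfl
    · exact .inl inter_subset_right
    · exact .inr disjoint_sdiff_left
  · rw [List.mem_singleton.1 hu]
    rw [not_and_or, not_nonempty_iff_eq_empty, not_nonempty_iff_eq_empty, sdiff_eq_empty] at h
    exact h.symm.imp_right fun h => disjoint_iff_inter_eq_empty.2 h

theorem Cell.exists_split_ival {P : Set K} {t : Cell K} {q : ℚ} (hq : q ∈ t.ival) :
    ∃ u ∈ t.split P, q ∈ u.ival := by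
  rw [Cell.split]
  split_ifs with h
  · rcases lt_or_ge q ((t.l + t.r) / 2) with hlt | hge
    · exact ⟨_, List.mem_cons_self, hq.1, hlt⟩
    · exact ⟨_, List.mem_cons_of_mem _ List.mem_cons_self, hge, hq.2⟩
  · exact ⟨t, by simp, hq⟩

theorem Cell.exists_split_part {P : Set K} {t : Cell K} {c : K} (hc : c ∈ t.part) :
    ∃ u ∈ t.split P, c ∈ u.part := by
  rw [Cell.split]
  split_ifs with h
  · by_cases hcP : c ∈ P
    · exact ⟨_, List.mem_cons_self, hc, hcP⟩
    · exact ⟨_, List.mem_cons_of_mem _ List.mem_cons_self, hc, hcP⟩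
  · exact ⟨t, by simp, hc⟩

theorem Cell.split_unique {P : Set K} {t u v : Cell K} (hu : u ∈ t.split P) (hv : v ∈ t.split P)
    {q : ℚ} (hqu : q ∈ u.ival) (hqv : q ∈ v.ival) : u = v := by
  rw [Cell.split] at hu hv
  split_ifs at hu hv with h
  · rcases List.mem_pair.1 hu with rfl | rfl <;> rcases List.mem_pair.1 hv with rfl | rfl
    · rfl
    · exact absurd hqu.2 (not_lt.2 hqv.1)
    · exact absurd hqv.2 (not_lt.2 hqu.1)
    · rfl
  · rw [List.mem_singleton.1 hu, List.mem_singleton.1 hv]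

variable [Nonempty K] (P : ℕ → Set K)

/-- The cells after the first `n` sets have been taken into account. -/
noncomputable def cells : ℕ → List (Cell K)
  | 0 => [⟨0, 1, univ, le_rfl, one_pos, le_rfl, univ_nonempty⟩]
  | n + 1 => (cells n).flatMap (Cell.split (P n))

/-- A rational number and a member of `K` lie in the same cell. -/
def SameCell (n : ℕ) (q : ℚ) (c : K) : Prop := ∃ t ∈ cells P n, q ∈ t.ival ∧ c ∈ t.part

/-- The union of the intervals of the cells that lie in the `n`-th set. -/
def realized (n : ℕ) : Set ℚ := {q | ∃ t ∈ cells P (n + 1), t.part ⊆ P n ∧ q ∈ t.ival}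

variable {P}

theorem exists_cell_ival {q : ℚ} (hq : q ∈ Ico (0 : ℚ) 1) : ∀ n, ∃ t ∈ cells P n, q ∈ t.ival
  | 0 => ⟨_, List.mem_singleton.2 rfl, hq⟩
  | n + 1 => by
    obtain ⟨t, ht, hqt⟩ := exists_cell_ival hq n
    obtain ⟨u, hu, hqu⟩ := Cell.exists_split_ival (P := P n) hqt
    exact ⟨u, List.mem_flatMap.2 ⟨t, ht, hu⟩, hqu⟩

theorem exists_cell_part (c : K) : ∀ n, ∃ t ∈ cells P n, c ∈ t.part
  | 0 => ⟨_, List.mem_singleton.2 rfl, trivial⟩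
  | n + 1 => by
    obtain ⟨t, ht, hqt⟩ := exists_cell_part c n
    obtain ⟨u, hu, hqu⟩ := Cell.exists_split_part (P := P n) hqt
    exact ⟨u, List.mem_flatMap.2 ⟨t, ht, hu⟩, hqu⟩

theorem cell_unique {q : ℚ} : ∀ {n : ℕ} {t u : Cell K}, t ∈ cells P n → u ∈ cells P n →
    q ∈ t.ival → q ∈ u.ival → t = u
  | 0, t, u, ht, hu, _, _ => (List.mem_singleton.1 ht).trans (List.mem_singleton.1 hu).symm
  | n + 1, t, u, ht, hu, hqt, hqu => by
    obtain ⟨t', ht', ht⟩ := List.mem_flatMap.1 ht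
    obtain ⟨u', hu', hu⟩ := List.mem_flatMap.1 hu
    obtain rfl := cell_unique ht' hu' ((Cell.split_subset ht).1 hqt) ((Cell.split_subset hu).1 hqu)
    exact Cell.split_unique ht hu hqt hqu

theorem SameCell.exists_right (n : ℕ) {q : ℚ} (hq : q ∈ Ico (0 : ℚ) 1) : ∃ c, SameCell P n q c := by
  obtain ⟨t, ht, hqt⟩ := exists_cell_ival (P := P) hq n
  obtain ⟨c, hc⟩ := t.nonempty
  exact ⟨c, t, ht, hqt, hc⟩

theorem SameCell.exists_left (n : ℕ) (c : K) : ∃ q ∈ Ico (0 : ℚ) 1, SameCell P n q c := by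
  obtain ⟨t, ht, hct⟩ := exists_cell_part (P := P) c n
  exact ⟨t.l, ⟨t.zero_le, t.lt.trans_le t.le_one⟩, t, ht, ⟨le_rfl, t.lt⟩, hct⟩

theorem SameCell.anti {m n : ℕ} (h : m ≤ n) {q : ℚ} {c : K} (hn : SameCell P n q c) :
    SameCell P m q c := by
  induction h with
  | refl => exact hn
  | step _ ih =>
    obtain ⟨t, ht, hqt, hct⟩ := hn
    obtain ⟨t', ht', ht⟩ := List.mem_flatMap.1 ht
    exact ih ⟨t', ht', (Cell.split_subset ht).1 hqt, (Cell.split_subset ht).2 hct⟩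

/-- A number in the cell of `c` belongs to the realization of an earlier set if and only if `c`
belongs to this set. So relations between finitely many sets hold between their realizations. -/
theorem SameCell.mem_iff {k n : ℕ} (h : k < n) {q : ℚ} {c : K} (hn : SameCell P n q c) :
    q ∈ realized P k ↔ c ∈ P k := by
  obtain ⟨t, ht, hqt, hct⟩ := hn.anti (Nat.succ_le_of_lt h)
  constructor
  · rintro ⟨u, hu, huP, hqu⟩
    obtain rfl := cell_unique ht hu hqt hqu
    exact huP hct
  · intro hcP
    refine ⟨t, ht, ?_, hqt⟩
    obtain ⟨t', _, ht'⟩ := List.mem_flatMap.1 ht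
    exact (Cell.split_decides ht').resolve_right fun hd => disjoint_left.1 hd hct hcP

theorem realized_subset (n : ℕ) : realized P n ⊆ Ico 0 1 := by
  rintro q ⟨t, _, _, hq⟩
  exact ⟨t.zero_le.trans hq.1, hq.2.trans_le t.le_one⟩

open scoped Classical in
theorem realized_eq_union (n : ℕ) :
    ∃ F : Finset (ℚ × ℚ), (∀ q ∈ F, 0 ≤ q.1 ∧ q.1 < q.2 ∧ q.2 ≤ 1) ∧
      realized P n = ⋃ q ∈ F, Ico q.1 q.2 := by
  refine ⟨(((cells P (n + 1)).filter fun t => t.part ⊆ P n).map fun t => (t.l, t.r)).toFinset,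
    ?_, ?_⟩
  · intro q hq
    simp only [List.mem_toFinset, List.mem_map, List.mem_filter] at hq
    obtain ⟨t, _, rfl⟩ := hq
    exact ⟨t.zero_le, t.lt, t.le_one⟩
  · ext q
    simp only [realized, Cell.ival, mem_ofPred_eq, List.mem_toFinset, List.mem_map,
      List.mem_filter, decide_eq_true_eq, mem_iUnion, exists_prop]
    constructor
    · rintro ⟨t, ht, hP, hq⟩
      exact ⟨_, ⟨t, ⟨ht, hP⟩, rfl⟩, hq⟩
    · rintro ⟨_, ⟨t, ⟨ht, hP⟩, rfl⟩, hq⟩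
      exact ⟨t, ht, hP, hq⟩

end Cells

/-- The compact elements of a Scott domain can be represented by members of the basis of the
universal domain, such that bounds correspond to smaller sets, suprema to intersections, and
bounded pairs to intersecting sets. -/
theorem IsScottDomain.exists_representation {D : Type} [PartialOrder D] (hD : IsScottDomain D) :
    ∃ i : {c : D // IsCompactElement c} → UBasis,
      (∀ c d, i c ≤ i d ↔ (c : D) ≤ d) ∧
      (∀ u : UBasis, ∃ c, i c ≤ u) ∧
      ∀ c d u, i c ≤ u → i d ≤ u →
        ∃ e : {c : D // IsCompactElement c}, IsLUB {(c : D), (d : D)} (e : D) ∧ i e ≤ u := by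
  obtain ⟨b, hb⟩ := hD.exists_isBot
  have hbc : IsCompactElement b := fun s u hne _ _ _ => ⟨_, hne.some_mem, hb _⟩
  have : Nonempty {c : D // IsCompactElement c} := ⟨⟨b, hbc⟩⟩
  have : Countable {c : D // IsCompactElement c} := hD.countable.to_subtype
  obtain ⟨k, hk⟩ := exists_surjective_nat {c : D // IsCompactElement c}
  choose idx hidx using hk
  -- the compact element `c` is represented by the realization of the set of those above it
  set P : ℕ → Set {c : D // IsCompactElement c} := fun n => {d | k n ≤ d} with hP
  have hmem : ∀ (c d : {c : D // IsCompactElement c}) (n : ℕ) (q : ℚ), idx c < n →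
      SameCell P n q d → (q ∈ realized P (idx c) ↔ c ≤ d) := by
    intro c d n q hn h
    rw [h.mem_iff hn, hP]
    change k (idx c) ≤ d ↔ _
    rw [hidx]
  have hsub : ∀ (c : {c : D // IsCompactElement c}) (q : ℚ), q ∈ realized P (idx c) →
      q ∈ Ico (0 : ℚ) 1 := fun c q hq => realized_subset _ hq
  let i : {c : D // IsCompactElement c} → UBasis := fun c =>
    ⟨realized P (idx c), by
      obtain ⟨q, _, hq⟩ := SameCell.exists_left (P := P) (idx c + 1) c
      exact ⟨q, (hmem c c _ q (Nat.lt_succ_self _) hq).2 le_rfl⟩, realized_eq_union _⟩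
  have hle : ∀ c d, i c ≤ i d ↔ (c : D) ≤ d := by
    intro c d
    constructor
    · intro h
      obtain ⟨q, _, hq⟩ := SameCell.exists_left (P := P) (max (idx c) (idx d) + 1) d
      have hqd := (hmem d d _ q (by omega) hq).2 le_rfl
      exact (hmem c d _ q (by omega) hq).1 (h hqd)
    · intro h q hq
      obtain ⟨x, hx⟩ := SameCell.exists_right (P := P) (max (idx c) (idx d) + 1) (hsub d q hq)
      have hdx := (hmem d x _ q (by omega) hx).1 hq
      exact (hmem c x _ q (by omega) hx).2 (le_trans (show c ≤ d from h) hdx)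
  refine ⟨i, hle, fun u => ⟨⟨b, hbc⟩, fun q hq => ?_⟩, fun c d u hc hd => ?_⟩
  · have hq' : q ∈ Ico (0 : ℚ) 1 := by
      obtain ⟨F, hF, hu⟩ := u.isUnion
      rw [hu] at hq
      simp only [mem_iUnion, exists_prop] at hq
      obtain ⟨t, ht, hqt⟩ := hq
      have := hF t ht
      exact ⟨this.1.trans hqt.1, hqt.2.trans_le this.2.2⟩
    obtain ⟨x, hx⟩ := SameCell.exists_right (P := P) (idx ⟨b, hbc⟩ + 1) hq'
    exact (hmem _ x _ q (Nat.lt_succ_self _) hx).2 (hb x)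
  · obtain ⟨q, hq⟩ := u.nonempty
    obtain ⟨x, hx⟩ := SameCell.exists_right (P := P) (max (idx c) (idx d) + 1) (hsub c q (hc hq))
    have hcx := (hmem c x _ q (by omega) hx).1 (hc hq)
    have hdx := (hmem d x _ q (by omega) hx).1 (hd hq)
    obtain ⟨e, he⟩ := hD.exists_isLUB_pair c d ⟨x, by rintro _ (rfl | rfl) <;> assumption⟩
    have hec := isCompactElement_of_isLUB (toFinite _)
      (by rintro _ (rfl | rfl); exacts [c.2, d.2]) he
    refine ⟨⟨e, hec⟩, he, fun q hq => ?_⟩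
    obtain ⟨x, hx⟩ := SameCell.exists_right (P := P)
      (max (max (idx c) (idx d)) (idx ⟨e, hec⟩) + 1) (hsub c q (hc hq))
    have hcx := (hmem c x _ q (by omega) hx).1 (hc hq)
    have hdx := (hmem d x _ q (by omega) hx).1 (hd hq)
    exact (hmem _ x _ q (by omega) hx).2 (he.2 (by rintro _ (rfl | rfl) <;> assumption) : e ≤ x)

/-- The supremum of a directed set of ideals is its union. -/
theorem mem_of_isLUB_ideal {P : Type} [Preorder P] {s : Set (Order.Ideal P)} (hne : s.Nonempty)
    (hs : DirectedOn (· ≤ ·) s) {I : Order.Ideal P} (hI : IsLUB s I) {u : P} (hu : u ∈ I) :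
    ∃ J ∈ s, u ∈ J := by
  let U : Order.Ideal P :=
    { carrier := {u | ∃ J ∈ s, u ∈ J}
      lower' := fun a b hba ⟨J, hJ, ha⟩ => ⟨J, hJ, J.lower hba ha⟩
      nonempty' := by
        obtain ⟨J, hJ⟩ := hne
        obtain ⟨a, ha⟩ := J.nonempty
        exact ⟨a, J, hJ, ha⟩
      directed' := by
        rintro a ⟨J, hJ, ha⟩ b ⟨J', hJ', hb⟩
        obtain ⟨M, hM, h1, h2⟩ := hs J hJ J' hJ'
        obtain ⟨c, hc, hac, hbc⟩ := M.directed a (h1 ha) b (h2 hb)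
        exact ⟨c, ⟨M, hM, hc⟩, hac, hbc⟩ }
  have : I ≤ U := hI.2 fun J hJ a ha => ⟨J, hJ, ha⟩
  exact this hu

/-- Every Scott domain is isomorphic to a subdomain of the universal domain. -/
theorem IsScottDomain.exists_universal {D : Type} [PartialOrder D] (hD : IsScottDomain D) :
    ∃ X : Set Universal, IsSubdomain X ∧ Nonempty (D ≃o X) := by
  obtain ⟨i, hle, hbot, hjoin⟩ := hD.exists_representation
  have hlub : ∀ {x : D} {c d : {c : D // IsCompactElement c}}, (c : D) ≤ x → (d : D) ≤ x →
      ∀ {e : D}, IsLUB {(c : D), (d : D)} e → e ≤ x := fun hc hd e he =>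
    he.2 (by rintro _ (rfl | rfl) <;> assumption)
  -- the ideal of an element is generated by the representations of its compact approximations
  let f : D → Universal := fun x =>
    { carrier := {u | ∃ c : {c : D // IsCompactElement c}, (c : D) ≤ x ∧ u ≤ i c}
      lower' := fun a b hba ⟨c, hc, ha⟩ => ⟨c, hc, le_trans hba ha⟩
      nonempty' := by
        obtain ⟨b, hb⟩ := hD.exists_isBot
        exact ⟨i ⟨b, fun s u hne _ _ _ => ⟨_, hne.some_mem, hb _⟩⟩, _, hb x, le_rfl⟩
      directed' := by
        rintro a ⟨c, hc, ha⟩ b ⟨d, hd, hb⟩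
        obtain ⟨e, ⟨he, hex⟩, hce, hde⟩ := hD.directed x c ⟨c.2, hc⟩ d ⟨d.2, hd⟩
        exact ⟨i ⟨e, he⟩, ⟨⟨e, he⟩, hex, le_rfl⟩, ha.trans ((hle _ _).2 hce),
          hb.trans ((hle _ _).2 hde)⟩ }
  have hmemf : ∀ x c, i c ∈ f x ↔ (c : D) ≤ x := fun x c =>
    ⟨fun ⟨d, hd, h⟩ => ((hle _ _).1 h).trans hd, fun h => ⟨c, h, le_rfl⟩⟩
  have hfle : ∀ x y, f x ≤ f y ↔ x ≤ y := by
    intro x y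
    constructor
    · intro h
      refine (hD.isLUB x).2 ?_
      rintro c ⟨hc, hcx⟩
      exact (hmemf y ⟨c, hc⟩).1 (h ((hmemf x ⟨c, hc⟩).2 hcx))
    · rintro h u ⟨c, hc, hu⟩
      exact ⟨c, hc.trans h, hu⟩
  -- every ideal contains a largest ideal of this form
  have hproj : ∀ I : Universal, ∃ x, f x ≤ I ∧ ∀ y, f y ≤ I → y ≤ x := by
    intro I
    obtain ⟨x, hx⟩ := hD.exists_isLUB_directed
      {c : D | ∃ h : IsCompactElement c, i ⟨c, h⟩ ∈ I} (by
        obtain ⟨u, hu⟩ := I.nonempty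
        obtain ⟨c, hc⟩ := hbot u
        exact ⟨c, c.2, I.lower hc hu⟩) (by
        rintro c ⟨hc, hcI⟩ d ⟨hd, hdI⟩
        obtain ⟨u, hu, hcu, hdu⟩ := I.directed _ hcI _ hdI
        obtain ⟨e, he, heu⟩ := hjoin _ _ u hcu hdu
        exact ⟨e, ⟨e.2, I.lower heu hu⟩, he.1 (.inl rfl), he.1 (.inr rfl)⟩)
    refine ⟨x, ?_, fun y hy => (hD.isLUB y).2 ?_⟩
    · rintro u ⟨c, hc, hu⟩
      obtain ⟨d, ⟨hd, hdI⟩, hcd⟩ := c.2 _ x (by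
        obtain ⟨u, hu⟩ := I.nonempty
        obtain ⟨c, hc⟩ := hbot u
        exact ⟨c, c.2, I.lower hc hu⟩) (by
        rintro c ⟨hc, hcI⟩ d ⟨hd, hdI⟩
        obtain ⟨u, hu, hcu, hdu⟩ := I.directed _ hcI _ hdI
        obtain ⟨e, he, heu⟩ := hjoin _ _ u hcu hdu
        exact ⟨e, ⟨e.2, I.lower heu hu⟩, he.1 (.inl rfl), he.1 (.inr rfl)⟩) hx hc
      exact I.lower (hu.trans ((hle c ⟨d, hd⟩).2 hcd)) hdI
    · rintro c ⟨hc, hcy⟩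
      exact hx.1 ⟨hc, hy ((hmemf y ⟨c, hc⟩).2 hcy)⟩
  have hclosed : ∀ A ⊆ range f, ∀ I : Universal, IsLUB A I → I ∈ range f := by
    intro A hA I hI
    obtain ⟨x, hx, hmax⟩ := hproj I
    refine ⟨x, le_antisymm hx (hI.2 fun J hJ => ?_)⟩
    obtain ⟨y, rfl⟩ := hA hJ
    exact (hfle _ _).2 (hmax y (hI.1 hJ))
  let F : D ↪o Universal := OrderEmbedding.ofMapLEIff f hfle
  let E : D ≃o range f := F.orderIso
  have hE : ∀ x, ((E x : range f) : Universal) = f x := fun _ => rfl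
  refine ⟨range f, ⟨hD.of_orderIso E, ?_, ?_, ?_, ?_⟩, ⟨E⟩⟩
  · intro b hb
    obtain ⟨x, hx, _⟩ := hproj b
    exact ⟨x, le_antisymm hx (hb _)⟩
  · intro c hc
    obtain ⟨x, rfl⟩ := E.surjective c
    -- the element is compact, hence its ideal is principal
    have hx : IsCompactElement x := by
      intro s u hne hs hu hxu
      obtain ⟨_, ⟨y, hy, rfl⟩, h⟩ := hc (E '' s) (E u) (hne.image _)
        (directedOn_image E.monotone hs) (E.isLUB_image'.2 hu) (E.monotone hxu)
      exact ⟨y, hy, E.le_iff_le.1 h⟩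
    intro s u hne hs hu hxu
    have : i ⟨x, hx⟩ ∈ u := hxu ((hmemf x ⟨x, hx⟩).2 le_rfl)
    obtain ⟨J, hJ, hxJ⟩ := mem_of_isLUB_ideal hne hs hu this
    refine ⟨J, hJ, ?_⟩
    rintro v ⟨d, hd, hv⟩
    exact J.lower (hv.trans ((hle d ⟨x, hx⟩).2 hd)) hxJ
  · intro x hx y hy z hz
    exact hclosed _ (by rintro _ (rfl | rfl) <;> assumption) z hz
  · intro d hd _ _ a ha
    exact hclosed d hd a ha

end UniversalDomain

/-! ### Filtering -/

/-- What filtering needs to know of the signatures: for an object with header `h`, whether its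
shapes match (`good`), which slots are declared (`ok`), and which signature closures are admitted
for the `i`-th argument (`acc`) and for the result (`res`) at a slot. -/
structure FilterSpec (S L : Type) : Type where
  good : Header S L → Prop
  ok : Header S L → Slot L → Prop
  allowed_of_ok : ∀ {h σ}, good h → ok h σ → σ.Allowed h
  acc : Header S L → Slot L → ℕ → Set S
  res : Header S L → Slot L → Set S

/-- The other half of the finitary condition follows from monotonicity. -/
theorem IsFinitaryProjection.of_exists {D : Type} [PartialOrder D] {p : D → D}
    (hc : ScottContinuous p) (idem : ∀ x, p (p x) = p x) (le_self : ∀ x, p x ≤ x)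
    (h : ∀ x c, IsCompactElement c → c ≤ p x → ∃ e, IsCompactElement e ∧ e ≤ x ∧ p e = e ∧ c ≤ e) :
    IsFinitaryProjection p where
  continuous := hc
  idem := idem
  le_self := le_self
  finitary x c hcc := by
    constructor
    · intro hcx
      obtain ⟨e, h1, h2, h3, h4⟩ := h x c hcc hcx
      exact ⟨e, h1, h2, h3.symm, h4⟩
    · rintro ⟨e, _, h2, h3, h4⟩
      rw [h3] at h4
      exact h4.trans (hc.monotone h2)

namespace PreObj

variable {S L : Type}

local notation "O" => PreObj S L

open scoped Classical in
/-- Apply `φ` to the objects whose signature closure is in `P`, and replace the others by `⊥`. -/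
noncomputable def gate (φ : O → O) (P : Set S) (o : O) : O :=
  if ∃ h, hd o = some h ∧ h.1 ∈ P then φ o else ⊥

theorem gate_of_mem {φ : O → O} {P : Set S} {o : O} {h : Header S L} (ho : hd o = some h)
    (hP : h.1 ∈ P) : gate φ P o = φ o := if_pos ⟨h, ho, hP⟩

theorem gate_of_not_mem {φ : O → O} {P : Set S} {o : O} {h : Header S L} (ho : hd o = some h)
    (hP : h.1 ∉ P) : gate φ P o = ⊥ := if_neg (by
  rintro ⟨h', ho', hP'⟩
  rw [ho] at ho'
  obtain rfl := Option.some_injective _ ho'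
  exact hP hP')

@[simp] theorem gate_bot (φ : O → O) (P : Set S) : gate φ P ⊥ = ⊥ := if_neg (by simp)

theorem gate_mono_left {φ ψ : O → O} (h : ∀ x, φ x ≤ ψ x) (P : Set S) (o : O) :
    gate φ P o ≤ gate ψ P o := by
  rw [gate, gate]
  split_ifs
  · exact h o
  · exact le_rfl

theorem scottContinuous_gate {φ : O → O} (hφ : ScottContinuous φ) (h0 : φ ⊥ = ⊥) (P : Set S) :
    ScottContinuous (gate φ P) := by
  intro d hne hd' a ha
  by_cases hab : a = ⊥
  · subst hab
    have : ∀ x ∈ d, x = ⊥ := fun x hx => le_bot_iff.1 (ha.1 hx)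
    refine ⟨?_, fun _ _ => by simp⟩
    rintro _ ⟨x, hx, rfl⟩
    rw [this x hx]
  · obtain ⟨h, hh⟩ := exists_hd hab
    have hd2 : ∀ x ∈ d, x ≠ ⊥ → hd x = some h := fun x hx => hd_of_ge hh (ha.1 hx)
    by_cases hP : h.1 ∈ P
    · have e : ∀ x ∈ d, gate φ P x = φ x := by
        intro x hx
        by_cases hxb : x = ⊥
        · rw [hxb, gate_bot, h0]
        · exact gate_of_mem (hd2 x hx hxb) hP
      rw [image_congr e, gate_of_mem hh hP]
      exact hφ hne hd' ha
    · have e : ∀ x ∈ d, gate φ P x = ⊥ := by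
        intro x hx
        by_cases hxb : x = ⊥
        · rw [hxb, gate_bot]
        · exact gate_of_not_mem (hd2 x hx hxb) hP
      rw [image_congr e, gate_of_not_mem hh hP, hne.image_const]
      exact isLUB_singleton

theorem hd_of_projection {φ : O → O} (hle : ∀ x, φ x ≤ x) {x : O} {h : Header S L}
    (hx : hd x = some h) (hφ : φ x ≠ ⊥) : hd (φ x) = some h := hd_of_ge hx (hle x) hφ

theorem gate_le {φ : O → O} (hle : ∀ x, φ x ≤ x) (P : Set S) (x : O) : gate φ P x ≤ x := by
  rw [gate]
  split_ifs
  · exact hle x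
  · exact bot_le

theorem gate_eq_self_iff {φ : O → O} {P : Set S} {x : O} :
    gate φ P x = x ↔ x = ⊥ ∨ (φ x = x ∧ ∃ h, hd x = some h ∧ h.1 ∈ P) := by
  by_cases hx : x = ⊥
  · simp [hx]
  · rw [gate]
    split_ifs with h
    · simp [h, hx]
    · exact ⟨fun h' => absurd h'.symm hx,
        fun h' => h'.elim (fun h'' => absurd h'' hx) fun h'' => absurd h''.2 h⟩

theorem gate_gate {φ : O → O} (hle : ∀ x, φ x ≤ x) (idem : ∀ x, φ (φ x) = φ x)
    (P : Set S) (x : O) : gate φ P (gate φ P x) = gate φ P x := by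
  rw [gate_eq_self_iff]
  by_cases hx : ∃ h, hd x = some h ∧ h.1 ∈ P
  · have e : gate φ P x = φ x := if_pos hx
    rw [e]
    obtain ⟨h, hh, hP⟩ := hx
    exact or_iff_not_imp_left.2 fun hb => ⟨idem x, h, hd_of_projection hle hh hb, hP⟩
  · exact .inl (if_neg hx)

theorem _root_.NOOP.IsFinitaryProjection.map_bot {φ : O → O} (hφ : IsFinitaryProjection φ) :
    φ ⊥ = ⊥ := le_bot_iff.1 (hφ.le_self ⊥)

theorem _root_.NOOP.IsFinitaryProjection.gate {φ : O → O} (hφ : IsFinitaryProjection φ)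
    (P : Set S) : IsFinitaryProjection (gate φ P) := by
  have h0 := hφ.map_bot
  refine .of_exists (scottContinuous_gate hφ.continuous h0 P) (gate_gate hφ.le_self hφ.idem P)
    (gate_le hφ.le_self P) fun x c hc hcx => ?_
  by_cases hx : ∃ h, hd x = some h ∧ h.1 ∈ P
  · have e : PreObj.gate φ P x = φ x := if_pos hx
    rw [e] at hcx
    obtain ⟨e, he, hex, hpe, hce⟩ := (hφ.finitary x c hc).1 hcx
    refine ⟨e, he, hex, (gate_eq_self_iff).2 ?_, hce⟩
    obtain ⟨h, hh, hP⟩ := hx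
    exact or_iff_not_imp_left.2 fun hb => ⟨hpe.symm, h, hd_of_ge hh hex hb, hP⟩
  · have e : PreObj.gate φ P x = ⊥ := if_neg hx
    rw [e] at hcx
    exact ⟨⊥, isCompactElement_bot, bot_le, gate_bot φ P, hcx⟩

/-- The filtered value of `x` at a slot. -/
noncomputable def slotVal (T : FilterSpec S L) (φ : O → O) (h : Header S L) (x : O) (σ : Slot L)
    (v : Fin σ.2 → O) : O :=
  gate φ (T.res h σ) (ap x σ fun i => gate φ (T.acc h σ i) (v i))

open scoped Classical in
/-- The function `ψ` arises from `φ` by one unfolding of the recursive equations of filtering. -/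
structure Unfolds (T : FilterSpec S L) (φ ψ : O → O) : Prop where
  bot : ψ ⊥ = ⊥
  mismatch : ∀ {x h}, hd x = some h → ¬ T.good h → ψ x = ⊥
  hd : ∀ {x h}, hd x = some h → T.good h → hd (ψ x) = some h
  ap : ∀ {x h}, PreObj.hd x = some h → T.good h → ∀ σ v,
    ap (ψ x) σ v = if T.ok h σ then slotVal T φ h x σ v else ⊥

variable {T : FilterSpec S L}

theorem slotVal_mono_left {φ ψ : O → O} (hφ : ScottContinuous φ) (h0 : φ ⊥ = ⊥)
    (h : ∀ x, φ x ≤ ψ x) (k : Header S L) (x : O) (σ : Slot L) (v : Fin σ.2 → O) :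
    slotVal T φ k x σ v ≤ slotVal T ψ k x σ v :=
  ((scottContinuous_gate hφ h0 _).monotone
    (ap_monotone x σ fun _ => gate_mono_left h _ _)).trans (gate_mono_left h _ _)

theorem Unfolds.mono {φ ψ φ' ψ' : O → O} (hφ : ScottContinuous φ) (h0 : φ ⊥ = ⊥)
    (h : Unfolds T φ ψ) (h' : Unfolds T φ' ψ') (hle : ∀ x, φ x ≤ φ' x) (x : O) :
    ψ x ≤ ψ' x := by
  by_cases hx : x = ⊥
  · rw [hx, h.bot]
    exact bot_le
  obtain ⟨k, hk⟩ := exists_hd hx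
  by_cases hg : T.good k
  · refine (le_of_hd (h.hd hk hg)).2 ⟨h'.hd hk hg, fun σ v => ?_⟩
    rw [h.ap hk hg, h'.ap hk hg]
    split_ifs
    · exact slotVal_mono_left hφ h0 hle k x σ v
    · exact le_rfl
  · rw [h.mismatch hk hg]
    exact bot_le

open scoped Classical in
/-- One unfolding of the recursive equations turns a strict continuous function into one. -/
theorem exists_unfolds (T : FilterSpec S L) (φ : StrictFun O O) :
    ∃ ψ : StrictFun O O, Unfolds T φ ψ := by
  have key : ∀ x : O, ∃ y : O, (x = ⊥ → y = ⊥) ∧ ∀ h, hd x = some h →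
      (¬ T.good h → y = ⊥) ∧ (T.good h → hd y = some h ∧ ∀ σ v,
        ap y σ v = if T.ok h σ then slotVal T φ h x σ v else ⊥) := by
    intro x
    by_cases hx : x = ⊥
    · exact ⟨⊥, fun _ => rfl, by simp [hx]⟩
    obtain ⟨h, hh⟩ := exists_hd hx
    by_cases hg : T.good h
    · obtain ⟨y, hy1, hy2⟩ := exists_mk h
        (fun σ v => if T.ok h σ then slotVal T φ h x σ v else ⊥) fun σ => by
          split_ifs
          · refine ScottContinuous.comp
              (f := fun (v : Fin σ.2 → O) (i : Fin σ.2) => gate φ (T.acc h σ i) (v i)) ?_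
              ((continuous_ap x σ).comp (scottContinuous_gate φ.continuous φ.strict _))
            intro d hne hd a ha
            refine isLUB_pi.2 fun i => ?_
            have := scottContinuous_gate φ.continuous φ.strict (T.acc h σ i) (hne.image _)
              (directedOn_image (Function.monotone_eval i) hd) (isLUB_pi.1 ha i)
            rw [image_image] at this ⊢
            exact this
          · exact .const ⊥
      refine ⟨y, fun h => absurd h hx, fun h' hh' => ?_⟩
      rw [hh] at hh'
      obtain rfl := Option.some_injective _ hh'
      refine ⟨fun h => absurd hg h, fun _ => ⟨hy1, fun σ v => ?_⟩⟩
      by_cases hσ : σ.Allowed h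
      · exact hy2 σ v hσ
      · rw [ap_of_not_allowed hy1 hσ, if_neg fun h => hσ (T.allowed_of_ok hg h)]
    · refine ⟨⊥, fun _ => rfl, fun h' hh' => ⟨fun _ => rfl, fun hg' => ?_⟩⟩
      rw [hh] at hh'
      obtain rfl := Option.some_injective _ hh'
      exact absurd hg' hg
  choose ψ hψ0 hψ using key
  refine ⟨⟨ψ, ?_, hψ0 ⊥ rfl⟩, hψ0 ⊥ rfl, fun hh hg => (hψ _ _ hh).1 hg,
    fun hh hg => ((hψ _ _ hh).2 hg).1, fun hh hg => ((hψ _ _ hh).2 hg).2⟩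
  intro d hne hd' a ha
  by_cases hab : a = ⊥
  · subst hab
    rw [hψ0 ⊥ rfl]
    refine ⟨?_, fun _ _ => bot_le⟩
    rintro _ ⟨x, hx, rfl⟩
    exact (hψ0 x (le_bot_iff.1 (ha.1 hx))).le
  obtain ⟨h, hh⟩ := exists_hd hab
  have hd2 : ∀ x ∈ d, x ≠ ⊥ → hd x = some h := fun x hx => hd_of_ge hh (ha.1 hx)
  by_cases hg : T.good h
  · obtain ⟨x0, hx0, hx0b⟩ : ∃ x ∈ d, x ≠ ⊥ := by
      by_contra hcon
      push Not at hcon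
      exact hab (le_bot_iff.1 (ha.2 fun x hx => (hcon x hx).le))
    have hψx0 := ((hψ x0 h (hd2 x0 hx0 hx0b)).2 hg).1
    refine isLUB_of_slots (mem_image_of_mem ψ hx0) (h := h) ?_ (ne_bot_of_hd hψx0)
      ((hψ a h hh).2 hg).1 ?_
    · rintro _ ⟨x, hx, rfl⟩ hxb
      exact ((hψ x h (hd2 x hx fun h0 => hxb (hψ0 x h0))).2 hg).1
    · intro σ v _
      rw [((hψ a h hh).2 hg).2, image_image]
      have e : ∀ x ∈ d, ap (ψ x) σ v = if T.ok h σ then slotVal T φ h x σ v else ⊥ := by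
        intro x hx
        by_cases hxb : x = ⊥
        · rw [hψ0 x hxb, ap_bot, hxb, slotVal, ap_bot, gate_bot, ite_self]
        · exact ((hψ x h (hd2 x hx hxb)).2 hg).2 σ v
      rw [image_congr e]
      split_ifs
      · have := scottContinuous_gate φ.continuous φ.strict (T.res h σ) (hne.image _)
          (directedOn_image (fun x y hxy => ap_mono hxy σ fun i => gate φ (T.acc h σ i) (v i)) hd')
          (isLUB_ap hne hd' ha σ _)
        rwa [image_image] at this
      · rw [hne.image_const]
        exact isLUB_singleton
  · rw [(hψ a h hh).1 hg]
    refine ⟨?_, fun _ _ => bot_le⟩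
    rintro _ ⟨x, hx, rfl⟩
    by_cases hxb : x = ⊥
    · exact (hψ0 x hxb).le
    · exact ((hψ x h (hd2 x hx hxb)).1 hg).le

/-- The Kleene approximations of the filtering function. -/
noncomputable def filterApprox (T : FilterSpec S L) : ℕ → StrictFun O O
  | 0 => ⊥
  | n + 1 => (exists_unfolds T (filterApprox T n)).choose

theorem unfolds_filterApprox (T : FilterSpec S L) (n : ℕ) :
    Unfolds T (filterApprox T n : StrictFun O O) (filterApprox T (n + 1) : StrictFun O O) :=
  (exists_unfolds T (filterApprox T n)).choose_spec

theorem filterApprox_mono (T : FilterSpec S L) : Monotone (filterApprox T : ℕ → StrictFun O O) := by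
  refine monotone_nat_of_le_succ fun n => ?_
  induction n with
  | zero => exact bot_le
  | succ n ih =>
    exact (unfolds_filterApprox T n).mono (StrictFun.continuous _) (StrictFun.strict _)
      (unfolds_filterApprox T (n + 1)) ih

theorem exists_filter (T : FilterSpec S L) : ∃ φ : StrictFun O O, ∀ x,
    IsLUB (range fun n => filterApprox T n x) (φ x) := by
  obtain ⟨φ, hφ⟩ := StrictFun.exists_pointwise (range_nonempty (filterApprox T : ℕ → StrictFun O O))
    (filterApprox_mono T).directed_le.directedOn_range
  refine ⟨φ, fun x => ?_⟩
  have := hφ x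
  rwa [← range_comp] at this

/-- The filtering function. -/
noncomputable def filter (T : FilterSpec S L) : StrictFun O O := (exists_filter T).choose

theorem isLUB_filter (T : FilterSpec S L) (x : O) :
    IsLUB (range fun n => filterApprox T n x) (filter T x) := (exists_filter T).choose_spec x

theorem filterApprox_le_filter (T : FilterSpec S L) (n : ℕ) (x : O) :
    filterApprox T n x ≤ filter T x := (isLUB_filter T x).1 ⟨n, rfl⟩

theorem directedOn_filterApprox (T : FilterSpec S L) (x : O) :
    DirectedOn (· ≤ ·) (range fun n => filterApprox T n x) := by
  have : Monotone fun n => filterApprox T n x := fun _ _ h => filterApprox_mono T h x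
  exact this.directed_le.directedOn_range

theorem isLUB_gate_filterApprox (T : FilterSpec S L) (P : Set S) (x : O) :
    IsLUB (range fun n => gate (filterApprox T n : StrictFun O O) P x) (gate (filter T) P x) := by
  by_cases h : ∃ h, hd x = some h ∧ h.1 ∈ P
  · simp only [gate, if_pos h]
    exact isLUB_filter T x
  · simp only [gate, if_neg h, range_const]
    exact isLUB_singleton

/-- The filtered value at a slot is continuous in the filtering function, in spite of the two
occurrences of the latter. -/
theorem isLUB_slotVal (T : FilterSpec S L) (h : Header S L) (x : O) (σ : Slot L)
    (v : Fin σ.2 → O) :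
    IsLUB (range fun n => slotVal T (filterApprox T n : StrictFun O O) h x σ v)
      (slotVal T (filter T) h x σ v) := by
  constructor
  · rintro _ ⟨n, rfl⟩
    exact slotVal_mono_left (StrictFun.continuous _) (StrictFun.strict _)
      (filterApprox_le_filter T n) h x σ v
  · intro u hu
    refine (isLUB_gate_filterApprox T _ _).2 ?_
    rintro _ ⟨n, rfl⟩
    -- the argument of `gate` is itself the supremum of a chain
    have hmono : Monotone fun m (i : Fin σ.2) =>
        gate (filterApprox T m : StrictFun O O) (T.acc h σ i) (v i) :=
      fun _ _ hml i => gate_mono_left (filterApprox_mono T hml) _ _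
    have hlub : IsLUB (range fun m (i : Fin σ.2) =>
        gate (filterApprox T m : StrictFun O O) (T.acc h σ i) (v i))
        (fun i => gate (filter T) (T.acc h σ i) (v i)) := by
      refine isLUB_pi.2 fun i => ?_
      rw [← range_comp]
      exact isLUB_gate_filterApprox T _ _
    refine ((continuous_ap x σ).comp (scottContinuous_gate (StrictFun.continuous _)
      (StrictFun.strict _) _) (range_nonempty _) hmono.directed_le.directedOn_range hlub).2 ?_
    rintro _ ⟨_, ⟨m, rfl⟩, rfl⟩
    refine le_trans ?_ (hu ⟨max n m, rfl⟩)
    exact (gate_mono_left (filterApprox_mono T (le_max_left n m)) _ _).trans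
      ((scottContinuous_gate (StrictFun.continuous _) (StrictFun.strict _) _).monotone
        (ap_monotone x σ (hmono (le_max_right n m))))

/-- The filtering function solves its recursive equations. -/
theorem unfolds_filter (T : FilterSpec S L) :
    Unfolds T (filter T : StrictFun O O) (filter T : StrictFun O O) where
  bot := StrictFun.strict _
  mismatch {x h} hx hg := le_bot_iff.1 ((isLUB_filter T x).2 (by
    rintro _ ⟨n, rfl⟩
    cases n with
    | zero => exact le_rfl
    | succ n => exact ((unfolds_filterApprox T n).mismatch hx hg).le))
  hd {x h} hx hg :=
    hd_of_le ((unfolds_filterApprox T 0).hd hx hg) (filterApprox_le_filter T 1 x)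
  ap {x h} hx hg σ v := by
    refine (isLUB_ap (range_nonempty _) (directedOn_filterApprox T x) (isLUB_filter T x) σ v).unique
      ?_
    rw [← range_comp]
    have e : ∀ n, ap (filterApprox T (n + 1) x) σ v = _ := fun n =>
      (unfolds_filterApprox T n).ap hx hg σ v
    constructor
    · rintro _ ⟨n, rfl⟩
      refine (ap_mono (filterApprox_mono T (Nat.le_succ n) x) σ v).trans ?_
      rw [e]
      split_ifs
      · exact (isLUB_slotVal T h x σ v).1 ⟨n, rfl⟩
      · exact le_rfl
    · intro u hu
      split_ifs with hok
      · refine (isLUB_slotVal T h x σ v).2 ?_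
        rintro _ ⟨n, rfl⟩
        have := hu ⟨n + 1, rfl⟩
        rw [Function.comp_apply, e, if_pos hok] at this
        exact this
      · exact bot_le

/-- The filtering function is below every solution of the recursive equations, continuous or not. -/
theorem filter_le_of_unfolds {ψ : O → O} (hψ : Unfolds T ψ ψ) (x : O) : filter T x ≤ ψ x := by
  refine (isLUB_filter T x).2 ?_
  rintro _ ⟨n, rfl⟩
  change filterApprox T n x ≤ ψ x
  induction n generalizing x with
  | zero => exact bot_le
  | succ n ih =>
    exact (unfolds_filterApprox T n).mono (StrictFun.continuous _) (StrictFun.strict _) hψ ih x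

/-! ### Filtering is a finitary projection -/

section Finitary

variable [Countable S] [Countable L]

/-- A compact element below the value of a continuous function at projected arguments is below its
value at compact fixed arguments. -/
theorem exists_fixed_args {n : ℕ} {p : Fin n → O → O} (hp : ∀ i, IsFinitaryProjection (p i))
    {g : (Fin n → O) → O} (hg : ScottContinuous g) {v : Fin n → O} {y : O}
    (hy : IsCompactElement y) (hyv : y ≤ g fun i => p i (v i)) :
    ∃ w : Fin n → O, (∀ i, IsCompactElement (w i) ∧ w i ≤ v i ∧ p i (w i) = w i) ∧ y ≤ g w := by
  have hne := fun i => (hp i).fixed_nonempty isScottDomain (v i)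
  have hdir := directedOn_univ_pi fun i => (hp i).directedOn_fixed isScottDomain (v i)
  have hlub := isLUB_univ_pi hne fun i => (hp i).isLUB_fixed isScottDomain (v i)
  have hpne := univ_pi_nonempty_iff.2 hne
  obtain ⟨_, ⟨w, hw, rfl⟩, hyw⟩ := hy _ _ (hpne.image _) (directedOn_image hg.monotone hdir)
    (hg hpne hdir hlub) hyv
  exact ⟨w, fun i => hw i trivial, hyw⟩

omit [Countable S] [Countable L] in
/-- The step object of compact fixed arguments and a fixed result at a declared slot is a fixed
point. These objects are the witnesses for the finitary condition. -/
theorem step_fixed {φ ψ : O → O} (h : Unfolds T φ ψ) {k : Header S L} (hk : T.good k) {σ : Slot L}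
    (hφ : IsFinitaryProjection φ)
    (hok : T.ok k σ) {w : Fin σ.2 → O} (hw : ∀ i, IsCompactElement (w i))
    (hw' : ∀ i : Fin σ.2, gate φ (T.acc k σ i) (w i) = w i) {e : O}
    (he : gate φ (T.res k σ) e = e) :
    ψ (step k σ w e) = step k σ w e := by
  have hs := hd_step hw (h := k) (e := e)
  refine ext_hd_ap ((h.hd hs hk).trans hs.symm) fun σ' v' => ?_
  rw [h.ap hs hk]
  by_cases hσ : σ'.Allowed k
  swap
  · rw [if_neg fun h => hσ (T.allowed_of_ok hk h), ap_of_not_allowed hs hσ]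
  by_cases hσσ : σ = σ'
  · subst hσσ
    rw [if_pos hok, slotVal, ap_step hw hσ, ap_step hw hσ]
    have : (⟨σ, w⟩ : Σ σ : Slot L, Fin σ.2 → O) ≤ ⟨σ, fun i => gate φ (T.acc k σ i) (v' i)⟩ ↔
        (⟨σ, w⟩ : Σ σ : Slot L, Fin σ.2 → O) ≤ ⟨σ, v'⟩ := by
      rw [Sigma.mk_le_mk_iff, Sigma.mk_le_mk_iff]
      constructor
      · exact fun h i => (h i).trans (gate_le hφ.le_self _ _)
      · intro h i
        rw [← hw' i]
        exact (hφ.gate _).continuous.monotone (h i)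
    by_cases hle : (⟨σ, w⟩ : Σ σ : Slot L, Fin σ.2 → O) ≤ ⟨σ, v'⟩
    · rw [if_pos hle, if_pos (this.2 hle), he]
    · rw [if_neg hle, if_neg fun h => hle (this.1 h), gate_bot]
  · have hn : ∀ v' : Fin σ'.2 → O, ¬ (⟨σ, w⟩ : Σ σ : Slot L, Fin σ.2 → O) ≤ ⟨σ', v'⟩ :=
      fun v' hle => by
        obtain ⟨h, _⟩ := Sigma.le_def.1 hle
        exact hσσ h
    rw [slotVal, ap_step hw hσ, ap_step hw hσ, if_neg (hn _), if_neg (hn _), gate_bot, ite_self]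

/-- Unfolding the recursive equations once preserves finitary projections. A compact part of a
filtered value of `x` at `v` is attained at compact fixed arguments below `v`, and is itself
below a compact fixed element; the corresponding step objects are compact fixed points below `x`. -/
theorem Unfolds.isFinitaryProjection {φ : O → O} {ψ : StrictFun O O} (h : Unfolds T φ ψ)
    (hφ : IsFinitaryProjection φ) : IsFinitaryProjection ψ := by
  have hle : ∀ x, ψ x ≤ x := by
    intro x
    by_cases hx : x = ⊥
    · rw [hx, h.bot]
    obtain ⟨k, hk⟩ := exists_hd hx
    by_cases hg : T.good k
    · refine (le_of_hd (h.hd hk hg)).2 ⟨hk, fun σ v => ?_⟩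
      rw [h.ap hk hg]
      split_ifs
      · exact (gate_le hφ.le_self _ _).trans
          (ap_monotone x σ fun i => gate_le hφ.le_self _ _)
      · exact bot_le
    · rw [h.mismatch hk hg]
      exact bot_le
  have idem : ∀ x, ψ (ψ x) = ψ x := by
    intro x
    by_cases hx : x = ⊥
    · rw [hx, h.bot, h.bot]
    obtain ⟨k, hk⟩ := exists_hd hx
    by_cases hg : T.good k
    · have hk' := h.hd hk hg
      refine ext_hd_ap ((h.hd hk' hg).trans hk'.symm) fun σ v => ?_
      rw [h.ap hk' hg, h.ap hk hg]
      by_cases hok : T.ok k σ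
      · rw [if_pos hok, if_pos hok, slotVal, h.ap hk hg, if_pos hok]
        simp only [slotVal, (hφ.gate _).idem]
      · rw [if_neg hok, if_neg hok]
    · rw [h.mismatch hk hg, h.bot]
  refine .of_exists ψ.continuous idem hle fun x c hc hcx => ?_
  -- the compact fixed points below `x` are directed, and `ψ x` is their supremum
  have hdir : DirectedOn (· ≤ ·) {e : O | IsCompactElement e ∧ e ≤ x ∧ ψ e = e} := by
    rintro c ⟨hc, hcx, hpc⟩ d ⟨hd, hdx, hpd⟩
    obtain ⟨z, hz⟩ := exists_isLUB (A := {c, d}) ⟨x, by rintro _ (rfl | rfl) <;> assumption⟩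
    refine ⟨z, ⟨IsScottDomain.isLUB_pair_compact hc hd hz, hz.2 ?_, ?_⟩, hz.1 (.inl rfl),
      hz.1 (.inr rfl)⟩
    · rintro _ (rfl | rfl) <;> assumption
    · refine (mem_range_iff_of_idem idem).1 (isLUB_mem_range ψ.mono idem hle ?_ hz)
      rintro _ (rfl | rfl)
      · exact ⟨_, hpc⟩
      · exact ⟨_, hpd⟩
  have hne : {e : O | IsCompactElement e ∧ e ≤ x ∧ ψ e = e}.Nonempty :=
    ⟨⊥, isCompactElement_bot, bot_le, h.bot⟩
  have hlub : IsLUB {e : O | IsCompactElement e ∧ e ≤ x ∧ ψ e = e} (ψ x) := by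
    refine ⟨?_, fun u hu => ?_⟩
    · rintro e ⟨_, hex, hpe⟩
      rw [← hpe]
      exact ψ.mono hex
    by_cases hx : x = ⊥
    · rw [hx, h.bot]
      exact bot_le
    obtain ⟨k, hk⟩ := exists_hd hx
    by_cases hg : T.good k
    swap
    · rw [h.mismatch hk hg]
      exact bot_le
    have hhead : head k ≤ u := by
      refine hu ⟨isCompactElement_head k, head_le_iff.2 hk,
        ext_hd_ap ((h.hd (hd_head k) hg).trans (hd_head k).symm) fun σ v => ?_⟩
      rw [h.ap (hd_head k) hg, slotVal, ap_head, ap_head, gate_bot, ite_self]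
    refine (le_of_hd (h.hd hk hg)).2 ⟨head_le_iff.1 hhead, fun σ v => ?_⟩
    rw [h.ap hk hg]
    split_ifs with hok
    swap
    · exact bot_le
    refine ((hφ.gate _).isLUB_fixed isScottDomain _).2 ?_
    rintro e ⟨he, hle', hpe⟩
    obtain ⟨w, hw, hew⟩ := exists_fixed_args (fun i : Fin σ.2 => hφ.gate (T.acc k σ i))
      (continuous_ap x σ) he hle'
    have hσ := T.allowed_of_ok hg hok
    have hmem : step k σ w e ≤ u :=
      hu ⟨isCompactElement_step (fun i => (hw i).1) he,
        (step_le_iff fun i => (hw i).1).2 ⟨hk, fun _ => hew⟩,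
        step_fixed h hg hφ hok (fun i => (hw i).1) (fun i => (hw i).2.2) hpe⟩
    exact (((step_le_iff fun i => (hw i).1).1 hmem).2 hσ).trans
      (ap_monotone u σ fun i => (hw i).2.1)
  obtain ⟨e, he, hce⟩ := hc _ _ hne hdir hlub hcx
  exact ⟨e, he.1, he.2.1, he.2.2, hce⟩

theorem isFinitaryProjection_filterApprox (T : FilterSpec S L) (n : ℕ) :
    IsFinitaryProjection (filterApprox T n : StrictFun O O) := by
  induction n with
  | zero =>
    exact .of_exists (StrictFun.continuous _) (fun _ => rfl) (fun _ => bot_le)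
      fun x c hc hcx => ⟨⊥, isCompactElement_bot, bot_le, rfl, hcx⟩
  | succ n ih => exact (unfolds_filterApprox T n).isFinitaryProjection ih

/-- A compact fixed point of the filtering function is a fixed point of an approximation. -/
theorem exists_filterApprox_eq {e : O} (he : IsCompactElement e) (h : filter T e = e) :
    ∃ n, filterApprox T n e = e := by
  obtain ⟨_, ⟨n, rfl⟩, hn⟩ := he _ _ (range_nonempty _) (directedOn_filterApprox T e)
    (isLUB_filter T e) h.ge
  exact ⟨n, le_antisymm ((isFinitaryProjection_filterApprox T n).le_self e) hn⟩

/-- Filtering is the supremum of a chain of finitary projections. A compact element below `filter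
x` is already below some approximation, whose compact fixed points are fixed points of filtering. -/
theorem isFinitaryProjection_filter (T : FilterSpec S L) :
    IsFinitaryProjection (filter T : StrictFun O O) := by
  have hle : ∀ x : O, filter T x ≤ x := fun x => (isLUB_filter T x).2 (by
    rintro _ ⟨n, rfl⟩
    exact (isFinitaryProjection_filterApprox T n).le_self x)
  refine .of_exists (StrictFun.continuous _) (fun x => le_antisymm (hle _) ?_) hle
    fun x c hc hcx => ?_
  · refine (isLUB_filter T x).2 ?_
    rintro _ ⟨n, rfl⟩
    have := (isFinitaryProjection_filterApprox T n).idem x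
    dsimp only
    rw [← this]
    exact ((filterApprox T n).mono (filterApprox_le_filter T n x)).trans
      (filterApprox_le_filter T n _)
  · obtain ⟨_, ⟨n, rfl⟩, hn⟩ := hc _ _ (range_nonempty _) (directedOn_filterApprox T x)
      (isLUB_filter T x) hcx
    obtain ⟨e, he, hex, hpe, hce⟩ :=
      ((isFinitaryProjection_filterApprox T n).finitary x c hc).1 hn
    refine ⟨e, he, hex, le_antisymm (hle e) ?_, hce⟩
    calc e = filterApprox T n e := hpe
      _ ≤ filter T e := filterApprox_le_filter T n e

/-! ### Validity -/

/-- `o` is bottom, or a member of `V` whose signature closure is in `P`. -/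
def Conforms (V : Set O) (P : Set S) (o : O) : Prop :=
  o = ⊥ ∨ (o ∈ V ∧ ∃ h, hd o = some h ∧ h.1 ∈ P)

/-- The validity clauses in terms of slots. -/
def SlotValid (T : FilterSpec S L) (V : Set O) (o : O) : Prop :=
  o = ⊥ ∨ ∃ h, hd o = some h ∧ T.good h ∧ ∀ σ v,
    (¬ T.ok h σ → ap o σ v = ⊥) ∧
    (T.ok h σ → Conforms V (T.res h σ) (ap o σ v) ∧
      ∃ w ≤ v, (∀ i : Fin σ.2, Conforms V (T.acc h σ i) (w i)) ∧ ap o σ w = ap o σ v)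

theorem conforms_range_iff {P : Set S} {o : O} :
    Conforms (range (filter T : StrictFun O O)) P o ↔ gate (filter T) P o = o := by
  rw [gate_eq_self_iff, Conforms,
    mem_range_iff_of_idem (isFinitaryProjection_filter T).idem]

/-- The fixed points of filtering are the objects that satisfy the validity clauses relative to
the set of fixed points. The admissible argument below `v` is the filtered `v`. -/
theorem mem_range_filter_iff {o : O} :
    o ∈ range (filter T : StrictFun O O) ↔ SlotValid T (range (filter T : StrictFun O O)) o := by
  have hF := isFinitaryProjection_filter (S := S) (L := L) T
  have hU := unfolds_filter (S := S) (L := L) T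
  rw [mem_range_iff_of_idem hF.idem]
  constructor
  · intro ho
    refine or_iff_not_imp_left.2 fun hb => ?_
    obtain ⟨h, hh⟩ := exists_hd hb
    have hg : T.good h := by
      by_contra hg
      rw [hU.mismatch hh hg] at ho
      exact hb ho.symm
    refine ⟨h, hh, hg, fun σ v => ?_⟩
    have hap := fun v => hU.ap hh hg σ v
    rw [ho] at hap
    refine ⟨fun hok => by rw [hap, if_neg hok], fun hok => ?_⟩
    simp only [if_pos hok] at hap
    refine ⟨conforms_range_iff.2 ?_, fun i => gate (filter T) (T.acc h σ i) (v i),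
      fun i => gate_le hF.le_self _ _, fun i => conforms_range_iff.2 ((hF.gate _).idem _), ?_⟩
    · rw [hap, slotVal, (hF.gate _).idem]
    · rw [hap, hap]
      simp only [slotVal, (hF.gate _).idem]
  · rintro (rfl | ⟨h, hh, hg, hv⟩)
    · exact StrictFun.strict _
    · refine ext_hd_ap ((hU.hd hh hg).trans hh.symm) fun σ v => ?_
      rw [hU.ap hh hg]
      split_ifs with hok
      · obtain ⟨h1, w, hwv, hw, hap⟩ := (hv σ v).2 hok
        have e : ap o σ (fun i => gate (filter T) (T.acc h σ i) (v i)) = ap o σ v := by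
          refine le_antisymm (ap_monotone o σ fun i => gate_le hF.le_self _ _) ?_
          rw [← hap]
          refine ap_monotone o σ fun i => ?_
          rw [← conforms_range_iff.1 (hw i)]
          exact (hF.gate _).continuous.monotone (hwv i)
        rw [slotVal, e]
        exact conforms_range_iff.1 h1
      · exact ((hv σ v).1 hok).symm

/-- A compact object in the image of filtering lies in every set that is closed under the validity
clauses: by induction on the number of the approximation that fixes the object. The compactness
of the values allows the argument of a method to be replaced by compact fixed points. -/
theorem mem_of_closed {V : Set O} (hV : ∀ p, SlotValid T V p → p ∈ V) {o : O}
    (ho : IsCompactElement o) (hf : filter T o = o) : o ∈ V := by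
  obtain ⟨n, hn⟩ := exists_filterApprox_eq ho hf
  clear hf
  induction n generalizing o with
  | zero => exact hV o (.inl hn.symm)
  | succ n ih =>
    have hF := isFinitaryProjection_filterApprox (S := S) (L := L) T n
    have hU := unfolds_filterApprox (S := S) (L := L) T n
    have hconf : ∀ {P : Set S} {y : O}, IsCompactElement y →
        gate (filterApprox T n : StrictFun O O) P y = y → Conforms V P y := by
      intro P y hy hyg
      rcases (gate_eq_self_iff).1 hyg with h | ⟨h1, h2⟩
      · exact .inl h
      · exact .inr ⟨ih hy h1, h2⟩
    refine hV o (or_iff_not_imp_left.2 fun hb => ?_)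
    obtain ⟨h, hh⟩ := exists_hd hb
    have hg : T.good h := by
      by_contra hg
      rw [hU.mismatch hh hg] at hn
      exact hb hn.symm
    refine ⟨h, hh, hg, fun σ v => ?_⟩
    have hap := fun v => hU.ap hh hg σ v
    rw [hn] at hap
    refine ⟨fun hok => by rw [hap, if_neg hok], fun hok => ?_⟩
    simp only [if_pos hok] at hap
    obtain ⟨_⟩ := exists_primcodable L
    have hy := isCompactElement_ap ho σ v
    refine ⟨hconf hy ?_, ?_⟩
    · rw [hap, slotVal, (hF.gate _).idem]
    · have hle : ap o σ v ≤
          ap o σ fun i => gate (filterApprox T n : StrictFun O O) (T.acc h σ i) (v i) := by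
        conv_lhs => rw [hap]
        exact gate_le hF.le_self _ _
      obtain ⟨w, hw, hyw⟩ := exists_fixed_args (fun i : Fin σ.2 => hF.gate (T.acc h σ i))
        (continuous_ap o σ) hy hle
      exact ⟨w, fun i => (hw i).2.1, fun i => hconf (hw i).1 (hw i).2.2,
        le_antisymm (ap_monotone o σ fun i => (hw i).2.1) hyw⟩

end Finitary

end PreObj

/-! ### Atoms below filtered suprema of atoms -/

namespace PreObj

variable {S L : Type} [Primcodable L] {hof : ℕ → Header S L} {T : FilterSpec S L}

local notation "O" => PreObj S L

theorem not_den_le_bot {n : ℕ} : ¬ den hof n ≤ (⊥ : O) := fun h => by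
  have := hd_den (hof := hof) n
  rw [le_bot_iff.1 h] at this
  simp at this

/-- An atom is below a gated object if it is below the ungated one and its own signature closure,
which is then that of the object, is admitted. -/
theorem den_le_gate_iff {φ : O → O} (hle : ∀ x, φ x ≤ x) {P : Set S} {n : ℕ} {o : O} :
    den hof n ≤ gate φ P o ↔ den hof n ≤ φ o ∧ (hof (hdCode L n)).1 ∈ P := by
  constructor
  · intro h
    by_cases hP : ∃ h, hd o = some h ∧ h.1 ∈ P
    · rw [gate, if_pos hP] at h
      obtain ⟨k, hk, hkP⟩ := hP
      have := (den_le_iff.1 (h.trans (hle o))).1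
      rw [hk] at this
      rw [← Option.some_injective _ this]
      exact ⟨h, hkP⟩
    · rw [gate, if_neg hP] at h
      exact absurd h not_den_le_bot
  · rintro ⟨h, hP⟩
    rwa [gate_of_mem (den_le_iff.1 (h.trans (hle o))).1 hP]

/-- The slot of the atom `y` is declared. -/
def OkAt (T : FilterSpec S L) (hof : ℕ → Header S L) (y : ℕ) : Prop :=
  ∃ σ, slotOf L y = some σ ∧ T.ok (hof (hdCode L y)) σ

/-- The signature closure of the atom `z` is admitted for the `i`-th argument at the slot of `y`. -/
def AccAt (T : FilterSpec S L) (hof : ℕ → Header S L) (y i z : ℕ) : Prop :=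
  ∃ σ, slotOf L y = some σ ∧ (hof (hdCode L z)).1 ∈ T.acc (hof (hdCode L y)) σ i

/-- The signature closure of the atom `z` is admitted for the result at the slot of `y`. -/
def ResAt (T : FilterSpec S L) (hof : ℕ → Header S L) (y z : ℕ) : Prop :=
  ∃ σ, slotOf L y = some σ ∧ (hof (hdCode L z)).1 ∈ T.res (hof (hdCode L y)) σ

/-- One unfolding of the recursive characterization of the atoms below a filtered supremum of atoms,
relative to a relation `P` in its place. The headers have to agree and to be good; and unless the
atom is void (it has no allowed slot, or its arguments are inconsistent), the filtered arguments of
the atom have to make some atoms of the list fire, whose filtered results yield that of the atom. -/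
def BelowStep (T : FilterSpec S L) (hof : ℕ → Header S L) (P : List ℕ × ℕ → Prop)
    (q : List ℕ × ℕ) : Prop :=
  (Con hof q.1 ∧ T.good (hof (hdCode L q.2)) ∧
    ∃ k ∈ q.1, hof (hdCode L k) = hof (hdCode L q.2)) ∧
  (¬ Act hof q.2 ∨ (∃ i ∈ List.range (numArgs L q.2), ¬ Con hof (argOf L q.2 i)) ∨
    (Act hof q.2 ∧ OkAt T hof q.2) ∧ ResAt T hof q.2 (resOf L q.2) ∧ ∃ J ∈ q.1.sublists',
      (∀ j ∈ J, slotOf L j = slotOf L q.2 ∧ ∀ i ∈ List.range (numArgs L q.2),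
        ∀ z ∈ argOf L j i, P (argOf L q.2 i, z) ∧ AccAt T hof q.2 i z) ∧
      P (J.map (resOf L), resOf L q.2))

/-- Whether an atom is below the filtered supremum of a consistent list of atoms is determined by
the same question about the arguments and the results of these atoms. -/
theorem below_iff_belowStep {φ : O → O} (hU : Unfolds T φ φ) (hle : ∀ x, φ x ≤ x)
    (hmono : Monotone φ) (q : List ℕ × ℕ) :
    (Con hof q.1 ∧ den hof q.2 ≤ φ (join hof q.1)) ↔
      BelowStep T hof (fun q => Con hof q.1 ∧ den hof q.2 ≤ φ (join hof q.1)) q := by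
  obtain ⟨X, y⟩ := q
  constructor
  · rintro ⟨hX, hy⟩
    dsimp only at hX hy
    have hd1 := (den_le_iff.1 hy).1
    have hd2 := (den_le_iff.1 (hy.trans (hle _))).1
    have hg : T.good (hof (hdCode L y)) := by
      by_contra hg
      rw [hU.mismatch hd2 hg] at hy
      exact not_den_le_bot hy
    obtain ⟨k, hk⟩ := exists_mem_of_hd_join hd2
    refine ⟨⟨hX, hg, k, hk, hof_eq_of_hd_join hX hd2 hk⟩, ?_⟩
    rw [or_iff_not_imp_left, or_iff_not_imp_left]
    intro hact hc
    dsimp only at hact hc ⊢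
    push Not at hact hc
    obtain ⟨σ, hσ, ha⟩ := hact
    rw [numArgs_eq hσ] at hc ⊢
    simp only [List.mem_range] at hc ⊢
    have h1 := (den_le_iff.1 hy).2 σ hσ ha hc
    rw [hU.ap hd2 hg] at h1
    by_cases hok : T.ok (hof (hdCode L y)) σ
    swap
    · rw [if_neg hok] at h1
      exact absurd h1 not_den_le_bot
    rw [if_pos hok, slotVal, den_le_gate_iff hle] at h1
    obtain ⟨h1, hres⟩ := h1
    obtain ⟨J, hJX, hJ, hJc, hJe⟩ := exists_sublist_ap_join hX hd2 ha
      fun i => gate φ (T.acc (hof (hdCode L y)) σ i) (join hof (argOf L y i))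
    rw [hJe] at h1
    refine ⟨⟨⟨σ, hσ, ha⟩, σ, hσ, hok⟩, ⟨σ, hσ, hres⟩, J, hJX, fun j hj => ?_, hJc, h1⟩
    obtain ⟨hj1, hj2, hj3⟩ := hJ j hj
    refine ⟨hj2.trans hσ.symm, fun i hi z hz => ?_⟩
    obtain ⟨h2, h3⟩ := (den_le_gate_iff hle).1 (hj3 ⟨i, hi⟩ z hz)
    exact ⟨⟨hc i hi, h2⟩, σ, hσ, h3⟩
  · rintro ⟨⟨hX, hg, k, hk, hky⟩, h⟩
    dsimp only at hX hg hk hky h ⊢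
    have hd2 : hd (join hof X) = some (hof (hdCode L y)) := hky ▸ hd_join_of_mem hX hk
    refine ⟨hX, den_le_iff.2 ⟨hU.hd hd2 hg, fun σ hσ ha hc => ?_⟩⟩
    rw [numArgs_eq hσ] at h
    simp only [List.mem_range] at h
    rcases h with h | ⟨i, hi, h⟩ | ⟨⟨_, σ', hσ', hok⟩, ⟨σ'', hσ'', hres⟩, J, hJX, hJ, hJc, hJr⟩
    · exact absurd ⟨σ, hσ, ha⟩ h
    · exact absurd (hc i hi) h
    rw [hσ] at hσ' hσ''
    obtain rfl := Option.some_injective _ hσ'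
    obtain rfl := Option.some_injective _ hσ''
    rw [hU.ap hd2 hg, if_pos hok, slotVal, den_le_gate_iff hle]
    refine ⟨hJr.trans (hmono ((join_le_iff hJc).2 fun z hz => ?_)), hres⟩
    obtain ⟨j, hj, rfl⟩ := List.mem_map.1 hz
    refine (isLUB_ap_join hX hd2 ha _).1 ⟨j, ⟨(List.mem_sublists'.1 hJX).subset hj,
      (hJ j hj).1.trans hσ, fun i z hz => ?_⟩, rfl⟩
    obtain ⟨⟨_, h2⟩, σ', hσ', h3⟩ := (hJ j hj).2 i i.2 z hz
    rw [hσ] at hσ'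
    obtain rfl := Option.some_injective _ hσ'
    exact (den_le_gate_iff hle).2 ⟨h2, h3⟩

/-- The specification for which filtering is the identity. With it, the characterization of the
atoms below filtered suprema specializes to the order on atoms and their suprema. -/
def trivialSpec (S L : Type) : FilterSpec S L where
  good _ := True
  ok h σ := σ.Allowed h
  allowed_of_ok _ h := h
  acc _ _ _ := univ
  res _ _ := univ

omit [Primcodable L] in
theorem gate_id_univ (o : O) : gate id univ o = o := by
  by_cases h : o = ⊥
  · rw [h, gate_bot]
  · obtain ⟨h, hh⟩ := exists_hd h
    exact gate_of_mem hh (mem_univ _)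

omit [Primcodable L] in
theorem unfolds_id : Unfolds (trivialSpec S L) (id : O → O) id where
  bot := rfl
  mismatch _ h := absurd trivial h
  hd h _ := h
  ap {x h} hx _ σ v := by
    by_cases hσ : σ.Allowed h
    · rw [if_pos (by exact hσ), slotVal]
      change _ = gate id univ (ap x σ fun i => gate id univ (v i))
      simp only [gate_id_univ, id]
    · rw [if_neg (by exact hσ)]
      exact ap_of_not_allowed hx hσ v

end PreObj

/-! ### Recursively enumerable and computable predicates -/

section Computability

variable {α β : Type} [Primcodable α] [Primcodable β]

/-- Normal form: a recursively enumerable predicate holds if it is recognized within a finite number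
of steps, and recognition within `n` steps is primitive recursive and monotone in `n`. -/
theorem _root_.REPred.exists_primrecRel {p : α → Prop} (hp : REPred p) :
    ∃ q : α → ℕ → Prop, PrimrecRel q ∧ (∀ a m n, m ≤ n → q a m → q a n) ∧
      ∀ a, p a ↔ ∃ n, q a n := by
  obtain ⟨c, hc⟩ := Nat.Partrec.Code.exists_code.1 hp
  have h1 : ∀ a, (c.eval (Encodable.encode a)).Dom ↔ p a := fun a => by
    rw [hc]
    simp only [Encodable.encodek, Part.coe_some, Part.bind_some]
    exact ⟨fun h => h.1, fun h => ⟨h, trivial⟩⟩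
  refine ⟨fun a n => (c.evaln n (Encodable.encode a)).isSome, ?_, fun a m n hmn h => ?_,
    fun a => ?_⟩
  · refine Primrec₂.primrecRel ?_
    have : Primrec₂ fun (a : α) (n : ℕ) => (c.evaln n (Encodable.encode a)).isSome :=
      Primrec.option_isSome.comp (Nat.Partrec.Code.primrec_evaln.comp
        ((Primrec.snd.pair (Primrec.const c)).pair (Primrec.encode.comp Primrec.fst)))
    simpa using this
  · obtain ⟨x, hx⟩ := Option.isSome_iff_exists.1 h
    exact Option.isSome_iff_exists.2 ⟨x, Nat.Partrec.Code.evaln_mono hmn hx⟩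
  · rw [← h1, Part.dom_iff_mem]
    simp only [Option.isSome_iff_exists, Nat.Partrec.Code.evaln_complete]
    exact exists_comm

theorem _root_.PrimrecRel.rePred_exists {q : α → ℕ → Prop} (hq : PrimrecRel q) :
    REPred fun a => ∃ n, q a n := by
  classical
  exact (Partrec.rfind (p := fun a n => Part.some (decide (q a n)))
    hq.decide.to_comp.partrec₂).dom_re.of_eq fun a => Nat.rfind_dom'.trans
      ⟨fun ⟨n, h, _⟩ => ⟨n, by simpa using h⟩,
        fun ⟨n, h⟩ => ⟨n, by simpa using h, fun _ => trivial⟩⟩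

theorem _root_.REPred.comp {p : β → Prop} (hp : REPred p) {f : α → β} (hf : Computable f) :
    REPred fun a => p (f a) := Partrec.comp hp hf

theorem _root_.ComputablePred.comp {p : β → Prop} (hp : ComputablePred p) {f : α → β}
    (hf : Computable f) : ComputablePred fun a => p (f a) := by
  obtain ⟨_, hp⟩ := hp
  exact ⟨inferInstance, hp.comp hf⟩

theorem _root_.REPred.and {p q : α → Prop} (hp : REPred p) (hq : REPred q) :
    REPred fun a => p a ∧ q a := by
  obtain ⟨p', hp1, hp2, hp3⟩ := hp.exists_primrecRel
  obtain ⟨q', hq1, hq2, hq3⟩ := hq.exists_primrecRel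
  refine (PrimrecRel.rePred_exists (q := fun a n => p' a n ∧ q' a n)
    (PrimrecPred.and hp1 hq1)).of_eq fun a => ?_
  rw [hp3, hq3]
  constructor
  · rintro ⟨n, h1, h2⟩
    exact ⟨⟨n, h1⟩, n, h2⟩
  · rintro ⟨⟨m, h1⟩, n, h2⟩
    exact ⟨max m n, hp2 _ _ _ (le_max_left _ _) h1, hq2 _ _ _ (le_max_right _ _) h2⟩

theorem _root_.REPred.or {p q : α → Prop} (hp : REPred p) (hq : REPred q) :
    REPred fun a => p a ∨ q a := by
  obtain ⟨p', hp1, hp2, hp3⟩ := hp.exists_primrecRel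
  obtain ⟨q', hq1, hq2, hq3⟩ := hq.exists_primrecRel
  refine (PrimrecRel.rePred_exists (q := fun a n => p' a n ∨ q' a n)
    (PrimrecPred.or hp1 hq1)).of_eq fun a => ?_
  rw [hp3, hq3, exists_or]

theorem _root_.REPred.exists_mem {p : α → β → Prop} (hp : REPred fun x : α × β => p x.1 x.2)
    {l : α → List β} (hl : Computable l) : REPred fun a => ∃ b ∈ l a, p a b := by
  obtain ⟨q, hq1, hq2, hq3⟩ := hp.exists_primrecRel
  have h1 : REPred fun x : α × List β => ∃ b ∈ x.2, p x.1 b := by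
    refine (PrimrecRel.rePred_exists (q := fun (x : α × List β) n => ∃ b ∈ x.2, q (x.1, b) n)
      ?_).of_eq fun x => ?_
    · have : PrimrecRel fun (b : β) (y : α × ℕ) => q (y.1, b) y.2 :=
        PrimrecRel.comp hq1 ((Primrec.fst.comp Primrec.snd).pair Primrec.fst)
          (Primrec.snd.comp Primrec.snd)
      exact PrimrecRel.comp (PrimrecRel.exists_mem_list this) (Primrec.snd.comp Primrec.fst)
        ((Primrec.fst.comp Primrec.fst).pair Primrec.snd)
    · simp only [hq3 (_, _)]
      constructor
      · rintro ⟨n, b, hb, h⟩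
        exact ⟨b, hb, n, h⟩
      · rintro ⟨b, hb, n, h⟩
        exact ⟨n, b, hb, h⟩
  exact h1.comp (Computable.id.pair hl)

/-- Bounded universal quantification: the numbers of steps in which the finitely many instances
are recognized have a common upper bound. -/
theorem _root_.REPred.forall_mem {p : α → β → Prop} (hp : REPred fun x : α × β => p x.1 x.2)
    {l : α → List β} (hl : Computable l) : REPred fun a => ∀ b ∈ l a, p a b := by
  obtain ⟨q, hq1, hq2, hq3⟩ := hp.exists_primrecRel
  have h1 : REPred fun x : α × List β => ∀ b ∈ x.2, p x.1 b := by
    refine (PrimrecRel.rePred_exists (q := fun (x : α × List β) n => ∀ b ∈ x.2, q (x.1, b) n)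
      ?_).of_eq fun x => ?_
    · have : PrimrecRel fun (b : β) (y : α × ℕ) => q (y.1, b) y.2 :=
        PrimrecRel.comp hq1 ((Primrec.fst.comp Primrec.snd).pair Primrec.fst)
          (Primrec.snd.comp Primrec.snd)
      exact PrimrecRel.comp (PrimrecRel.forall_mem_list this) (Primrec.snd.comp Primrec.fst)
        ((Primrec.fst.comp Primrec.fst).pair Primrec.snd)
    · simp only [hq3 (_, _)]
      constructor
      · rintro ⟨n, h⟩ b hb
        exact ⟨n, h b hb⟩
      · obtain ⟨a, l⟩ := x
        intro h
        induction l with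
        | nil => exact ⟨0, by simp⟩
        | cons c l ih =>
          obtain ⟨m, hm⟩ := h c (by simp)
          obtain ⟨n, hn⟩ := ih fun b hb => h b (List.mem_cons_of_mem _ hb)
          refine ⟨max m n, fun b hb => ?_⟩
          rcases List.mem_cons.1 hb with rfl | hb
          · exact hq2 _ _ _ (le_max_left _ _) hm
          · exact hq2 _ _ _ (le_max_right _ _) (hn b hb)
  exact h1.comp (Computable.id.pair hl)

theorem _root_.REPred.exists {p : α → β → Prop} (hp : REPred fun x : α × β => p x.1 x.2) :
    REPred fun a => ∃ b, p a b := by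
  have h0 : REPred fun x : α × ℕ => ∃ b ∈ (Encodable.decode (α := β) x.2).toList, p x.1 b :=
    REPred.exists_mem (p := fun (x : α × ℕ) b => p x.1 b)
      (hp.comp ((Computable.fst.comp Computable.fst).pair Computable.snd))
      (Primrec.optionToList.to_comp.comp (Computable.decode.comp Computable.snd))
  obtain ⟨q, hq1, hq2, hq3⟩ := h0.exists_primrecRel
  refine (PrimrecRel.rePred_exists (q := fun (a : α) n => q (a, n.unpair.1) n.unpair.2)
      ?_).of_eq fun a => ?_
  · exact PrimrecRel.comp hq1
      (Primrec.fst.pair (Primrec.fst.comp (Primrec.unpair.comp Primrec.snd)))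
      (Primrec.snd.comp (Primrec.unpair.comp Primrec.snd))
  · constructor
    · rintro ⟨n, h⟩
      obtain ⟨b, _, hb⟩ := (hq3 _).2 ⟨_, h⟩
      exact ⟨b, hb⟩
    · rintro ⟨b, hb⟩
      obtain ⟨n, hn⟩ := (hq3 (a, Encodable.encode b)).1 ⟨b, by simp, hb⟩
      exact ⟨Nat.pair (Encodable.encode b) n, by simpa using hn⟩

theorem _root_.ComputablePred.and {p q : α → Prop} (hp : ComputablePred p) (hq : ComputablePred q) :
    ComputablePred fun a => p a ∧ q a := by
  rw [ComputablePred.computable_iff_re_compl_re'] at *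
  exact ⟨hp.1.and hq.1, (hp.2.or hq.2).of_eq fun a => not_and_or.symm⟩

theorem _root_.ComputablePred.or {p q : α → Prop} (hp : ComputablePred p) (hq : ComputablePred q) :
    ComputablePred fun a => p a ∨ q a := by
  rw [ComputablePred.computable_iff_re_compl_re'] at *
  exact ⟨hp.1.or hq.1, (hp.2.and hq.2).of_eq fun a => not_or.symm⟩

theorem _root_.ComputablePred.imp {p q : α → Prop} (hp : ComputablePred p)
    (hq : ComputablePred q) : ComputablePred fun a => p a → q a :=
  (hp.not.or hq).of_eq fun _ => imp_iff_not_or.symm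

theorem _root_.ComputablePred.iff {p q : α → Prop} (hp : ComputablePred p)
    (hq : ComputablePred q) : ComputablePred fun a => p a ↔ q a :=
  ((hp.imp hq).and (hq.imp hp)).of_eq fun _ => iff_iff_implies_and_implies.symm

theorem _root_.ComputablePred.exists_mem {p : α → β → Prop}
    (hp : ComputablePred fun x : α × β => p x.1 x.2) {l : α → List β} (hl : Computable l) :
    ComputablePred fun a => ∃ b ∈ l a, p a b := by
  rw [ComputablePred.computable_iff_re_compl_re'] at *
  exact ⟨hp.1.exists_mem hl, (REPred.forall_mem (p := fun a b => ¬ p a b) hp.2 hl).of_eq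
    fun a => by simp⟩

theorem _root_.ComputablePred.forall_mem {p : α → β → Prop}
    (hp : ComputablePred fun x : α × β => p x.1 x.2) {l : α → List β} (hl : Computable l) :
    ComputablePred fun a => ∀ b ∈ l a, p a b := by
  rw [ComputablePred.computable_iff_re_compl_re'] at *
  exact ⟨hp.1.forall_mem hl, (REPred.exists_mem (p := fun a b => ¬ p a b) hp.2 hl).of_eq
    fun a => by simp⟩

theorem computablePred_eq {f g : α → β} (hf : Computable f) (hg : Computable g) :
    ComputablePred fun a => f a = g a := by
  have h : PrimrecPred fun x : β × β => x.1 = x.2 := Primrec.eq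
  exact h.computablePred.comp (hf.pair hg)

theorem computablePred_mem {f : α → β} {l : α → List β} (hf : Computable f) (hl : Computable l) :
    ComputablePred fun a => f a ∈ l a :=
  (ComputablePred.exists_mem (p := fun a b => f a = b)
    (computablePred_eq (hf.comp .fst) .snd) hl).of_eq fun a => by simp

theorem computablePred_const (p : Prop) : ComputablePred fun _ : α => p := by
  classical exact ⟨inferInstance, Computable.const (decide p)⟩

/-! ### Recursion on queries -/

omit [Primcodable α] in
/-- A finite set of queries that contains `q` and is closed under subqueries. -/
theorem exists_closed_list {Q : α → List α} {μ : α → ℕ} (hμ : ∀ q, ∀ r ∈ Q q, μ r < μ q) (q : α) :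
    ∃ W : List α, q ∈ W ∧ ∀ r ∈ W, ∀ s ∈ Q r, s ∈ W := by
  induction hn : μ q using Nat.strong_induction_on generalizing q with
  | _ n ih =>
    subst hn
    have : ∀ r, ∃ W : List α, r ∈ Q q → r ∈ W ∧ ∀ t ∈ W, ∀ s ∈ Q t, s ∈ W := fun r => by
      by_cases hr : r ∈ Q q
      · obtain ⟨W, hW⟩ := ih _ (hμ q r hr) r rfl
        exact ⟨W, fun _ => hW⟩
      · exact ⟨[], fun h => absurd h hr⟩
    choose W hW using this
    refine ⟨q :: (Q q).flatMap W, by simp, fun r hr s hs => ?_⟩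
    rcases List.mem_cons.1 hr with rfl | hr
    · exact List.mem_cons_of_mem _ (List.mem_flatMap.2 ⟨s, hs, (hW s hs).1⟩)
    · obtain ⟨t, ht, hr⟩ := List.mem_flatMap.1 hr
      exact List.mem_cons_of_mem _ (List.mem_flatMap.2 ⟨t, ht, (hW t ht).2 r hr s hs⟩)

/-- A predicate is decidable if its value at `q` can be computed from its values at a finite list
of subqueries of smaller measure. Here `Ψ q T` evaluates the predicate at `q` from the list `T` of
those subqueries for which it holds. -/
theorem computablePred_of_recursion {P : α → Prop} {Q : α → List α} (hQ : Computable Q)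
    {μ : α → ℕ} (hμ : ∀ q, ∀ r ∈ Q q, μ r < μ q) {Ψ : α → List α → Prop}
    (hΨ : ComputablePred fun x : α × List α => Ψ x.1 x.2)
    (h : ∀ q T, (∀ r ∈ Q q, r ∈ T ↔ P r) → (Ψ q T ↔ P q)) : ComputablePred P := by
  classical
  -- a certificate: a closed set `W` of queries, and the list `T` of those among them that hold
  let C : α → List α × List α → Prop := fun q c => q ∈ c.1 ∧
    ∀ q' ∈ c.1, (∀ r ∈ Q q', r ∈ c.1) ∧ (q' ∈ c.2 ↔ Ψ q' c.2)
  have hC : ComputablePred fun x : α × (List α × List α) => C x.1 x.2 := by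
    refine (computablePred_mem .fst (Computable.fst.comp .snd)).and
      (ComputablePred.forall_mem (p := fun (x : α × (List α × List α)) q' =>
        (∀ r ∈ Q q', r ∈ x.2.1) ∧ (q' ∈ x.2.2 ↔ Ψ q' x.2.2)) (.and ?_ ?_)
        (Computable.fst.comp .snd))
    · exact ComputablePred.forall_mem
        (p := fun (y : (α × (List α × List α)) × α) r => r ∈ y.1.2.1)
        (computablePred_mem .snd
          (Computable.fst.comp (Computable.snd.comp (Computable.fst.comp .fst)))) (hQ.comp .snd)
    · have h2 : Computable fun y : (α × (List α × List α)) × α => y.1.2.2 :=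
        Computable.snd.comp (Computable.snd.comp .fst)
      exact (computablePred_mem .snd h2).iff (hΨ.comp (Computable.snd.pair h2))
  have hsound : ∀ q c, C q c → (q ∈ c.2 ↔ P q) := by
    intro q c hc
    induction hn : μ q using Nat.strong_induction_on generalizing q with
    | _ n ih =>
      subst hn
      refine (hc.2 q hc.1).2.trans (h q c.2 fun r hr => ?_)
      exact ih _ (hμ q r hr) r ⟨(hc.2 q hc.1).1 r hr, hc.2⟩ rfl
  have hex : ∀ q, ∃ c, C q c := by
    intro q
    obtain ⟨W, hqW, hW⟩ := exists_closed_list hμ q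
    refine ⟨(W, W.filter P), hqW, fun q' hq' => ⟨hW q' hq', ?_⟩⟩
    rw [h q' _ fun r hr => by simp [hW q' hq' r hr]]
    simp [hq']
  rw [ComputablePred.computable_iff_re_compl_re']
  constructor
  · refine (REPred.exists (p := fun q c => C q c ∧ q ∈ c.2)
      (hC.and (computablePred_mem .fst (Computable.snd.comp .snd))).to_re).of_eq fun q => ?_
    constructor
    · rintro ⟨c, hc, hq⟩
      exact (hsound q c hc).1 hq
    · intro hq
      obtain ⟨c, hc⟩ := hex q
      exact ⟨c, hc, (hsound q c hc).2 hq⟩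
  · refine (REPred.exists (p := fun q c => C q c ∧ ¬ q ∈ c.2)
      (hC.and (computablePred_mem .fst (Computable.snd.comp .snd)).not).to_re).of_eq fun q => ?_
    constructor
    · rintro ⟨c, hc, hq⟩
      exact fun h => hq ((hsound q c hc).2 h)
    · intro hq
      obtain ⟨c, hc⟩ := hex q
      exact ⟨c, hc, fun h => hq ((hsound q c hc).1 h)⟩

/-- A predicate is recursively enumerable if it satisfies a monotone recursion over a finite list
of subqueries of smaller measure. -/
theorem rePred_of_recursion {P : α → Prop} {Q : α → List α}
    {μ : α → ℕ} (hμ : ∀ q, ∀ r ∈ Q q, μ r < μ q) {Ψ : α → List α → Prop}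
    (hΨ : REPred fun x : α × List α => Ψ x.1 x.2)
    (sound : ∀ q T, (∀ r ∈ Q q, r ∈ T → P r) → Ψ q T → P q)
    (complete : ∀ q T, (∀ r ∈ Q q, P r → r ∈ T) → P q → Ψ q T) : REPred P := by
  classical
  refine (REPred.exists (p := fun q T => (∀ q' ∈ T, Ψ q' T) ∧ q ∈ T) (.and ?_
    (computablePred_mem .fst .snd).to_re)).of_eq fun q => ?_
  · exact REPred.forall_mem (p := fun (x : α × List α) q' => Ψ q' x.2)
      (hΨ.comp (Computable.snd.pair (Computable.snd.comp .fst))) .snd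
  constructor
  · rintro ⟨T, hT, hq⟩
    induction hn : μ q using Nat.strong_induction_on generalizing q with
    | _ n ih =>
      subst hn
      exact sound q T (fun r hr hrT => ih _ (hμ q r hr) r hrT rfl) (hT q hq)
  · intro hq
    obtain ⟨W, hqW, hW⟩ := exists_closed_list hμ q
    refine ⟨W.filter P, fun q' hq' => ?_, by simp [hqW, hq]⟩
    simp only [List.mem_filter, decide_eq_true_eq] at hq'
    exact complete q' _ (fun r hr hPr => by simp [hW q' hq'.1 r hr, hPr]) hq'.2

/-- A non-empty recursively enumerable set is the range of a computable function. -/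
theorem exists_computable_range_eq {p : α → Prop} (hp : REPred p) (hne : ∃ a, p a) :
    ∃ r : ℕ → α, Computable r ∧ ∀ a, p a ↔ ∃ n, r n = a := by
  classical
  obtain ⟨a0, h0⟩ := hne
  obtain ⟨q, hq1, hq2, hq3⟩ := hp.exists_primrecRel
  have hd : Computable fun n : ℕ => (Encodable.decode (α := α) n.unpair.1).getD a0 :=
    Computable.option_getD (Computable.decode.comp (Computable.fst.comp .unpair)) (.const a0)
  have hb : ComputablePred fun n : ℕ =>
      q ((Encodable.decode (α := α) n.unpair.1).getD a0) n.unpair.2 := by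
    have : ComputablePred fun x : α × ℕ => q x.1 x.2 := PrimrecPred.computablePred hq1
    exact this.comp (hd.pair (Computable.snd.comp .unpair))
  refine ⟨fun n => bif decide (q ((Encodable.decode (α := α) n.unpair.1).getD a0) n.unpair.2)
    then (Encodable.decode (α := α) n.unpair.1).getD a0 else a0,
    Computable.cond hb.decide hd (.const a0), fun a => ⟨fun ha => ?_, ?_⟩⟩
  · obtain ⟨n, hn⟩ := (hq3 a).1 ha
    exact ⟨Nat.pair (Encodable.encode a) n, by simp [hn]⟩
  · rintro ⟨n, rfl⟩
    by_cases h : q ((Encodable.decode (α := α) n.unpair.1).getD a0) n.unpair.2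
    · simp only [h, decide_true, cond_true]
      exact (hq3 _).2 ⟨_, h⟩
    · simp only [h, decide_false, cond_false]
      exact h0

end Computability

end NOOP

namespace NOOP

open PreObj

/-! ### Primitive recursive functions on codes -/

section Codes

attribute [local fun_prop] Primrec Primrec.id Primrec.const Primrec.comp Primrec.pair Primrec.fst
  Primrec.snd

section Lists

variable {α β γ : Type} [Primcodable α] [Primcodable β] [Primcodable γ]

theorem primrec_append {f g : α → List β} (hf : Primrec f) (hg : Primrec g) :
    Primrec fun a => f a ++ g a := Primrec.list_append.comp hf hg

theorem primrec_cons {f : α → β} {g : α → List β} (hf : Primrec f) (hg : Primrec g) :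
    Primrec fun a => f a :: g a := Primrec.list_cons.comp hf hg

theorem primrec_map {f : α → List β} {g : α → β → γ} (hf : Primrec f)
    (hg : Primrec fun x : α × β => g x.1 x.2) : Primrec fun a => (f a).map (g a) :=
  Primrec.list_map hf hg

theorem primrec_flatMap {f : α → List β} {g : α → β → List γ} (hf : Primrec f)
    (hg : Primrec fun x : α × β => g x.1 x.2) : Primrec fun a => (f a).flatMap (g a) :=
  Primrec.list_flatMap hf hg

theorem primrec_sublists' : Primrec (List.sublists' : List α → List (List α)) := by
  have h : Primrec fun l : List α =>
      l.foldr (fun a (r : List (List α)) => r ++ r.map (List.cons a)) [[]] := by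
    refine Primrec.list_foldr (f := id)
      (h := fun (_ : List α) (x : α × List (List α)) => x.2 ++ x.2.map (List.cons x.1))
      Primrec.id (Primrec.const _) (primrec_append (by fun_prop) ?_)
    exact primrec_map (g := fun (y : List α × (α × List (List α))) l => y.2.1 :: l) (by fun_prop)
      (primrec_cons (by fun_prop) (by fun_prop))
  refine h.of_eq fun l => ?_
  induction l with
  | nil => rfl
  | cons a l ih => rw [List.foldr_cons, ih, List.sublists'_cons]

/-- A strict upper bound for the members of a list of numbers. -/
def strictBound (l : List ℕ) : ℕ := l.foldr (fun a b => max (a + 1) b) 0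

theorem strictBound_le_iff {l : List ℕ} {n : ℕ} : strictBound l ≤ n ↔ ∀ z ∈ l, z < n := by
  induction l with
  | nil => simp [strictBound]
  | cons a l ih =>
    rw [strictBound, List.foldr_cons, max_le_iff, ← strictBound, ih]
    simp

theorem lt_strictBound {l : List ℕ} {z : ℕ} (hz : z ∈ l) : z < strictBound l :=
  strictBound_le_iff.1 le_rfl z hz

theorem strictBound_lt {l : List ℕ} {n : ℕ} (h : ∀ z ∈ l, z + 1 < n) (hn : 0 < n) :
    strictBound l < n := by
  obtain ⟨m, rfl⟩ := Nat.exists_eq_succ_of_ne_zero hn.ne'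
  exact Nat.lt_succ_of_le (strictBound_le_iff.2 fun z hz => Nat.succ_lt_succ_iff.1 (h z hz))

theorem primrec_strictBound : Primrec strictBound :=
  Primrec.list_foldr (f := id) (h := fun (_ : List ℕ) (x : ℕ × ℕ) => max (x.1 + 1) x.2)
    Primrec.id (Primrec.const 0)
    (Primrec.nat_max.comp (Primrec.succ.comp (by fun_prop)) (by fun_prop))

end Lists

variable {L : Type} [Primcodable L]

theorem primrec_atomData : Primrec (atomData L) :=
  Primrec.option_getD.comp Primrec.decode₂ (Primrec.const _)

theorem primrec_hdCode : Primrec (hdCode L) := Primrec.fst.comp primrec_atomData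

theorem primrec_slotOf : Primrec (slotOf L) :=
  Primrec.option_map (Primrec.snd.comp primrec_atomData)
    (g := fun (_ : ℕ) (b : Slot L × List (List ℕ) × ℕ) => b.1) (by unfold Primrec₂; fun_prop)

theorem primrec_resOf : Primrec (resOf L) :=
  Primrec.option_getD.comp (Primrec.option_map (Primrec.snd.comp primrec_atomData)
    (g := fun (_ : ℕ) (b : Slot L × List (List ℕ) × ℕ) => b.2.2) (by unfold Primrec₂; fun_prop))
    (Primrec.const _)

theorem primrec_argOf : Primrec fun x : ℕ × ℕ => argOf L x.1 x.2 :=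
  Primrec.option_getD.comp (Primrec.option_map
    ((Primrec.snd.comp primrec_atomData).comp Primrec.fst)
    (g := fun (x : ℕ × ℕ) (b : Slot L × List (List ℕ) × ℕ) => b.2.1.getD x.2 [])
    ((Primrec.list_getD []).comp (by fun_prop) (by fun_prop))) (Primrec.const _)

theorem primrec_numArgs : Primrec (numArgs L) :=
  Primrec.option_getD.comp (Primrec.option_map primrec_slotOf
    (g := fun (_ : ℕ) (σ : Slot L) => σ.2) (by unfold Primrec₂; fun_prop))
    (Primrec.const _)

end Codes

/-! ### Recursions on codes of atoms -/

section CodeRelations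

attribute [local fun_prop] Primrec Primrec.id Primrec.const Primrec.comp Primrec.pair Primrec.fst
  Primrec.snd

attribute [local fun_prop] Computable Computable.id Computable.const Computable.comp Computable.pair
  Computable.fst Computable.snd

theorem primrec_filter {α β : Type} [Primcodable α] [Primcodable β] {f : α → List β}
    {p : α → β → Prop} [∀ a, DecidablePred (p a)] (hf : Primrec f)
    (hp : PrimrecPred fun x : α × β => p x.1 x.2) :
    Primrec fun a => (f a).filter fun b => p a b := by
  have : Primrec₂ fun (a : α) (b : β) => if p a b then some b else none :=
    Primrec.ite hp (Primrec.option_some.comp Primrec.snd) (Primrec.const none)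
  refine (Primrec.listFilterMap hf this).of_eq fun a => ?_
  induction f a with
  | nil => rfl
  | cons b l ih => by_cases h : p a b <;> simp [h, ih]

variable {S L : Type} [Primcodable L] {hof : ℕ → Header S L} {T : FilterSpec S L}

theorem computablePred_act
    (hAl : ComputablePred fun q : ℕ × Slot L => q.2.Allowed (hof q.1)) :
    ComputablePred (Act hof) := by
  refine (ComputablePred.exists_mem (p := fun j σ => σ.Allowed (hof (hdCode L j)))
    (hAl.comp (f := fun x : ℕ × Slot L => (hdCode L x.1, x.2)) ?_)
    (Primrec.optionToList.comp primrec_slotOf).to_comp).of_eq fun j => ?_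
  · exact (primrec_hdCode.to_comp.comp Computable.fst).pair .snd
  · simp [Act]

/-- The lists whose consistency decides that of `X`. The recursion terminates since the atoms that
occur in an atom have smaller codes; the restriction to lists with a smaller bound is no loss. -/
def conQueries (L : Type) [Primcodable L] (X : List ℕ) : List (List ℕ) :=
  (X.sublists'.flatMap fun J => J.map (resOf L) ::
    (J.flatMap fun k => List.range (numArgs L k)).map fun i =>
      J.flatMap fun j => argOf L j i).filter fun r => strictBound r < strictBound X

theorem primrec_conQueries : Primrec (conQueries L) := by
  refine primrec_filter (p := fun X r => strictBound r < strictBound X) ?_ ?_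
  · refine primrec_flatMap
      (g := fun (X J : List ℕ) => J.map (resOf L) ::
        (J.flatMap fun k => List.range (numArgs L k)).map fun i => J.flatMap fun j => argOf L j i)
      primrec_sublists' (primrec_cons ?_ ?_)
    · exact primrec_map (by fun_prop) (primrec_resOf.comp Primrec.snd)
    · refine primrec_map (g := fun (x : List ℕ × List ℕ) i => x.2.flatMap fun j => argOf L j i)
        (primrec_flatMap (by fun_prop) ?_) (primrec_flatMap (by fun_prop) ?_)
      · exact Primrec.list_range.comp (primrec_numArgs.comp Primrec.snd)
      · exact primrec_argOf.comp (f := argOf L |>.uncurry)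
          (g := fun (x : ((List ℕ × List ℕ) × ℕ) × ℕ) => (x.2, x.1.2)) (by fun_prop)
  · exact Primrec.nat_lt.comp (primrec_strictBound.comp Primrec.snd)
      (primrec_strictBound.comp Primrec.fst)

/-- The unfolding depends on the consistency of the queried lists only. -/
theorem ConStep.congr {P P' : List ℕ → Prop} {X : List ℕ}
    (h : ∀ r ∈ conQueries L X, (P r ↔ P' r)) : ConStep hof P X ↔ ConStep hof P' X := by
  refine and_congr_right fun _ => forall₂_congr fun J hJ => forall₃_congr fun hact _ k => ?_
  refine forall_congr' fun hk => ?_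
  have hlt : ∀ j ∈ J, j < strictBound X := fun j hj =>
    lt_strictBound ((List.mem_sublists'.1 hJ).subset hj)
  have h0 : 0 < strictBound X := (Nat.zero_le k).trans_lt (hlt k hk)
  have hmem : ∀ r, (∀ z ∈ r, ∃ j ∈ J, z < j) →
      (r = J.map (resOf L) ∨ ∃ i ∈ List.range (numArgs L k),
        r = J.flatMap fun j => argOf L j i) → r ∈ conQueries L X := by
    intro r hr hr'
    simp only [conQueries, List.mem_filter, List.mem_flatMap, List.mem_cons, List.mem_map,
      decide_eq_true_eq]
    refine ⟨⟨J, hJ, hr'.imp id ?_⟩, strictBound_lt (fun z hz => ?_) h0⟩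
    · rintro ⟨i, hi, rfl⟩
      exact ⟨i, ⟨k, hk, hi⟩, rfl⟩
    · obtain ⟨j, hj, hzj⟩ := hr z hz
      exact (Nat.succ_le_of_lt hzj).trans_lt (hlt j hj)
  refine imp_congr (forall₂_congr fun i hi => h _ (hmem _ ?_ (.inr ⟨i, hi, rfl⟩)))
    (h _ (hmem _ ?_ (.inl rfl)))
  · intro z hz
    obtain ⟨j, hj, hz⟩ := List.mem_flatMap.1 hz
    exact ⟨j, hj, argOf_lt hz⟩
  · intro z hz
    obtain ⟨j, hj, rfl⟩ := List.mem_map.1 hz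
    obtain ⟨σ, hσ, _⟩ := hact j hj
    exact ⟨j, hj, resOf_lt hσ⟩

/-- Consistency of finite lists of atoms is decidable. -/
theorem computablePred_con
    (hEq : ComputablePred fun q : ℕ × ℕ => hof q.1 = hof q.2)
    (hAl : ComputablePred fun q : ℕ × Slot L => q.2.Allowed (hof q.1)) :
    ComputablePred (Con hof) := by
  have hAct := computablePred_act hAl
  refine computablePred_of_recursion (primrec_conQueries (L := L)).to_comp (μ := strictBound)
    (fun X r hr => by simpa using (List.mem_filter.1 hr).2)
    (Ψ := fun X T => ConStep hof (· ∈ T) X) (.and ?_ ?_)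
    fun X T hT => (ConStep.congr hT).trans con_iff_conStep.symm
  · refine ComputablePred.forall_mem
      (p := fun (x : List ℕ × List (List ℕ)) i => ∀ j ∈ x.1, hof (hdCode L i) = hof (hdCode L j))
      ?_ .fst
    refine ComputablePred.forall_mem
      (p := fun (x : (List ℕ × List (List ℕ)) × ℕ) j => hof (hdCode L x.2) = hof (hdCode L j))
      (hEq.comp (f := fun x : ((List ℕ × List (List ℕ)) × ℕ) × ℕ =>
        (hdCode L x.1.2, hdCode L x.2)) ?_) (Computable.fst.comp .fst)
    exact (primrec_hdCode.to_comp.comp (Computable.snd.comp .fst)).pair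
      (primrec_hdCode.to_comp.comp .snd)
  refine ComputablePred.forall_mem
    (p := fun (x : List ℕ × List (List ℕ)) J => (∀ j ∈ J, Act hof j) →
      (∀ i ∈ J, ∀ j ∈ J, slotOf L i = slotOf L j) →
      ∀ k ∈ J, (∀ i ∈ List.range (numArgs L k), (J.flatMap fun j => argOf L j i) ∈ x.2) →
        J.map (resOf L) ∈ x.2) (.imp ?_ (.imp ?_ ?_))
    (primrec_sublists'.to_comp.comp .fst)
  · exact ComputablePred.forall_mem (p := fun _ j => Act hof j) (hAct.comp .snd) .snd
  · refine ComputablePred.forall_mem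
      (p := fun (x : (List ℕ × List (List ℕ)) × List ℕ) i => ∀ j ∈ x.2, slotOf L i = slotOf L j)
      ?_ .snd
    refine ComputablePred.forall_mem
      (p := fun (x : ((List ℕ × List (List ℕ)) × List ℕ) × ℕ) j => slotOf L x.2 = slotOf L j)
      (computablePred_eq ?_ ?_) (Computable.snd.comp .fst)
    · exact primrec_slotOf.to_comp.comp (Computable.snd.comp .fst)
    · exact primrec_slotOf.to_comp.comp .snd
  refine ComputablePred.forall_mem
    (p := fun (x : (List ℕ × List (List ℕ)) × List ℕ) k =>
      (∀ i ∈ List.range (numArgs L k), (x.2.flatMap fun j => argOf L j i) ∈ x.1.2) →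
        x.2.map (resOf L) ∈ x.1.2) (.imp ?_ ?_) .snd
  · refine ComputablePred.forall_mem
      (p := fun (x : ((List ℕ × List (List ℕ)) × List ℕ) × ℕ) i =>
        (x.1.2.flatMap fun j => argOf L j i) ∈ x.1.1.2) (computablePred_mem ?_ ?_) ?_
    · refine (primrec_flatMap (by fun_prop) ?_).to_comp
      exact primrec_argOf.comp
        (g := fun (x : ((((List ℕ × List (List ℕ)) × List ℕ) × ℕ) × ℕ) × ℕ) => (x.2, x.1.2))
        (by fun_prop)
    · fun_prop
    · exact (Primrec.list_range.comp (primrec_numArgs.comp Primrec.snd)).to_comp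
  · refine computablePred_mem ?_ (by fun_prop)
    exact (primrec_map (by fun_prop) (primrec_resOf.comp Primrec.snd)).to_comp

/-- The questions that decide whether an atom is below a filtered supremum of atoms. Arguments and
suprema change places in the first kind of questions, so that the bound has to be symmetric. -/
def belowQueries (L : Type) [Primcodable L] (q : List ℕ × ℕ) : List (List ℕ × ℕ) :=
  ((q.1.flatMap fun j => (List.range (numArgs L q.2)).flatMap fun i =>
      (argOf L j i).map fun z => (argOf L q.2 i, z)) ++
    q.1.sublists'.map fun J => (J.map (resOf L), resOf L q.2)).filter
    fun r => max (strictBound r.1) (r.2 + 1) < max (strictBound q.1) (q.2 + 1)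

theorem primrec_belowQueries : Primrec (belowQueries L) := by
  refine primrec_filter (p := fun (q r : List ℕ × ℕ) =>
    max (strictBound r.1) (r.2 + 1) < max (strictBound q.1) (q.2 + 1))
    (primrec_append ?_ ?_) ?_
  · refine primrec_flatMap (g := fun (q : List ℕ × ℕ) j =>
      (List.range (numArgs L q.2)).flatMap fun i => (argOf L j i).map fun z => (argOf L q.2 i, z))
      (by fun_prop) ?_
    refine primrec_flatMap (g := fun (x : (List ℕ × ℕ) × ℕ) i =>
      (argOf L x.2 i).map fun z => (argOf L x.1.2 i, z)) ?_ ?_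
    · exact Primrec.list_range.comp (primrec_numArgs.comp (by fun_prop))
    · refine primrec_map (g := fun (x : ((List ℕ × ℕ) × ℕ) × ℕ) z => (argOf L x.1.1.2 x.2, z))
        ?_ (Primrec.pair ?_ (by fun_prop))
      · exact primrec_argOf.comp
          (g := fun x : ((List ℕ × ℕ) × ℕ) × ℕ => (x.1.2, x.2)) (by fun_prop)
      · exact primrec_argOf.comp
          (g := fun x : (((List ℕ × ℕ) × ℕ) × ℕ) × ℕ => (x.1.1.1.2, x.1.2)) (by fun_prop)
  · refine primrec_map (g := fun (q : List ℕ × ℕ) J => (J.map (resOf L), resOf L q.2))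
      (primrec_sublists'.comp Primrec.fst) (Primrec.pair ?_ ?_)
    · exact primrec_map (by fun_prop) (primrec_resOf.comp Primrec.snd)
    · exact primrec_resOf.comp (by fun_prop)
  · have h : Primrec fun q : List ℕ × ℕ => max (strictBound q.1) (q.2 + 1) :=
      Primrec.nat_max.comp (primrec_strictBound.comp Primrec.fst) (Primrec.succ.comp Primrec.snd)
    exact Primrec.nat_lt.comp (h.comp Primrec.snd) (h.comp Primrec.fst)

theorem belowQueries_lt (q r : List ℕ × ℕ) (hr : r ∈ belowQueries L q) :
    max (strictBound r.1) (r.2 + 1) < max (strictBound q.1) (q.2 + 1) := by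
  simpa only [decide_eq_true_eq] using (List.mem_filter.1 hr).2

/-- The unfolding is monotone in the relation, and depends on its values at the queries only. -/
theorem BelowStep.mono {P P' : List ℕ × ℕ → Prop} {q : List ℕ × ℕ}
    (h : ∀ r ∈ belowQueries L q, P r → P' r) (hq : BelowStep T hof P q) :
    BelowStep T hof P' q := by
  obtain ⟨X, y⟩ := q
  obtain ⟨h0, hq⟩ := hq
  refine ⟨h0, hq.imp_right (Or.imp_right ?_)⟩
  rintro ⟨⟨hact, hok⟩, hres, J, hJX, hJ, hJr⟩
  obtain ⟨σ, hσ, _⟩ := id hact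
  have hlt : ∀ j ∈ J, j < strictBound X := fun j hj =>
    lt_strictBound ((List.mem_sublists'.1 hJX).subset hj)
  refine ⟨⟨hact, hok⟩, hres, J, hJX, fun j hj => ⟨(hJ j hj).1, fun i hi z hz => ?_⟩, ?_⟩
  · refine ((hJ j hj).2 i hi z hz).imp_left (h _ (List.mem_filter.2 ⟨?_, ?_⟩))
    · exact List.mem_append_left _ (List.mem_flatMap.2 ⟨j, (List.mem_sublists'.1 hJX).subset hj,
        List.mem_flatMap.2 ⟨i, hi, List.mem_map.2 ⟨z, hz, rfl⟩⟩⟩)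
    · have h1 : strictBound (argOf L y i) ≤ y := strictBound_le_iff.2 fun z hz => argOf_lt hz
      have h2 := argOf_lt hz
      have h3 := hlt j hj
      simp only [decide_eq_true_eq]
      omega
  · refine h _ (List.mem_filter.2 ⟨?_, ?_⟩) hJr
    · exact List.mem_append_right _ (List.mem_map.2 ⟨J, hJX, rfl⟩)
    · have h1 := resOf_lt hσ
      have h2 : strictBound (J.map (resOf L)) < max (strictBound X) (y + 1) := by
        refine strictBound_lt (fun z hz => ?_) (by omega)
        obtain ⟨j, hj, rfl⟩ := List.mem_map.1 hz
        have h3 := hlt j hj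
        have h4 := resOf_lt ((hJ j hj).1.trans hσ)
        omega
      simp only [decide_eq_true_eq]
      dsimp only at h1 ⊢
      omega

end CodeRelations

end NOOP

namespace NOOP

open PreObj Set

/-! ### The effective presentation -/

/-- A class of predicates with the closure properties that the recursive and the recursively
enumerable predicates share. -/
structure IsQuantifierClosed (C : ∀ (α : Type) [Primcodable α], (α → Prop) → Prop) : Prop where
  of_computable : ∀ {α : Type} [Primcodable α] {p : α → Prop}, ComputablePred p → C α p
  comp : ∀ {α β : Type} [Primcodable α] [Primcodable β] {p : β → Prop}, C β p →
    ∀ {f : α → β}, Computable f → C α fun a => p (f a)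
  and : ∀ {α : Type} [Primcodable α] {p q : α → Prop}, C α p → C α q → C α fun a => p a ∧ q a
  or : ∀ {α : Type} [Primcodable α] {p q : α → Prop}, C α p → C α q → C α fun a => p a ∨ q a
  exists_mem : ∀ {α β : Type} [Primcodable α] [Primcodable β] {p : α → β → Prop},
    C (α × β) (fun x => p x.1 x.2) → ∀ {l : α → List β}, Computable l →
      C α fun a => ∃ b ∈ l a, p a b
  forall_mem : ∀ {α β : Type} [Primcodable α] [Primcodable β] {p : α → β → Prop},
    C (α × β) (fun x => p x.1 x.2) → ∀ {l : α → List β}, Computable l →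
      C α fun a => ∀ b ∈ l a, p a b

theorem isQuantifierClosed_computablePred :
    IsQuantifierClosed fun α [Primcodable α] (p : α → Prop) => ComputablePred p :=
  ⟨id, ComputablePred.comp, .and, .or, .exists_mem, .forall_mem⟩

theorem isQuantifierClosed_rePred :
    IsQuantifierClosed fun α [Primcodable α] (p : α → Prop) => REPred p :=
  ⟨ComputablePred.to_re, REPred.comp, .and, .or, .exists_mem, .forall_mem⟩

section Below

attribute [local fun_prop] Primrec Primrec.id Primrec.const Primrec.comp Primrec.pair Primrec.fst
  Primrec.snd

attribute [local fun_prop] Computable Computable.id Computable.const Computable.comp Computable.pair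
  Computable.fst Computable.snd

variable {S L : Type} [Primcodable L] {hof : ℕ → Header S L} {T : FilterSpec S L}

local notation "O" => PreObj S L

/-- One unfolding of the characterization stays within a class of predicates that contains its
ingredients. The instances are the recursive and the recursively enumerable predicates. -/
theorem IsQuantifierClosed.belowStep
    {C : ∀ (α : Type) [Primcodable α], (α → Prop) → Prop} (hC : IsQuantifierClosed C)
    (hEq : ComputablePred fun q : ℕ × ℕ => hof q.1 = hof q.2)
    (hAl : ComputablePred fun q : ℕ × Slot L => q.2.Allowed (hof q.1))
    (hgood : C ℕ fun y => T.good (hof (hdCode L y))) (hok : C ℕ (OkAt T hof))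
    (hacc : C (ℕ × ℕ × ℕ) fun q => AccAt T hof q.1 q.2.1 q.2.2)
    (hres : C (ℕ × ℕ) fun q => ResAt T hof q.1 q.2) :
    C ((List ℕ × ℕ) × List (List ℕ × ℕ)) fun x => BelowStep T hof (· ∈ x.2) x.1 := by
  have hCon := computablePred_con hEq hAl
  have hAct := computablePred_act hAl
  have hrange : Computable fun x : (List ℕ × ℕ) × List (List ℕ × ℕ) =>
      List.range (numArgs L x.1.2) :=
    (Primrec.list_range.comp (primrec_numArgs.comp (by fun_prop))).to_comp
  refine hC.and (hC.and (hC.of_computable ?_) (hC.and ?_ (hC.of_computable ?_)))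
    (hC.or (hC.of_computable ?_) (hC.or (hC.of_computable ?_)
      (hC.and (hC.and (hC.of_computable ?_) ?_) (hC.and ?_ ?_))))
  · exact hCon.comp (by fun_prop)
  · exact hC.comp hgood (f := fun x : (List ℕ × ℕ) × List (List ℕ × ℕ) => x.1.2) (by fun_prop)
  · refine ComputablePred.exists_mem (p := fun (x : (List ℕ × ℕ) × List (List ℕ × ℕ)) k =>
      hof (hdCode L k) = hof (hdCode L x.1.2))
      (hEq.comp (f := fun x : ((List ℕ × ℕ) × List (List ℕ × ℕ)) × ℕ =>
        (hdCode L x.2, hdCode L x.1.1.2)) ?_) (by fun_prop)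
    exact (primrec_hdCode.to_comp.comp (by fun_prop)).pair
      (primrec_hdCode.to_comp.comp (by fun_prop))
  · exact (hAct.comp (by fun_prop)).not
  · refine ComputablePred.exists_mem (p := fun (x : (List ℕ × ℕ) × List (List ℕ × ℕ)) i =>
      ¬ Con hof (argOf L x.1.2 i)) (ComputablePred.not (hCon.comp ?_)) hrange
    exact (primrec_argOf.comp (g := fun x : ((List ℕ × ℕ) × List (List ℕ × ℕ)) × ℕ =>
      (x.1.1.2, x.2)) (by fun_prop)).to_comp
  · exact hAct.comp (by fun_prop)
  · exact hC.comp hok (f := fun x : (List ℕ × ℕ) × List (List ℕ × ℕ) => x.1.2) (by fun_prop)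
  · exact hC.comp hres (f := fun x : (List ℕ × ℕ) × List (List ℕ × ℕ) => (x.1.2, resOf L x.1.2))
      (Computable.pair (Computable.snd.comp .fst) (primrec_resOf.to_comp.comp
        (g := fun x : (List ℕ × ℕ) × List (List ℕ × ℕ) => x.1.2) (by fun_prop)))
  refine hC.exists_mem (p := fun (x : (List ℕ × ℕ) × List (List ℕ × ℕ)) J =>
    (∀ j ∈ J, slotOf L j = slotOf L x.1.2 ∧ ∀ i ∈ List.range (numArgs L x.1.2),
      ∀ z ∈ argOf L j i, (argOf L x.1.2 i, z) ∈ x.2 ∧ AccAt T hof x.1.2 i z) ∧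
      (J.map (resOf L), resOf L x.1.2) ∈ x.2) (hC.and ?_ (hC.of_computable ?_))
    (primrec_sublists'.to_comp.comp
      (g := fun x : (List ℕ × ℕ) × List (List ℕ × ℕ) => x.1.1) (by fun_prop))
  swap
  · refine computablePred_mem (Computable.pair ?_ ?_) (by fun_prop)
    · exact (primrec_map (by fun_prop) (primrec_resOf.comp Primrec.snd)).to_comp
    · exact primrec_resOf.to_comp.comp (by fun_prop)
  refine hC.forall_mem
    (p := fun (x : ((List ℕ × ℕ) × List (List ℕ × ℕ)) × List ℕ) j =>
      slotOf L j = slotOf L x.1.1.2 ∧ ∀ i ∈ List.range (numArgs L x.1.1.2),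
      ∀ z ∈ argOf L j i, (argOf L x.1.1.2 i, z) ∈ x.1.2 ∧ AccAt T hof x.1.1.2 i z)
    (hC.and (hC.of_computable (computablePred_eq ?_ ?_)) ?_) (by fun_prop)
  · exact primrec_slotOf.to_comp.comp (by fun_prop)
  · exact primrec_slotOf.to_comp.comp (by fun_prop)
  refine hC.forall_mem
    (p := fun (x : (((List ℕ × ℕ) × List (List ℕ × ℕ)) × List ℕ) × ℕ) i =>
      ∀ z ∈ argOf L x.2 i, (argOf L x.1.1.1.2 i, z) ∈ x.1.1.2 ∧ AccAt T hof x.1.1.1.2 i z)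
    ?_ (hrange.comp (f := fun x : ((List ℕ × ℕ) × List (List ℕ × ℕ)) =>
      List.range (numArgs L x.1.2)) (by fun_prop))
  refine hC.forall_mem
    (p := fun (x : ((((List ℕ × ℕ) × List (List ℕ × ℕ)) × List ℕ) × ℕ) × ℕ) z =>
      (argOf L x.1.1.1.1.2 x.2, z) ∈ x.1.1.1.2 ∧ AccAt T hof x.1.1.1.1.2 x.2 z)
    (hC.and (hC.of_computable (computablePred_mem (Computable.pair ?_ (by fun_prop))
      (by fun_prop))) ?_) ?_
  · exact (primrec_argOf.comp
      (g := fun x : (((((List ℕ × ℕ) × List (List ℕ × ℕ)) × List ℕ) × ℕ) × ℕ) × ℕ =>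
        (x.1.1.1.1.1.2, x.1.2)) (by fun_prop)).to_comp
  · exact hC.comp hacc
      (f := fun x : (((((List ℕ × ℕ) × List (List ℕ × ℕ)) × List ℕ) × ℕ) × ℕ) × ℕ =>
        (x.1.1.1.1.1.2, x.1.2, x.2)) (by fun_prop)
  · exact (primrec_argOf.comp
      (g := fun x : ((((List ℕ × ℕ) × List (List ℕ × ℕ)) × List ℕ) × ℕ) × ℕ =>
        (x.1.2, x.2)) (by fun_prop)).to_comp

/-- It is recursively enumerable which atoms are below the filtered suprema of atoms. -/
theorem rePred_below {φ : O → O} (hU : Unfolds T φ φ) (hle : ∀ x, φ x ≤ x) (hmono : Monotone φ)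
    (hEq : ComputablePred fun q : ℕ × ℕ => hof q.1 = hof q.2)
    (hAl : ComputablePred fun q : ℕ × Slot L => q.2.Allowed (hof q.1))
    (hgood : REPred fun y => T.good (hof (hdCode L y))) (hok : REPred (OkAt T hof))
    (hacc : REPred fun q : ℕ × ℕ × ℕ => AccAt T hof q.1 q.2.1 q.2.2)
    (hres : REPred fun q : ℕ × ℕ => ResAt T hof q.1 q.2) :
    REPred fun q : List ℕ × ℕ => Con hof q.1 ∧ den hof q.2 ≤ φ (join hof q.1) :=
  rePred_of_recursion (belowQueries_lt (L := L)) (Ψ := fun q T' => BelowStep T hof (· ∈ T') q)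
    (isQuantifierClosed_rePred.belowStep hEq hAl hgood hok hacc hres)
    (fun q _ hT hΨ => (below_iff_belowStep hU hle hmono q).2 (BelowStep.mono hT hΨ))
    fun q _ hT hP => BelowStep.mono hT ((below_iff_belowStep hU hle hmono q).1 hP)

/-- It is decidable which atoms are below the suprema of atoms. -/
theorem computablePred_below
    (hEq : ComputablePred fun q : ℕ × ℕ => hof q.1 = hof q.2)
    (hAl : ComputablePred fun q : ℕ × Slot L => q.2.Allowed (hof q.1)) :
    ComputablePred fun q : List ℕ × ℕ => Con hof q.1 ∧ den hof q.2 ≤ join hof q.1 := by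
  have hslot : ComputablePred fun y => ∃ σ, slotOf L y = some σ := by
    refine (ComputablePred.exists_mem (p := fun (_ : ℕ) (_ : Slot L) => True)
      (computablePred_const True)
      (Primrec.optionToList.comp primrec_slotOf).to_comp).of_eq fun j => ?_
    simp
  have hstep := isQuantifierClosed_computablePred.belowStep (T := trivialSpec S L) hEq hAl
    (computablePred_const True) (computablePred_act hAl)
    ((hslot.comp Computable.fst).of_eq fun q => by simp [AccAt, trivialSpec])
    ((hslot.comp Computable.fst).of_eq fun q => by simp [ResAt, trivialSpec])
  have hiff := below_iff_belowStep (hof := hof) (unfolds_id (S := S) (L := L))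
    (fun _ => le_rfl) monotone_id
  exact computablePred_of_recursion (primrec_belowQueries (L := L)).to_comp
    (belowQueries_lt (L := L))
    (Ψ := fun q T' => BelowStep (trivialSpec S L) hof (· ∈ T') q) hstep fun q T hT =>
      ⟨fun h => (hiff q).2 (BelowStep.mono (fun r hr => (hT r hr).1) h),
        fun h => BelowStep.mono (fun r hr => (hT r hr).2) ((hiff q).1 h)⟩

open scoped Classical in
/-- The list of atoms with the given code, or the empty list if that list is inconsistent. -/
noncomputable def conList (hof : ℕ → Header S L) (n : ℕ) : List ℕ :=
  bif decide (Con hof ((Encodable.decode n).getD [])) then (Encodable.decode n).getD [] else []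

theorem con_conList (n : ℕ) : Con hof (conList hof n) := by
  rw [conList]
  generalize (Encodable.decode (α := List ℕ) n).getD [] = X
  by_cases h : Con hof X
  · simp [h]
  · simpa [h] using con_nil

theorem exists_conList_eq {X : List ℕ} (hX : Con hof X) : ∃ n, conList hof n = X :=
  ⟨Encodable.encode X, by simp [conList, hX]⟩

open scoped Classical in
theorem computable_conList
    (hEq : ComputablePred fun q : ℕ × ℕ => hof q.1 = hof q.2)
    (hAl : ComputablePred fun q : ℕ × Slot L => q.2.Allowed (hof q.1)) :
    Computable (conList hof) := by
  have h : Computable fun n : ℕ => (Encodable.decode (α := List ℕ) n).getD [] :=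
    Computable.option_getD Computable.decode (.const [])
  exact Computable.cond ((computablePred_con hEq hAl).comp h).decide h (.const [])

theorem bddAbove_join_pair_iff {X Y : List ℕ} (hX : Con hof X) (hY : Con hof Y) :
    BddAbove {join hof X, join hof Y} ↔ Con hof (X ++ Y) := by
  rw [con_iff]
  simp only [BddAbove, Set.Nonempty, mem_upperBounds, mem_insert_iff, mem_singleton_iff,
    forall_eq, join_le_iff hX, join_le_iff hY, List.mem_append, or_imp,
    forall_and]

theorem isLUB_join_pair {X Y : List ℕ} (hXY : Con hof (X ++ Y)) :
    IsLUB {join hof X, join hof Y} (join hof (X ++ Y)) := by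
  have hX : Con hof X := hXY.mono (List.subset_append_left _ _)
  have hY : Con hof Y := hXY.mono (List.subset_append_right _ _)
  constructor
  · rintro _ (rfl | rfl)
    · exact (join_le_iff hX).2 fun z hz => den_le_join hXY (List.mem_append_left _ hz)
    · exact (join_le_iff hY).2 fun z hz => den_le_join hXY (List.mem_append_right _ hz)
  · intro u hu
    refine (join_le_iff hXY).2 fun z hz => ?_
    rcases List.mem_append.1 hz with hz | hz
    · exact (den_le_join hX hz).trans (hu (.inl rfl))
    · exact (den_le_join hY hz).trans (hu (.inr rfl))

theorem isLUB_join_pair_iff {X Y Z : List ℕ} (hX : Con hof X) (hY : Con hof Y) (hZ : Con hof Z) :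
    IsLUB {join hof X, join hof Y} (join hof Z) ↔
      (∀ z ∈ Z, Con hof (X ++ Y) ∧ den hof z ≤ join hof (X ++ Y)) ∧ Con hof (X ++ Y) ∧
        ∀ z ∈ X ++ Y, Con hof Z ∧ den hof z ≤ join hof Z := by
  constructor
  · intro h
    have hXY := (bddAbove_join_pair_iff hX hY).1 ⟨_, h.1⟩
    have e := h.unique (isLUB_join_pair hXY)
    refine ⟨fun z hz => ⟨hXY, ?_⟩, hXY, fun z hz => ⟨hZ, ?_⟩⟩
    · rw [← e]
      exact den_le_join hZ hz
    · rw [e]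
      exact den_le_join hXY hz
  · rintro ⟨h1, hXY, h2⟩
    have e : join hof Z = join hof (X ++ Y) :=
      le_antisymm ((join_le_iff hZ).2 fun z hz => (h1 z hz).2)
      ((join_le_iff hXY).2 fun z hz => (h2 z hz).2)
    rw [e]
    exact isLUB_join_pair hXY

/-- The suprema of the consistent lists of atoms form an effective presentation. -/
theorem isEffectivePresentation_join (hsurj : Function.Surjective hof)
    (hEq : ComputablePred fun q : ℕ × ℕ => hof q.1 = hof q.2)
    (hAl : ComputablePred fun q : ℕ × Slot L => q.2.Allowed (hof q.1)) :
    IsEffectivePresentation fun n => (join hof (conList hof n) : O) where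
  range_eq := by
    ext c
    constructor
    · rintro ⟨n, rfl⟩
      exact isCompactElement_join _
    · intro hc
      obtain ⟨X, hX, rfl⟩ := exists_eq_join hsurj hc
      obtain ⟨n, hn⟩ := exists_conList_eq hX
      exact ⟨n, congrArg (join hof) hn⟩
  consistent := by
    have h := computable_conList hEq hAl
    refine ((computablePred_con hEq hAl).comp (f := fun q : ℕ × ℕ =>
      conList hof q.1 ++ conList hof q.2) ?_).of_eq fun q =>
        (bddAbove_join_pair_iff (con_conList _) (con_conList _)).symm
    exact Computable.list_append.comp (h.comp .fst) (h.comp .snd)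
  isLUB := by
    have h := computable_conList hEq hAl
    have hB := computablePred_below hEq hAl
    have hXY : Computable fun q : ℕ × ℕ × ℕ => conList hof q.1 ++ conList hof q.2.1 :=
      Computable.list_append.comp (h.comp .fst) (h.comp (by fun_prop))
    have hZ : Computable fun q : ℕ × ℕ × ℕ => conList hof q.2.2 := h.comp (by fun_prop)
    refine ((ComputablePred.forall_mem (p := fun (q : ℕ × ℕ × ℕ) z =>
      Con hof (conList hof q.1 ++ conList hof q.2.1) ∧
        den hof z ≤ join hof (conList hof q.1 ++ conList hof q.2.1))
        (hB.comp (f := fun x : (ℕ × ℕ × ℕ) × ℕ =>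
          (conList hof x.1.1 ++ conList hof x.1.2.1, x.2)) ?_) hZ).and
      (((computablePred_con hEq hAl).comp hXY).and
        (ComputablePred.forall_mem (p := fun (q : ℕ × ℕ × ℕ) z =>
          Con hof (conList hof q.2.2) ∧ den hof z ≤ join hof (conList hof q.2.2))
          (hB.comp (f := fun x : (ℕ × ℕ × ℕ) × ℕ => (conList hof x.1.2.2, x.2)) ?_)
          hXY))).of_eq fun q => (isLUB_join_pair_iff (con_conList _) (con_conList _)
            (con_conList _)).symm
    · exact (hXY.comp .fst).pair .snd
    · exact (hZ.comp .fst).pair .snd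

theorem isComputableMap_of_below {φ : O → O}
    (hEq : ComputablePred fun q : ℕ × ℕ => hof q.1 = hof q.2)
    (hAl : ComputablePred fun q : ℕ × Slot L => q.2.Allowed (hof q.1))
    (h : REPred fun q : List ℕ × ℕ => Con hof q.1 ∧ den hof q.2 ≤ φ (join hof q.1)) :
    IsComputableMap (fun n => (join hof (conList hof n) : O)) φ := by
  have hl := computable_conList hEq hAl
  refine (REPred.forall_mem (p := fun (q : ℕ × ℕ) z => Con hof (conList hof q.1) ∧
    den hof z ≤ φ (join hof (conList hof q.1)))
    (h.comp (f := fun x : (ℕ × ℕ) × ℕ => (conList hof x.1.1, x.2)) ?_)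
    (hl.comp .snd)).of_eq fun q => ?_
  · exact (hl.comp (by fun_prop)).pair .snd
  · rw [join_le_iff (con_conList _)]
    exact forall₂_congr fun z _ => and_iff_right (con_conList _)

end Below

/-- The image of a computable finitary projection is a computable subdomain: its finite elements
are the finite fixed points, and these can be enumerated. -/
theorem IsFinitaryProjection.isComputableSubdomain {D : Type} [PartialOrder D]
    (hD : IsScottDomain D) {p : D → D} (hp : IsFinitaryProjection p) {e : ℕ → D}
    (he : IsEffectivePresentation e) (hep : IsComputableMap e p) :
    IsComputableSubdomain e (range p) := by
  have mono := hp.continuous.monotone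
  have hbot : ∃ n, e n ≤ p (e n) := by
    obtain ⟨b, hb⟩ := hD.exists_isBot
    have hbc : b ∈ range e := by
      rw [he.range_eq]
      exact fun s u hne _ _ _ => ⟨_, hne.some_mem, hb _⟩
    obtain ⟨n, rfl⟩ := hbc
    exact ⟨n, hb _⟩
  obtain ⟨r, hr, hrange⟩ := exists_computable_range_eq
    (REPred.comp hep (f := fun n : ℕ => (n, n)) (Computable.id.pair .id)) hbot
  have hmem : ∀ n, e (r n) ∈ range p := fun n => (mem_range_iff_of_idem hp.idem).2
    ((hp.le_self _).antisymm ((hrange (r n)).2 ⟨n, rfl⟩))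
  have himg : ∀ i j, Subtype.val '' {(⟨e (r i), hmem i⟩ : range p), ⟨e (r j), hmem j⟩} =
      {e (r i), e (r j)} := fun i j => by rw [image_pair]
  refine ⟨hp.isSubdomain hD, r, hr, hmem, ?_, ?_, ?_⟩
  · ext c
    constructor
    · rintro ⟨n, rfl⟩
      refine (hp.isCompactElement_range_iff hD).2 ?_
      have : e (r n) ∈ {c | IsCompactElement c} := by
        rw [← he.range_eq]
        exact ⟨_, rfl⟩
      exact this
    · intro hc
      have hc' : (c : D) ∈ range e := by
        rw [he.range_eq]
        exact (hp.isCompactElement_range_iff hD).1 hc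
      obtain ⟨m, hm⟩ := hc'
      obtain ⟨n, hn⟩ := (hrange m).1 (by
        rw [hm, (mem_range_iff_of_idem hp.idem).1 c.2])
      exact ⟨n, Subtype.ext (by rw [← hm, ← hn])⟩
  · refine (he.consistent.comp (f := fun q : ℕ × ℕ => (r q.1, r q.2))
      ((hr.comp .fst).pair (hr.comp .snd))).of_eq fun q => ?_
    rw [bddAbove_range_iff mono hp.idem, himg]
  · refine (he.isLUB.comp (f := fun q : ℕ × ℕ × ℕ => (r q.1, r q.2.1, r q.2.2))
      ((hr.comp .fst).pair ((hr.comp (Computable.fst.comp .snd)).pair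
        (hr.comp (Computable.snd.comp .snd))))).of_eq fun q => ?_
    rw [isLUB_range_iff mono hp.idem hp.le_self, himg]

end NOOP

namespace NOOP

open Set Relation PreObj

/-! ### Raw objects with signature closures -/

section Objects

variable {N L : Type}

local notation "O" => Obj N L

theorem SigClosure.root_spec (sc : SigClosure N L) : sc.root ∈ sc.env ∧ sc.root.name = sc.name :=
  sc.isSigClosure.root.choose_spec

theorem SigClosure.isClassSig_root (sc : SigClosure N L) : sc.root.IsClassSig :=
  sc.isSigClosure.isSigEnv.isClassSig _ sc.root_spec.1

/-- What filtering needs to know of signature closures. Field slots have no arguments; the slots of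
a declared method are restricted to the sequences of the declared length, where the receiver is
counted. -/
def sigSpec (N L : Type) : FilterSpec (SigClosure N L) L where
  good h := (h.2.1 : Set L) = h.1.fieldShape ∧ (h.2.2 : Set L) = h.1.methodShape
  ok h
    | (Sum.inl a, n) => n = 0 ∧ ∃ f ∈ h.1.root.fields, f.1 = a
    | (Sum.inr b, n) => ∃ m ∈ h.1.root.methods, m.1 = b ∧ n = m.2.1.length + 1
  allowed_of_ok {h σ} hg hσ := by
    obtain ⟨a | b, n⟩ := σ
    · have : a ∈ (h.2.1 : Set L) := hg.1.symm ▸ hσ.2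
      exact ⟨this, hσ.1⟩
    · obtain ⟨m, hm, hmb, _⟩ := hσ
      have : b ∈ (h.2.2 : Set L) := hg.2.symm ▸ ⟨m, hm, hmb⟩
      exact this
  acc h
    | (Sum.inl _, _), _ => univ
    | (Sum.inr b, _), i => {sc | ∃ m ∈ h.1.root.methods, m.1 = b ∧
        ∃ ss, (argSigs h.1 m)[i]? = some ss ∧ sc.Subsign ss}
  res h
    | (Sum.inl a, _) => {sc | ∃ f ∈ h.1.root.fields, f.1 = a ∧ sc.Subsign (h.1.closAt f.2)}
    | (Sum.inr b, _) => {sc | ∃ m ∈ h.1.root.methods, m.1 = b ∧ sc.Subsign (h.1.closAt m.2.2)}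

theorem foldIso_symm_mkObj (sc : SigClosure N L) (fr : ProperRec L O) (mr : ProperRec L (Meth O)) :
    (foldIso : RHS _ L O ≃o O).symm (mkObj sc fr mr) = WithBot.some ⟨sc, fr, mr⟩ :=
  (foldIso : RHS _ L O ≃o O).symm_apply_apply _

theorem hd_mkObj (sc : SigClosure N L) (fr : ProperRec L O) (mr : ProperRec L (Meth O)) :
    hd (mkObj sc fr mr) = some (sc, fr.1, mr.1) := by
  rw [hd, foldIso_symm_mkObj]
  rfl

theorem ap_mkObj_field (sc : SigClosure N L) (fr : ProperRec L O) (mr : ProperRec L (Meth O))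
    {a : L} (h : a ∈ fr.1) (v : Fin 0 → O) :
    ap (mkObj sc fr mr) (Sum.inl a, 0) v = fr.2 ⟨a, h⟩ := by
  rw [ap, foldIso_symm_mkObj]
  exact dif_pos ⟨h, rfl⟩

theorem ap_mkObj_method (sc : SigClosure N L) (fr : ProperRec L O) (mr : ProperRec L (Meth O))
    {b : L} (h : b ∈ mr.1) (n : ℕ) (v : Fin n → O) :
    ap (mkObj sc fr mr) (Sum.inr b, n) v = mr.2 ⟨b, h⟩ (WithBot.some ⟨n, v⟩) := by
  rw [ap, foldIso_symm_mkObj]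
  exact dif_pos h

theorem exists_eq_mkObj {o : O} {h : Header (SigClosure N L) L} (ho : hd o = some h) :
    ∃ fr mr, o = mkObj h.1 ⟨h.2.1, fr⟩ ⟨h.2.2, mr⟩ := by
  obtain ⟨x, rfl⟩ := (foldIso : RHS _ L O ≃o O).surjective o
  rw [hd, OrderIso.symm_apply_apply] at ho
  induction x using WithBot.recBotCoe with
  | bot => simp [RHS.hd] at ho
  | coe x =>
    obtain ⟨s, ⟨A, f⟩, ⟨B, m⟩⟩ := x
    simp only [RHS.hd, Option.some.injEq] at ho
    subst ho
    exact ⟨f, m, rfl⟩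

theorem subsignsTo_iff {o : O} {ss : SigClosure N L} :
    SubsignsTo o ss ↔ ∃ h, hd o = some h ∧ h.1 ∈ {sc : SigClosure N L | sc.Subsign ss} := by
  constructor
  · rintro ⟨sc, fr, mr, rfl, h⟩
    exact ⟨_, hd_mkObj sc fr mr, h⟩
  · rintro ⟨h, ho, hs⟩
    obtain ⟨fr, mr, rfl⟩ := exists_eq_mkObj ho
    exact ⟨_, _, _, rfl, hs⟩

theorem filterObjSig_eq_gate (φ : O → O) (ss : SigClosure N L) (o : O) :
    filterObjSig φ ss o = gate φ {sc | sc.Subsign ss} o := by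
  rw [filterObjSig, gate]
  by_cases h : SubsignsTo o ss
  · rw [if_pos h, if_pos (subsignsTo_iff.1 h)]
  · rw [if_neg h, if_neg fun h' => h (subsignsTo_iff.2 h')]

theorem conformsTo_iff {V : Set O} {ss : SigClosure N L} {o : O} :
    ConformsTo V ss o ↔ Conforms V {sc : SigClosure N L | sc.Subsign ss} o := by
  rw [ConformsTo, Conforms, subsignsTo_iff]

theorem res_field {h : Header (SigClosure N L) L} {f : L × N} (hf : f ∈ h.1.root.fields) (n : ℕ) :
    (sigSpec N L).res h (Sum.inl f.1, n) = {sc | sc.Subsign (h.1.closAt f.2)} := by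
  ext sc
  constructor
  · rintro ⟨g, hg, hgf, hs⟩
    rwa [h.1.isClassSig_root.fields g hg f hf hgf] at hs
  · exact fun hs => ⟨f, hf, rfl, hs⟩

theorem res_method {h : Header (SigClosure N L) L} {b : L × List N × N}
    (hb : b ∈ h.1.root.methods) (n : ℕ) :
    (sigSpec N L).res h (Sum.inr b.1, n) = {sc | sc.Subsign (h.1.closAt b.2.2)} := by
  ext sc
  constructor
  · rintro ⟨m, hm, hmb, hs⟩
    rwa [h.1.isClassSig_root.methods m hm b hb hmb] at hs
  · exact fun hs => ⟨b, hb, rfl, hs⟩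

theorem length_argSigs (sc : SigClosure N L) (b : L × List N × N) :
    (argSigs sc b).length = b.2.1.length + 1 := by simp [argSigs]

theorem acc_method {h : Header (SigClosure N L) L} {b : L × List N × N}
    (hb : b ∈ h.1.root.methods) (n : ℕ) (i : Fin (argSigs h.1 b).length) :
    (sigSpec N L).acc h (Sum.inr b.1, n) i = {sc | sc.Subsign ((argSigs h.1 b).get i)} := by
  ext sc
  constructor
  · rintro ⟨m, hm, hmb, ss, hss, hs⟩
    rw [h.1.isClassSig_root.methods m hm b hb hmb] at hss
    rw [List.getElem?_eq_getElem i.2] at hss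
    obtain rfl := Option.some_injective _ hss
    exact hs
  · exact fun hs => ⟨b, hb, rfl, _, List.getElem?_eq_getElem i.2, hs⟩

theorem ok_method {h : Header (SigClosure N L) L} {b : L × List N × N}
    (hb : b ∈ h.1.root.methods) (n : ℕ) :
    (sigSpec N L).ok h (Sum.inr b.1, n) ↔ n = (argSigs h.1 b).length := by
  rw [length_argSigs]
  constructor
  · rintro ⟨m, hm, hmb, hn⟩
    rwa [h.1.isClassSig_root.methods m hm b hb hmb] at hn
  · exact fun hn => ⟨b, hb, rfl, hn⟩

theorem filterSeq_coe (φ : O → O) (ins : List (SigClosure N L)) (n : ℕ) (v : Fin n → O) :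
    filterSeq φ ins (WithBot.some ⟨n, v⟩) = if h : n = ins.length then
      WithBot.some ⟨n, fun i => filterObjSig φ (ins.get (i.cast h)) (v i)⟩ else ⊥ := rfl

theorem slotVal_field {sc : SigClosure N L} {fr : ProperRec L O} {mr : ProperRec L (Meth O)}
    (φ : O → O) {f : L × N} (hf : f ∈ sc.root.fields) (h : f.1 ∈ fr.1) (v : Fin 0 → O) :
    slotVal (sigSpec N L) φ (sc, fr.1, mr.1) (mkObj sc fr mr) (Sum.inl f.1, 0) v =
      filterObjSig φ (sc.closAt f.2) (fr.2 ⟨f.1, h⟩) := by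
  rw [slotVal, res_field (h := (sc, fr.1, mr.1)) hf, filterObjSig_eq_gate,
    ap_mkObj_field sc fr mr h]

open scoped Classical in
theorem slotVal_method {sc : SigClosure N L} {fr : ProperRec L O} {mr : ProperRec L (Meth O)}
    (φ : O → O) {b : L × List N × N} (hb : b ∈ sc.root.methods) (h : b.1 ∈ mr.1) (n : ℕ)
    (v : Fin n → O) :
    (if (sigSpec N L).ok (sc, fr.1, mr.1) (Sum.inr b.1, n) then
      slotVal (sigSpec N L) φ (sc, fr.1, mr.1) (mkObj sc fr mr) (Sum.inr b.1, n) v else ⊥) =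
      filterObjSig φ (sc.closAt b.2.2)
        (mr.2 ⟨b.1, h⟩ (filterSeq φ (argSigs sc b) (WithBot.some ⟨n, v⟩))) := by
  have hok := ok_method (h := (sc, fr.1, mr.1)) hb n
  by_cases hn : n = (argSigs sc b).length
  · rw [if_pos (hok.2 hn), slotVal, res_method (h := (sc, fr.1, mr.1)) hb, filterObjSig_eq_gate]
    have hv : filterSeq φ (argSigs sc b) (WithBot.some ⟨n, v⟩) = WithBot.some
        ⟨n, fun i : Fin n =>
          gate φ ((sigSpec N L).acc (sc, fr.1, mr.1) (Sum.inr b.1, n) i) (v i)⟩ := by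
      rw [filterSeq_coe, dif_pos hn]
      refine congrArg (fun w : Fin n → O => (WithBot.some ⟨n, w⟩ : Seq O)) (funext fun i => ?_)
      rw [filterObjSig_eq_gate]
      exact congrArg (fun P => gate φ P (v i))
        (acc_method (h := (sc, fr.1, mr.1)) hb n (i.cast hn)).symm
    rw [hv, ap_mkObj_method sc fr mr h n]
  · rw [if_neg fun h => hn (hok.1 h), filterSeq_coe, dif_neg hn, filterObjSig_eq_gate]
    have : mr.2 ⟨b.1, h⟩ ⊥ = ⊥ := (mr.2 ⟨b.1, h⟩).strict
    rw [this, gate_bot]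

/-- The recursive equations of filtering, read slotwise: at a declared slot, arguments and
results are gated by the admitted signature closures, and the other slots are `⊥`. -/
theorem filterEqs_iff_unfolds {φ : O → O} : FilterEqs φ ↔ Unfolds (sigSpec N L) φ φ := by
  constructor
  · intro h
    refine ⟨h.bot, fun {x k} hx hg => ?_, fun {x k} hx hg => ?_, fun {x k} hx hg σ v => ?_⟩
    · obtain ⟨fr, mr, rfl⟩ := exists_eq_mkObj hx
      exact h.mismatch _ _ _ hg
    · obtain ⟨fr, mr, rfl⟩ := exists_eq_mkObj hx
      obtain ⟨fr', mr', e, _⟩ := h.matching k.1 ⟨k.2.1, fr⟩ ⟨k.2.2, mr⟩ hg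
      rw [e]
      exact hd_mkObj _ _ _
    · obtain ⟨fr, mr, rfl⟩ := exists_eq_mkObj hx
      obtain ⟨sc, A, B⟩ := k
      obtain ⟨fr', mr', e, hf, hm⟩ := h.matching sc ⟨A, fr⟩ ⟨B, mr⟩ hg
      rw [e]
      obtain ⟨a | b, n⟩ := σ
      · by_cases hok : (sigSpec N L).ok (sc, A, B) (Sum.inl a, n)
        · rw [if_pos hok]
          obtain ⟨hn, f, hfm, hfa⟩ := hok
          subst hn hfa
          have ha : f.1 ∈ A := by
            have : f.1 ∈ (A : Set L) := hg.1.symm ▸ ⟨f, hfm, rfl⟩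
            exact this
          exact (ap_mkObj_field sc ⟨A, fr'⟩ ⟨B, mr'⟩ ha v).trans ((hf f hfm ha).trans
            (slotVal_field (mr := ⟨B, mr⟩) φ hfm ha v).symm)
        · rw [if_neg hok]
          refine ap_of_not_allowed (hd_mkObj sc ⟨A, fr'⟩ ⟨B, mr'⟩) (fun hal => hok ?_) v
          obtain ⟨h1, h2⟩ : a ∈ (A : Set L) ∧ n = 0 := hal
          rw [hg.1] at h1
          exact ⟨h2, h1⟩
      · by_cases hb : b ∈ B
        · have hb' : b ∈ (B : Set L) := hb
          rw [hg.2] at hb'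
          obtain ⟨m, hmm, rfl⟩ := hb'
          exact (ap_mkObj_method sc ⟨A, fr'⟩ ⟨B, mr'⟩ hb n v).trans ((hm m hmm hb _).trans
            (slotVal_method (fr := ⟨A, fr⟩) φ hmm hb n v).symm)
        · rw [ap_of_not_allowed (σ := (Sum.inr b, n)) (hd_mkObj sc ⟨A, fr'⟩ ⟨B, mr'⟩) hb v,
            if_neg fun hok => hb ((sigSpec N L).allowed_of_ok (h := (sc, A, B))
              (σ := (Sum.inr b, n)) hg hok)]
  · intro h
    refine ⟨h.bot, fun sc fr mr hg => h.mismatch (hd_mkObj sc fr mr) hg, fun sc fr mr hg => ?_⟩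
    have hx := hd_mkObj sc fr mr
    obtain ⟨fr', mr', e⟩ := exists_eq_mkObj (h.hd hx hg)
    have hap := h.ap hx hg
    rw [e] at hap
    refine ⟨fr', mr', e, fun f hf hfr => ?_, fun b hb hbr os => ?_⟩
    · have := hap (Sum.inl f.1, 0) Fin.elim0
      rw [if_pos ⟨rfl, f, hf, rfl⟩, slotVal_field φ hf hfr] at this
      exact (ap_mkObj_field sc ⟨fr.1, fr'⟩ ⟨mr.1, mr'⟩ hfr _).symm.trans this
    · induction os using WithBot.recBotCoe with
      | bot =>
        have h1 : mr.2 ⟨b.1, hbr⟩ ⊥ = ⊥ := (mr.2 ⟨b.1, hbr⟩).strict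
        have h2 : mr' ⟨b.1, hbr⟩ ⊥ = ⊥ := (mr' ⟨b.1, hbr⟩).strict
        rw [filterObjSig_eq_gate]
        have h3 : mr.2 ⟨b.1, hbr⟩ (filterSeq φ (argSigs sc b) ⊥) = ⊥ := h1
        change mr' ⟨b.1, hbr⟩ ⊥ = _
        rw [h3, gate_bot, h2]
      | coe os =>
        obtain ⟨n, v⟩ := os
        have := hap (Sum.inr b.1, n) v
        rw [slotVal_method φ hb hbr n v] at this
        exact (ap_mkObj_method sc ⟨fr.1, fr'⟩ ⟨mr.1, mr'⟩ hbr n v).symm.trans this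

theorem isFilter_filter : IsFilter (filter (sigSpec N L) : StrictFun O O) :=
  ⟨filterEqs_iff_unfolds.2 (unfolds_filter _), fun _ hψ x =>
    filter_le_of_unfolds (filterEqs_iff_unfolds.1 hψ) x⟩

theorem conforms_bot (V : Set O) (P : Set (SigClosure N L)) : Conforms V P (⊥ : O) := .inl rfl

theorem methConformsTo_iff {V : Set O} {sc : SigClosure N L} {A B : Finset L}
    {b : L × List N × N} (hb : b ∈ sc.root.methods) {m : Meth O} :
    MethConformsTo V (argSigs sc b) (sc.closAt b.2.2) m ↔ ∀ (n : ℕ) (v : Fin n → O),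
      (¬ (sigSpec N L).ok (sc, A, B) (Sum.inr b.1, n) → m (WithBot.some ⟨n, v⟩) = ⊥) ∧
      ((sigSpec N L).ok (sc, A, B) (Sum.inr b.1, n) →
        Conforms V ((sigSpec N L).res (sc, A, B) (Sum.inr b.1, n)) (m (WithBot.some ⟨n, v⟩)) ∧
        ∃ w ≤ v, (∀ i : Fin n, Conforms V ((sigSpec N L).acc (sc, A, B) (Sum.inr b.1, n) i) (w i)) ∧
          m (WithBot.some ⟨n, w⟩) = m (WithBot.some ⟨n, v⟩)) := by
  have hok := ok_method (h := (sc, A, B)) hb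
  have hacc := acc_method (h := (sc, A, B)) hb
  have hres := res_method (h := (sc, A, B)) hb
  constructor
  · intro h n v
    obtain ⟨⟨os, hos, hc, he⟩, hout⟩ := h (WithBot.some ⟨n, v⟩)
    constructor
    · intro hn
      rw [hok] at hn
      rcases hc with rfl | ⟨w, rfl, _⟩
      · rw [← he]
        exact m.strict
      · have := WithBot.coe_le_coe.1 hos
        obtain ⟨h, _⟩ := Sigma.le_def.1 this
        exact absurd h.symm hn
    · intro hn
      rw [hok] at hn
      dsimp only at hn
      subst hn
      refine ⟨by rw [hres]; exact conformsTo_iff.1 hout, ?_⟩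
      rcases hc with rfl | ⟨w, rfl, hw⟩
      · refine ⟨fun _ => ⊥, fun _ => bot_le, fun i => conforms_bot _ _, ?_⟩
        have h0 : m (WithBot.some ⟨_, v⟩) = ⊥ := he.symm.trans m.strict
        rw [h0]
        refine le_bot_iff.1 ((m.mono ?_).trans_eq h0)
        exact WithBot.coe_le_coe.2 (Sigma.mk_le_mk_iff.2 fun _ => bot_le)
      · refine ⟨w, Sigma.mk_le_mk_iff.1 (WithBot.coe_le_coe.1 hos), fun i => ?_, he⟩
        rw [hacc]
        exact conformsTo_iff.1 (hw i)
  · intro h os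
    induction os using WithBot.recBotCoe with
    | bot => exact ⟨⟨⊥, le_rfl, .inl rfl, rfl⟩, .inl m.strict⟩
    | coe os =>
      obtain ⟨n, v⟩ := os
      by_cases hn : n = (argSigs sc b).length
      · subst hn
        obtain ⟨hout, w, hwv, hw, he⟩ := (h _ v).2 ((hok _).2 rfl)
        rw [hres] at hout
        refine ⟨⟨WithBot.some ⟨_, w⟩, WithBot.coe_le_coe.2 (Sigma.mk_le_mk_iff.2 hwv),
          .inr ⟨w, rfl, fun i => ?_⟩, he⟩, conformsTo_iff.2 hout⟩
        have := hw i
        rw [hacc] at this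
        exact conformsTo_iff.2 this
      · have h0 := (h n v).1 fun hk => hn ((hok n).1 hk)
        exact ⟨⟨⊥, bot_le, .inl rfl, m.strict.trans h0.symm⟩, .inl h0⟩

/-- The validity clauses, read slotwise. -/
theorem validClauses_iff_slotValid {V : Set O} {o : O} :
    ValidClauses V o ↔ SlotValid (sigSpec N L) V o := by
  refine or_congr_right ⟨?_, ?_⟩
  · rintro ⟨sc, ⟨A, fr⟩, ⟨B, mr⟩, rfl, hg, hf, hm⟩
    refine ⟨_, hd_mkObj _ _ _, hg, ?_⟩
    rintro ⟨a | b, n⟩ v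
    · constructor
      · intro hok
        refine ap_of_not_allowed (hd_mkObj sc ⟨A, fr⟩ ⟨B, mr⟩) (fun hal => hok ?_) v
        obtain ⟨h1, h2⟩ : a ∈ (A : Set L) ∧ n = 0 := hal
        rw [hg.1] at h1
        exact ⟨h2, h1⟩
      · rintro ⟨hn, f, hfm, hfa⟩
        subst hn hfa
        have ha : f.1 ∈ A := by
          have : f.1 ∈ (A : Set L) := hg.1.symm ▸ ⟨f, hfm, rfl⟩
          exact this
        refine ⟨?_, v, le_rfl, fun i => i.elim0, rfl⟩
        rw [res_field (h := (sc, A, B)) hfm, ap_mkObj_field sc ⟨A, fr⟩ ⟨B, mr⟩ ha]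
        exact conformsTo_iff.1 (hf f hfm ha)
    · by_cases hb : b ∈ B
      · have hb' : b ∈ (B : Set L) := hb
        rw [hg.2] at hb'
        obtain ⟨m, hmm, rfl⟩ := hb'
        have := (methConformsTo_iff (A := A) (B := B) hmm).1 (hm m hmm hb) n v
        have e := ap_mkObj_method sc ⟨A, fr⟩ ⟨B, mr⟩ hb n
        rw [e]
        refine ⟨this.1, fun hok => ⟨(this.2 hok).1, ?_⟩⟩
        obtain ⟨w, h1, h2, h3⟩ := (this.2 hok).2
        exact ⟨w, h1, h2, (e w).trans h3⟩
      · refine ⟨fun _ => ap_of_not_allowed (σ := (Sum.inr b, n)) (hd_mkObj sc ⟨A, fr⟩ ⟨B, mr⟩) hb v,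
          fun hok => absurd ((sigSpec N L).allowed_of_ok (h := (sc, A, B)) hg hok) hb⟩
  · rintro ⟨⟨sc, A, B⟩, hh, hg, hv⟩
    obtain ⟨fr, mr, rfl⟩ := exists_eq_mkObj hh
    refine ⟨sc, ⟨A, fr⟩, ⟨B, mr⟩, rfl, hg, fun f hf hfr => ?_, fun b hb hbr => ?_⟩
    · have := ((hv (Sum.inl f.1, 0) Fin.elim0).2 ⟨rfl, f, hf, rfl⟩).1
      rw [res_field (h := (sc, A, B)) hf, ap_mkObj_field sc ⟨A, fr⟩ ⟨B, mr⟩ hfr] at this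
      exact conformsTo_iff.2 this
    · refine (methConformsTo_iff (A := A) (B := B) hb).2 fun n v => ?_
      have := hv (Sum.inr b.1, n) v
      have e := ap_mkObj_method sc ⟨A, fr⟩ ⟨B, mr⟩ hbr n
      rw [e] at this
      refine ⟨this.1, fun hok => ⟨(this.2 hok).1, ?_⟩⟩
      obtain ⟨w, h1, h2, h3⟩ := (this.2 hok).2
      exact ⟨w, h1, h2, (e w).symm.trans h3⟩

end Objects

/-! ### Reachability in finite and in recursively enumerable graphs -/

section Reachability

attribute [local fun_prop] Primrec Primrec.id Primrec.const Primrec.comp Primrec.pair Primrec.fst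
  Primrec.snd

attribute [local fun_prop] Computable Computable.id Computable.const Computable.comp Computable.pair
  Computable.fst Computable.snd

variable {α β : Type} [Primcodable α] [Primcodable β]

open scoped Classical in
/-- Add the direct successors of the members of `X` with respect to a list of edges. -/
noncomputable def expand (E : List (α × α)) (X : List α) : List α :=
  X ++ (E.filter fun e => e.1 ∈ X).map Prod.snd

omit [Primcodable α] in
theorem mem_expand {E : List (α × α)} {X : List α} {b : α} :
    b ∈ expand E X ↔ b ∈ X ∨ ∃ a ∈ X, (a, b) ∈ E := by
  simp only [expand, List.mem_append, List.mem_map, List.mem_filter, decide_eq_true_eq]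
  refine or_congr_right ⟨?_, ?_⟩
  · rintro ⟨⟨a, b⟩, ⟨h1, h2⟩, rfl⟩
    exact ⟨a, h2, h1⟩
  · rintro ⟨a, h1, h2⟩
    exact ⟨(a, b), ⟨h2, h1⟩, rfl⟩

open scoped Classical in
theorem primrec_expand : Primrec fun x : List (α × α) × List α => expand x.1 x.2 := by
  refine primrec_append (by fun_prop) (primrec_map (g := fun _ (e : α × α) => e.2)
    (primrec_filter (p := fun (x : List (α × α) × List α) (e : α × α) => e.1 ∈ x.2)
      (by fun_prop) ?_) (by fun_prop))
  have h : PrimrecRel fun (l : List α) (b : α) => ∃ a ∈ l, a = b :=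
    PrimrecRel.exists_mem_list Primrec.eq
  exact (h.comp (f := fun x : (List (α × α) × List α) × (α × α) => x.1.2)
    (g := fun x => x.2.1) (by fun_prop) (by fun_prop)).of_eq fun x => by simp

/-- Reachability in a finite graph is decidable. -/
theorem computablePred_reflTransGen : ComputablePred fun x : List (α × α) × α × α =>
    ReflTransGen (fun a b => (a, b) ∈ x.1) x.2.1 x.2.2 := by
  rw [ComputablePred.computable_iff_re_compl_re']
  constructor
  · have hc : Computable fun x : (List (α × α) × α × α) × ℕ =>
        (expand x.1.1)^[x.2] [x.1.2.1] := by
      refine (Primrec.nat_iterate (f := fun x : (List (α × α) × α × α) × ℕ => x.2)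
        (g := fun x => [x.1.2.1]) (h := fun x => expand x.1.1) (by fun_prop) ?_ ?_).to_comp
      · exact primrec_cons (by fun_prop) (Primrec.const [])
      · exact primrec_expand.comp (g := fun y : ((List (α × α) × α × α) × ℕ) × List α =>
          (y.1.1.1, y.2)) (by fun_prop)
    refine (REPred.exists (p := fun (x : List (α × α) × α × α) n =>
      x.2.2 ∈ (expand x.1)^[n] [x.2.1]) (computablePred_mem (by fun_prop) hc).to_re).of_eq ?_
    rintro ⟨E, a, b⟩
    constructor
    · rintro ⟨n, hn⟩
      dsimp only at hn ⊢
      induction n generalizing b with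
      | zero =>
        obtain rfl : b = a := by simpa using hn
        exact .refl
      | succ n ih =>
        rw [Function.iterate_succ_apply', mem_expand] at hn
        rcases hn with hn | ⟨c, hc, hcb⟩
        · exact ih b hn
        · exact (ih c hc).tail hcb
    · intro h
      dsimp only at h ⊢
      induction h with
      | refl => exact ⟨0, by simp⟩
      | tail _ hbc ih =>
        obtain ⟨n, hn⟩ := ih
        refine ⟨n + 1, ?_⟩
        rw [Function.iterate_succ_apply', mem_expand]
        exact .inr ⟨_, hn, hbc⟩
  · -- a set that is closed under the edges, contains `a` and does not contain `b`
    refine (REPred.exists (p := fun (x : List (α × α) × α × α) (C : List α) =>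
      x.2.1 ∈ C ∧ ¬ x.2.2 ∈ C ∧ ∀ e ∈ x.1, e.1 ∈ C → e.2 ∈ C) (ComputablePred.to_re
        (.and (computablePred_mem (by fun_prop) (by fun_prop))
          (.and (computablePred_mem (by fun_prop) (by fun_prop)).not
            (ComputablePred.forall_mem
              (p := fun (x : (List (α × α) × α × α) × List α) (e : α × α) => e.1 ∈ x.2 → e.2 ∈ x.2)
              (l := fun x => x.1.1) (.imp (computablePred_mem (by fun_prop) (by fun_prop))
                (computablePred_mem (by fun_prop) (by fun_prop))) (by fun_prop)))))).of_eq ?_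
    rintro ⟨E, a, b⟩
    dsimp only
    constructor
    · rintro ⟨C, ha, hb, hC⟩ h
      refine hb ?_
      clear hb
      induction h with
      | refl => exact ha
      | tail _ hbc ih => exact hC _ hbc ih
    · intro h
      classical
      refine ⟨(a :: E.map Prod.snd).filter fun c => ReflTransGen (fun a b => (a, b) ∈ E) a c,
        ?_, ?_, ?_⟩
      · simp [ReflTransGen.refl]
      · simp [h]
      · rintro ⟨c, d⟩ he hc
        simp only [List.mem_filter, decide_eq_true_eq] at hc ⊢
        exact ⟨List.mem_cons_of_mem _ (List.mem_map.2 ⟨_, he, rfl⟩), hc.2.tail he⟩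

/-- The reflexive transitive closure of a recursively enumerable relation is recursively
enumerable: guess a finite set of edges of the relation. -/
theorem _root_.REPred.reflTransGen {r : α → α → Prop} (hr : REPred fun x : α × α => r x.1 x.2) :
    REPred fun x : α × α => ReflTransGen r x.1 x.2 := by
  refine (REPred.exists (p := fun (x : α × α) (E : List (α × α)) => (∀ e ∈ E, r e.1 e.2) ∧
    ReflTransGen (fun a b => (a, b) ∈ E) x.1 x.2) (.and ?_
      (computablePred_reflTransGen.to_re.comp
        (f := fun y : (α × α) × List (α × α) => (y.2, y.1.1, y.1.2)) (by fun_prop)))).of_eq ?_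
  · exact REPred.forall_mem (p := fun (_ : (α × α) × List (α × α)) (e : α × α) => r e.1 e.2)
      (hr.comp (f := fun y : ((α × α) × List (α × α)) × (α × α) => y.2) (by fun_prop)) (by fun_prop)
  rintro ⟨a, b⟩
  dsimp only
  constructor
  · rintro ⟨E, hE, h⟩
    exact ReflTransGen.mono (fun a b hab => hE _ hab) _ _ h
  · intro h
    induction h with
    | refl => exact ⟨[], by simp, .refl⟩
    | @tail b c _ hbc ih =>
      obtain ⟨E, hE, h⟩ := ih
      refine ⟨(b, c) :: E, ?_, ?_⟩
      · intro e he
        rcases List.mem_cons.1 he with rfl | he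
        · exact hbc
        · exact hE e he
      · exact (ReflTransGen.mono (fun a b hab => List.mem_cons_of_mem _ hab) _ _ h).tail
          List.mem_cons_self

theorem computablePred_forall_mem_mem {f g : α → List β} (hf : Computable f) (hg : Computable g) :
    ComputablePred fun a => ∀ b ∈ f a, b ∈ g a :=
  ComputablePred.forall_mem (p := fun a b => b ∈ g a) (computablePred_mem .snd (hg.comp .fst)) hf

end Reachability

/-! ### Codes of signature closures -/

section SigCodes

attribute [local fun_prop] Primrec Primrec.id Primrec.const Primrec.comp Primrec.pair Primrec.fst
  Primrec.snd

attribute [local fun_prop] Computable Computable.id Computable.const Computable.comp Computable.pair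
  Computable.fst Computable.snd

/-- Class signatures with lists in place of finite sets. -/
abbrev SigCode (N L : Type) : Type := N × List N × List (L × N) × List (L × List N × N)

variable {N L : Type}

open scoped Classical in
/-- The class signature with the given code. -/
noncomputable def toSig (c : SigCode N L) : ClassSig N L :=
  ⟨c.1, c.2.1.toFinset, c.2.2.1.toFinset, c.2.2.2.toFinset⟩

open scoped Classical in
/-- The set of class signatures that is given by a list of codes. -/
noncomputable def envOf (l : List (SigCode N L)) : Finset (ClassSig N L) := (l.map toSig).toFinset

theorem mem_envOf {l : List (SigCode N L)} {s : ClassSig N L} :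
    s ∈ envOf l ↔ ∃ c ∈ l, toSig c = s := by simp [envOf]

theorem forall_mem_envOf {l : List (SigCode N L)} {p : ClassSig N L → Prop} :
    (∀ s ∈ envOf l, p s) ↔ ∀ c ∈ l, p (toSig c) :=
  ⟨fun h c hc => h _ (mem_envOf.2 ⟨c, hc, rfl⟩), fun h s hs => by
    obtain ⟨c, hc, rfl⟩ := mem_envOf.1 hs
    exact h c hc⟩

theorem exists_mem_envOf {l : List (SigCode N L)} {p : ClassSig N L → Prop} :
    (∃ s ∈ envOf l, p s) ↔ ∃ c ∈ l, p (toSig c) :=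
  ⟨fun ⟨s, hs, h⟩ => by
    obtain ⟨c, hc, rfl⟩ := mem_envOf.1 hs
    exact ⟨c, hc, h⟩, fun ⟨c, hc, h⟩ => ⟨_, mem_envOf.2 ⟨c, hc, rfl⟩, h⟩⟩

theorem toSig_surjective : Function.Surjective (toSig : SigCode N L → ClassSig N L) := fun s =>
  ⟨(s.name, s.supers.toList, s.fields.toList, s.methods.toList), by simp [toSig]⟩

theorem envOf_surjective : Function.Surjective (envOf : List (SigCode N L) → _) := fun se => by
  choose f hf using toSig_surjective (N := N) (L := L)
  refine ⟨se.toList.map f, ?_⟩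
  ext s
  simp [mem_envOf, hf]

theorem toSig_eq_iff {c d : SigCode N L} : toSig c = toSig d ↔ c.1 = d.1 ∧
    ((∀ n ∈ c.2.1, n ∈ d.2.1) ∧ ∀ n ∈ d.2.1, n ∈ c.2.1) ∧
    ((∀ n ∈ c.2.2.1, n ∈ d.2.2.1) ∧ ∀ n ∈ d.2.2.1, n ∈ c.2.2.1) ∧
    ((∀ n ∈ c.2.2.2, n ∈ d.2.2.2) ∧ ∀ n ∈ d.2.2.2, n ∈ c.2.2.2) := by
  simp only [toSig, ClassSig.mk.injEq, Finset.ext_iff, List.mem_toFinset, ← forall_and,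
    ← iff_iff_implies_and_implies]

/-- The names referenced in a class signature. -/
def refList (c : SigCode N L) : List N :=
  c.2.1 ++ (c.2.2.1.map Prod.snd ++ c.2.2.2.flatMap fun m => m.2.1 ++ [m.2.2])

theorem mem_refList {c : SigCode N L} {n : N} : n ∈ refList c ↔ n ∈ (toSig c).refs := by
  simp [refList, ClassSig.refs, toSig, eq_comm]

/-- The direct references of a list of class signatures. -/
def refEdges (l : List (SigCode N L)) : List (N × N) :=
  l.flatMap fun c => (refList c).map fun n => (c.1, n)

/-- The supersignature references of a list of class signatures. -/
def superEdges (l : List (SigCode N L)) : List (N × N) :=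
  l.flatMap fun c => c.2.1.map fun n => (c.1, n)

theorem mem_refEdges {l : List (SigCode N L)} {a b : N} :
    (a, b) ∈ refEdges l ↔ Adj (envOf l) a b := by
  rw [Adj, exists_mem_envOf]
  simp only [refEdges, List.mem_flatMap, List.mem_map, Prod.mk.injEq, ← mem_refList]
  refine exists_congr fun c => and_congr_right fun _ => ⟨?_, ?_⟩
  · rintro ⟨n, hn, h1, rfl⟩
    exact ⟨h1, hn⟩
  · rintro ⟨h1, h2⟩
    exact ⟨b, h2, h1, rfl⟩

theorem mem_superEdges {l : List (SigCode N L)} {a b : N} :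
    (a, b) ∈ superEdges l ↔ Super (envOf l) a b := by
  rw [Super, exists_mem_envOf]
  simp only [superEdges, List.mem_flatMap, List.mem_map, Prod.mk.injEq]
  refine exists_congr fun c => and_congr_right fun _ => ⟨?_, ?_⟩
  · rintro ⟨n, hn, h1, rfl⟩
    exact ⟨h1, by simpa [toSig] using hn⟩
  · rintro ⟨h1, h2⟩
    exact ⟨b, by simpa [toSig] using h2, h1, rfl⟩

/-- The definition of signature closures in terms of codes. -/
theorem isSigClosure_iff {nm : N} {l : List (SigCode N L)} : IsSigClosure nm (envOf l) ↔
    (∀ c ∈ l, (∀ f ∈ c.2.2.1, ∀ g ∈ c.2.2.1, f.1 = g.1 → f = g) ∧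
      ∀ f ∈ c.2.2.2, ∀ g ∈ c.2.2.2, f.1 = g.1 → f = g) ∧
    (∀ c ∈ l, (∀ n ∈ refList c, ∃ d ∈ l, d.1 = n) ∧
      ReflTransGen (fun a b => (a, b) ∈ refEdges l) nm c.1) ∧
    (∀ c ∈ l, ∀ d ∈ l, (c.1 = d.1 → toSig c = toSig d) ∧
      (d.1 ∈ c.2.1 → (∀ f ∈ d.2.2.1, f ∈ c.2.2.1) ∧ ∀ m ∈ d.2.2.2, m ∈ c.2.2.2)) ∧
    (∀ e ∈ superEdges l, ¬ ReflTransGen (fun a b => (a, b) ∈ superEdges l) e.2 e.1) ∧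
    ∃ c ∈ l, c.1 = nm := by
  have hA : (fun a b => (a, b) ∈ refEdges l) = Adj (envOf l) := by
    funext a b
    exact propext mem_refEdges
  have hS : (fun a b => (a, b) ∈ superEdges l) = Super (envOf l) := by
    funext a b
    exact propext mem_superEdges
  rw [hA, hS]
  constructor
  · rintro ⟨⟨h1, h2, h3, h4, h5, h6⟩, h7, h8⟩
    rw [forall_mem_envOf] at h1 h3 h8
    simp only [forall_mem_envOf] at h2 h5 h6
    rw [exists_mem_envOf] at h7
    refine ⟨fun c hc => ⟨?_, ?_⟩, fun c hc => ⟨fun n hn => ?_, h8 c hc⟩,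
      fun c hc d hd => ⟨h2 c hc d hd, fun hdc => ⟨?_, ?_⟩⟩, ?_, h7⟩
    · simpa [toSig] using (h1 c hc).1
    · simpa [toSig] using (h1 c hc).2
    · have := h3 c hc n (mem_refList.1 hn)
      rw [exists_mem_envOf] at this
      exact this
    · have := h5 c hc d hd (by simpa [toSig] using hdc)
      simpa [toSig, Finset.subset_iff] using this
    · have := h6 c hc d hd (by simpa [toSig] using hdc)
      simpa [toSig, Finset.subset_iff] using this
    · rintro ⟨a, b⟩ he h
      exact h4 a (TransGen.head' (mem_superEdges.1 he) h)
  · rintro ⟨h1, h2, h3, h4, h5⟩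
    refine ⟨⟨?_, ?_, ?_, ?_, ?_, ?_⟩, exists_mem_envOf.2 h5, ?_⟩
    · rw [forall_mem_envOf]
      intro c hc
      exact ⟨by simpa [toSig] using (h1 c hc).1, by simpa [toSig] using (h1 c hc).2⟩
    · simp only [forall_mem_envOf]
      exact fun c hc d hd => (h3 c hc d hd).1
    · rw [forall_mem_envOf]
      intro c hc n hn
      rw [exists_mem_envOf]
      exact (h2 c hc).1 n (mem_refList.2 hn)
    · intro n hn
      obtain ⟨b, hnb, hbn⟩ := TransGen.head'_iff.1 hn
      exact h4 (n, b) (mem_superEdges.2 hnb) hbn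
    · simp only [forall_mem_envOf]
      intro c hc d hd hdc
      have := ((h3 c hc d hd).2 (by simpa [toSig] using hdc)).1
      simpa [toSig, Finset.subset_iff] using this
    · simp only [forall_mem_envOf]
      intro c hc d hd hdc
      have := ((h3 c hc d hd).2 (by simpa [toSig] using hdc)).2
      simpa [toSig, Finset.subset_iff] using this
    · rw [forall_mem_envOf]
      exact fun c hc => (h2 c hc).2

variable [Primcodable N] [Primcodable L]

theorem primrec_refList : Primrec (refList : SigCode N L → List N) := by
  refine primrec_append (by fun_prop) (primrec_append (primrec_map (g := fun _ (f : L × N) => f.2)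
    (by fun_prop) (by fun_prop)) (primrec_flatMap
      (g := fun _ (m : L × List N × N) => m.2.1 ++ [m.2.2]) (by fun_prop)
      (primrec_append (by fun_prop) (primrec_cons (by fun_prop) (Primrec.const [])))))

theorem primrec_refEdges : Primrec (refEdges : List (SigCode N L) → List (N × N)) :=
  primrec_flatMap (g := fun _ (c : SigCode N L) => (refList c).map fun n => (c.1, n)) (by fun_prop)
    (primrec_map (g := fun (x : List (SigCode N L) × SigCode N L) n => (x.2.1, n))
      (primrec_refList.comp (by fun_prop)) (by fun_prop))

theorem primrec_superEdges : Primrec (superEdges : List (SigCode N L) → List (N × N)) :=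
  primrec_flatMap (g := fun _ (c : SigCode N L) => c.2.1.map fun n => (c.1, n)) (by fun_prop)
    (primrec_map (g := fun (x : List (SigCode N L) × SigCode N L) n => (x.2.1, n))
      (by fun_prop) (by fun_prop))

theorem computablePred_toSig_eq :
    ComputablePred fun x : SigCode N L × SigCode N L => toSig x.1 = toSig x.2 := by
  have h : ∀ {β : Type} [Primcodable β] {f : SigCode N L → List β}, Computable f →
      ComputablePred fun x : SigCode N L × SigCode N L =>
        (∀ n ∈ f x.1, n ∈ f x.2) ∧ ∀ n ∈ f x.2, n ∈ f x.1 := fun hf =>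
    (computablePred_forall_mem_mem (hf.comp .fst) (hf.comp .snd)).and
      (computablePred_forall_mem_mem (hf.comp .snd) (hf.comp .fst))
  refine ComputablePred.of_eq (.and (computablePred_eq (by fun_prop) (by fun_prop))
    (.and (h (f := fun c => c.2.1) (by fun_prop)) (.and (h (f := fun c => c.2.2.1) (by fun_prop))
      (h (f := fun c => c.2.2.2) (by fun_prop))))) fun x => toSig_eq_iff.symm

theorem computablePred_injOn {α β γ : Type} [Primcodable α] [Primcodable β] [Primcodable γ]
    {f : α → List (β × γ)} (hf : Computable f) :
    ComputablePred fun a => ∀ x ∈ f a, ∀ y ∈ f a, x.1 = y.1 → x = y :=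
  ComputablePred.forall_mem (p := fun a (x : β × γ) => ∀ y ∈ f a, x.1 = y.1 → x = y)
    (ComputablePred.forall_mem (p := fun (z : α × (β × γ)) (y : β × γ) => z.2.1 = y.1 → z.2 = y)
      (.imp (computablePred_eq (by fun_prop) (by fun_prop))
        (computablePred_eq (by fun_prop) (by fun_prop))) (hf.comp .fst)) hf

/-- It is decidable whether a code denotes a signature closure. -/
theorem computablePred_isSigClosure :
    ComputablePred fun x : N × List (SigCode N L) => IsSigClosure x.1 (envOf x.2) := by
  refine ComputablePred.of_eq (.and ?_ (.and ?_ (.and ?_ (.and ?_ ?_)))) fun x =>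
    isSigClosure_iff.symm
  · refine ComputablePred.forall_mem (p := fun _ (c : SigCode N L) =>
      (∀ f ∈ c.2.2.1, ∀ g ∈ c.2.2.1, f.1 = g.1 → f = g) ∧
      ∀ f ∈ c.2.2.2, ∀ g ∈ c.2.2.2, f.1 = g.1 → f = g) (.and ?_ ?_) (by fun_prop)
    · exact computablePred_injOn
        (f := fun x : (N × List (SigCode N L)) × SigCode N L => x.2.2.2.1) (by fun_prop)
    · exact computablePred_injOn
        (f := fun x : (N × List (SigCode N L)) × SigCode N L => x.2.2.2.2) (by fun_prop)
  · refine ComputablePred.forall_mem (p := fun (x : N × List (SigCode N L)) (c : SigCode N L) =>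
      (∀ n ∈ refList c, ∃ d ∈ x.2, d.1 = n) ∧
        ReflTransGen (fun a b => (a, b) ∈ refEdges x.2) x.1 c.1) (.and ?_ ?_) (by fun_prop)
    · refine ComputablePred.forall_mem
        (p := fun (y : (N × List (SigCode N L)) × SigCode N L) n => ∃ d ∈ y.1.2, d.1 = n) ?_
        (primrec_refList.to_comp.comp (by fun_prop))
      exact ComputablePred.exists_mem
        (p := fun (z : ((N × List (SigCode N L)) × SigCode N L) × N) (d : SigCode N L) =>
          d.1 = z.2) (computablePred_eq (by fun_prop) (by fun_prop)) (by fun_prop)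
    · exact computablePred_reflTransGen.comp
        (f := fun y : (N × List (SigCode N L)) × SigCode N L => (refEdges y.1.2, y.1.1, y.2.1))
        (.pair (primrec_refEdges.to_comp.comp
          (g := fun y : (N × List (SigCode N L)) × SigCode N L => y.1.2) (by fun_prop))
          (by fun_prop))
  · refine ComputablePred.forall_mem (p := fun (x : N × List (SigCode N L)) (c : SigCode N L) =>
      ∀ d ∈ x.2, (c.1 = d.1 → toSig c = toSig d) ∧
      (d.1 ∈ c.2.1 → (∀ f ∈ d.2.2.1, f ∈ c.2.2.1) ∧ ∀ m ∈ d.2.2.2, m ∈ c.2.2.2)) ?_ (by fun_prop)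
    refine ComputablePred.forall_mem
      (p := fun (y : (N × List (SigCode N L)) × SigCode N L) (d : SigCode N L) =>
        (y.2.1 = d.1 → toSig y.2 = toSig d) ∧
        (d.1 ∈ y.2.2.1 → (∀ f ∈ d.2.2.1, f ∈ y.2.2.2.1) ∧ ∀ m ∈ d.2.2.2, m ∈ y.2.2.2.2))
      (.and (.imp (computablePred_eq (by fun_prop) (by fun_prop)) ?_)
        (.imp (computablePred_mem (by fun_prop) (by fun_prop)) (.and ?_ ?_))) (by fun_prop)
    · exact computablePred_toSig_eq.comp
        (f := fun y : ((N × List (SigCode N L)) × SigCode N L) × SigCode N L => (y.1.2, y.2))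
        (by fun_prop)
    · exact computablePred_forall_mem_mem
        (f := fun y : ((N × List (SigCode N L)) × SigCode N L) × SigCode N L => y.2.2.2.1)
        (g := fun y => y.1.2.2.2.1) (by fun_prop) (by fun_prop)
    · exact computablePred_forall_mem_mem
        (f := fun y : ((N × List (SigCode N L)) × SigCode N L) × SigCode N L => y.2.2.2.2)
        (g := fun y => y.1.2.2.2.2) (by fun_prop) (by fun_prop)
  · refine ComputablePred.forall_mem (p := fun (x : N × List (SigCode N L)) (e : N × N) =>
      ¬ ReflTransGen (fun a b => (a, b) ∈ superEdges x.2) e.2 e.1) (.not ?_)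
      (primrec_superEdges.to_comp.comp .snd)
    exact computablePred_reflTransGen.comp
      (f := fun y : (N × List (SigCode N L)) × (N × N) => (superEdges y.1.2, y.2.2, y.2.1))
      (.pair (primrec_superEdges.to_comp.comp
        (g := fun y : (N × List (SigCode N L)) × (N × N) => y.1.2) (by fun_prop)) (by fun_prop))
  · exact ComputablePred.exists_mem
      (p := fun (x : N × List (SigCode N L)) (d : SigCode N L) => d.1 = x.1)
      (computablePred_eq (by fun_prop) (by fun_prop)) (by fun_prop)

end SigCodes

end NOOP

namespace NOOP

open Set Relation PreObj

/-! ### Enumerations of signature closures -/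

section SigClosures

variable {N L : Type}

theorem SigClosure.ext_iff {sc sc' : SigClosure N L} :
    sc = sc' ↔ sc.name = sc'.name ∧ sc.env = sc'.env := by
  obtain ⟨n, se, h⟩ := sc
  obtain ⟨n', se', h'⟩ := sc'
  simp

theorem SigClosure.countable [Countable N] [Countable L] : Countable (SigClosure N L) := by
  have h1 : Countable (ClassSig N L) := toSig_surjective.countable
  refine Function.Injective.countable (f := fun sc : SigClosure N L => (sc.name, sc.env)) ?_
  exact fun sc sc' h => SigClosure.ext_iff.2 (Prod.mk.inj h)

theorem SigClosure.closAt_of_bound (sc : SigClosure N L) {n : N} (h : ∃ s ∈ sc.env, s.name = n) :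
    (sc.closAt n).name = n ∧ (sc.closAt n).env ⊆ sc.env := by
  rw [SigClosure.closAt, dif_pos h]
  exact ⟨rfl, fun s hs => (mem_accessible.1 hs).1⟩

/-- A signature closure whose environment is contained in that of `sc` is the closure of its name
there: a closed set of signatures with distinct names contains what is accessible from it. -/
theorem SigClosure.closAt_eq {sc sc' : SigClosure N L} (h : sc'.env ⊆ sc.env) :
    sc.closAt sc'.name = sc' := by
  obtain ⟨r, hr, hrn⟩ := sc'.isSigClosure.root
  have hb : ∃ s ∈ sc.env, s.name = sc'.name := ⟨r, h hr, hrn⟩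
  have hadj : ∀ m, ReflTransGen (Adj sc.env) sc'.name m → ∃ t ∈ sc'.env, t.name = m := by
    intro m hm
    induction hm with
    | refl => exact ⟨r, hr, hrn⟩
    | tail _ hbc ih =>
      obtain ⟨s, hs, rfl, hc⟩ := hbc
      obtain ⟨t, ht, hts⟩ := ih
      obtain rfl := sc.isSigClosure.isSigEnv.name_inj t (h ht) s hs hts
      exact sc'.isSigClosure.isSigEnv.closed t ht _ hc
  rw [SigClosure.closAt, dif_pos hb]
  refine SigClosure.ext_iff.2 ⟨rfl, Finset.ext fun s => ?_⟩
  rw [mem_accessible]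
  constructor
  · rintro ⟨hs, hm⟩
    obtain ⟨t, ht, hts⟩ := hadj _ hm
    rwa [← sc.isSigClosure.isSigEnv.name_inj t (h ht) s hs hts]
  · intro hs
    refine ⟨h hs, ReflTransGen.mono ?_ _ _ (sc'.isSigClosure.minimal s hs)⟩
    rintro _ _ ⟨t, ht, hab⟩
    exact ⟨t, h ht, hab⟩

theorem SigClosure.bound_of_mem_refs (sc : SigClosure N L) {n : N} (h : n ∈ sc.root.refs) :
    ∃ s ∈ sc.env, s.name = n :=
  sc.isSigClosure.isSigEnv.closed _ sc.root_spec.1 _ h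

end SigClosures

section Enumeration

attribute [local fun_prop] Primrec Primrec.id Primrec.const Primrec.comp Primrec.pair Primrec.fst
  Primrec.snd

attribute [local fun_prop] Computable Computable.id Computable.const Computable.comp Computable.pair
  Computable.fst Computable.snd

variable {N L : Type} [Primcodable N] [Primcodable L]

/-- `sOf` enumerates the signature closures, and `s` computes their codes. -/
structure IsSigCoding (s : ℕ → N × List (SigCode N L)) (sOf : ℕ → SigClosure N L) : Prop where
  computable : Computable s
  surjective : Function.Surjective sOf
  name_eq : ∀ i, (sOf i).name = (s i).1
  env_eq : ∀ i, (sOf i).env = envOf (s i).2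

theorem exists_isSigCoding [Nonempty (SigClosure N L)] :
    ∃ (s : ℕ → N × List (SigCode N L)) (sOf : ℕ → SigClosure N L), IsSigCoding s sOf := by
  have key : ∀ sc : SigClosure N L, ∃ c : N × List (SigCode N L),
      IsSigClosure c.1 (envOf c.2) ∧ sc.name = c.1 ∧ sc.env = envOf c.2 := fun sc => by
    obtain ⟨l, hl⟩ := envOf_surjective sc.env
    exact ⟨(sc.name, l), hl.symm ▸ sc.isSigClosure, rfl, hl.symm⟩
  obtain ⟨s, hs, hrange⟩ := exists_computable_range_eq
    (computablePred_isSigClosure (N := N) (L := L)).to_re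
    (let ⟨c, hc, _⟩ := key (Classical.arbitrary _); ⟨c, hc⟩)
  refine ⟨s, fun n => ⟨(s n).1, envOf (s n).2, (hrange _).2 ⟨n, rfl⟩⟩, hs, fun sc => ?_,
    fun _ => rfl, fun _ => rfl⟩
  obtain ⟨c, hc, h1, h2⟩ := key sc
  obtain ⟨n, rfl⟩ := (hrange c).1 hc
  exact ⟨n, SigClosure.ext_iff.2 ⟨h1.symm, h2.symm⟩⟩

open scoped Classical in
/-- The codes of the root in a code of a signature closure. -/
noncomputable def rootCodes (x : N × List (SigCode N L)) : List (SigCode N L) :=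
  x.2.filter fun c => c.1 = x.1

open scoped Classical in
theorem primrec_rootCodes : Primrec (rootCodes : N × List (SigCode N L) → List (SigCode N L)) :=
  primrec_filter (p := fun (x : N × List (SigCode N L)) (c : SigCode N L) => c.1 = x.1)
    (by fun_prop) (Primrec.eq.comp (by fun_prop) (by fun_prop))

/-- The immediate supersignatures of the root. -/
noncomputable def rootSupers (x : N × List (SigCode N L)) : List N :=
  (rootCodes x).flatMap fun c => c.2.1

/-- The field signatures of the root. -/
noncomputable def rootFields (x : N × List (SigCode N L)) : List (L × N) :=
  (rootCodes x).flatMap fun c => c.2.2.1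

/-- The method signatures of the root. -/
noncomputable def rootMethods (x : N × List (SigCode N L)) : List (L × List N × N) :=
  (rootCodes x).flatMap fun c => c.2.2.2

theorem primrec_rootSupers : Primrec (rootSupers : N × List (SigCode N L) → List N) :=
  primrec_flatMap (g := fun _ (c : SigCode N L) => c.2.1) primrec_rootCodes (by fun_prop)

theorem primrec_rootFields : Primrec (rootFields : N × List (SigCode N L) → List (L × N)) :=
  primrec_flatMap (g := fun _ (c : SigCode N L) => c.2.2.1) primrec_rootCodes (by fun_prop)

theorem primrec_rootMethods :
    Primrec (rootMethods : N × List (SigCode N L) → List (L × List N × N)) :=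
  primrec_flatMap (g := fun _ (c : SigCode N L) => c.2.2.2) primrec_rootCodes (by fun_prop)

/-- The left components of a disjoint union, as a list with at most one member. -/
def leftList (x : L ⊕ L) : List L := Sum.elim (fun a => [a]) (fun _ => []) x

/-- The right components of a disjoint union, as a list with at most one member. -/
def rightList (x : L ⊕ L) : List L := Sum.elim (fun _ => []) (fun b => [b]) x

theorem primrec_leftList : Primrec (leftList : L ⊕ L → List L) :=
  (Primrec.sumCasesOn (f := fun x : L ⊕ L => x) (g := fun _ a => [a]) (h := fun _ _ => [])
    Primrec.id (primrec_cons .snd (.const [])) (.const [])).of_eq fun x => by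
      cases x <;> rfl

theorem primrec_rightList : Primrec (rightList : L ⊕ L → List L) :=
  (Primrec.sumCasesOn (f := fun x : L ⊕ L => x) (g := fun _ _ => []) (h := fun _ b => [b])
    Primrec.id (.const []) (primrec_cons .snd (.const []))).of_eq fun x => by
      cases x <;> rfl

/-- The code of the `k`-th header: an index of a signature closure, and two lists of labels. -/
def hdrCode (L : Type) [Primcodable L] (k : ℕ) : ℕ × List L × List L :=
  (Encodable.decode k).getD (0, [], [])

theorem primrec_hdrCode : Primrec (hdrCode L) :=
  Primrec.option_getD.comp Primrec.decode (Primrec.const _)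

open scoped Classical in
/-- The `k`-th header, relative to an enumeration of the signature closures. -/
noncomputable def hdrOf (sOf : ℕ → SigClosure N L) (k : ℕ) : Header (SigClosure N L) L :=
  (sOf (hdrCode L k).1, (hdrCode L k).2.1.toFinset, (hdrCode L k).2.2.toFinset)

namespace IsSigCoding

variable {s : ℕ → N × List (SigCode N L)} {sOf : ℕ → SigClosure N L} (hs : IsSigCoding s sOf)

include hs

theorem surjective_hdrOf : Function.Surjective (hdrOf sOf) := by
  rintro ⟨sc, A, B⟩
  obtain ⟨i, rfl⟩ := hs.surjective sc
  refine ⟨Encodable.encode (i, A.toList, B.toList), ?_⟩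
  simp [hdrOf, hdrCode]

theorem toSig_of_mem_rootCodes {i : ℕ} {c : SigCode N L} (hc : c ∈ rootCodes (s i)) :
    toSig c = (sOf i).root := by
  simp only [rootCodes, List.mem_filter, decide_eq_true_eq] at hc
  refine (sOf i).isSigClosure.isSigEnv.name_inj _ ?_ _ (sOf i).root_spec.1 ?_
  · rw [hs.env_eq]
    exact mem_envOf.2 ⟨c, hc.1, rfl⟩
  · rw [(sOf i).root_spec.2, hs.name_eq]
    exact hc.2

theorem exists_mem_rootCodes (i : ℕ) : ∃ c, c ∈ rootCodes (s i) := by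
  obtain ⟨h1, h2⟩ := (sOf i).root_spec
  rw [hs.env_eq] at h1
  obtain ⟨c, hc, h⟩ := mem_envOf.1 h1
  refine ⟨c, ?_⟩
  simp only [rootCodes, List.mem_filter, decide_eq_true_eq]
  refine ⟨hc, ?_⟩
  rw [← hs.name_eq, ← h2, ← h]
  rfl

theorem mem_rootSupers {i : ℕ} {n : N} : n ∈ rootSupers (s i) ↔ n ∈ (sOf i).root.supers := by
  simp only [rootSupers, List.mem_flatMap]
  constructor
  · rintro ⟨c, hc, hn⟩
    rw [← hs.toSig_of_mem_rootCodes hc]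
    simpa [toSig] using hn
  · intro hn
    obtain ⟨c, hc⟩ := hs.exists_mem_rootCodes i
    rw [← hs.toSig_of_mem_rootCodes hc] at hn
    exact ⟨c, hc, by simpa [toSig] using hn⟩

theorem mem_rootFields {i : ℕ} {f : L × N} : f ∈ rootFields (s i) ↔ f ∈ (sOf i).root.fields := by
  simp only [rootFields, List.mem_flatMap]
  constructor
  · rintro ⟨c, hc, hn⟩
    rw [← hs.toSig_of_mem_rootCodes hc]
    simpa [toSig] using hn
  · intro hn
    obtain ⟨c, hc⟩ := hs.exists_mem_rootCodes i
    rw [← hs.toSig_of_mem_rootCodes hc] at hn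
    exact ⟨c, hc, by simpa [toSig] using hn⟩

theorem mem_rootMethods {i : ℕ} {m : L × List N × N} :
    m ∈ rootMethods (s i) ↔ m ∈ (sOf i).root.methods := by
  simp only [rootMethods, List.mem_flatMap]
  constructor
  · rintro ⟨c, hc, hn⟩
    rw [← hs.toSig_of_mem_rootCodes hc]
    simpa [toSig] using hn
  · intro hn
    obtain ⟨c, hc⟩ := hs.exists_mem_rootCodes i
    rw [← hs.toSig_of_mem_rootCodes hc] at hn
    exact ⟨c, hc, by simpa [toSig] using hn⟩

theorem computablePred_env_subset :
    ComputablePred fun x : ℕ × ℕ => (sOf x.1).env ⊆ (sOf x.2).env := by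
  have hc := hs.computable
  refine (ComputablePred.forall_mem (p := fun (x : ℕ × ℕ) (c : SigCode N L) =>
    ∃ d ∈ (s x.2).2, toSig d = toSig c) (ComputablePred.exists_mem
      (p := fun (y : (ℕ × ℕ) × SigCode N L) (d : SigCode N L) => toSig d = toSig y.2)
      (computablePred_toSig_eq.comp
        (f := fun z : ((ℕ × ℕ) × SigCode N L) × SigCode N L => (z.2, z.1.2)) (by fun_prop))
      (Computable.snd.comp (hc.comp (by fun_prop))))
    (l := fun x => (s x.1).2) (Computable.snd.comp (hc.comp (by fun_prop)))).of_eq fun x => ?_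
  rw [hs.env_eq, hs.env_eq, Finset.subset_iff, ← forall_mem_envOf (p := fun t =>
    ∃ d ∈ (s x.2).2, toSig d = t)]
  exact forall₂_congr fun _ _ => mem_envOf.symm

theorem computablePred_eq : ComputablePred fun x : ℕ × ℕ => sOf x.1 = sOf x.2 := by
  have hc := hs.computable
  refine ((NOOP.computablePred_eq (Computable.fst.comp (hc.comp .fst))
    (Computable.fst.comp (hc.comp .snd))).and (hs.computablePred_env_subset.and
      (hs.computablePred_env_subset.comp (f := fun x : ℕ × ℕ => (x.2, x.1))
        (by fun_prop)))).of_eq fun x => ?_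
  rw [SigClosure.ext_iff, Finset.Subset.antisymm_iff, hs.name_eq, hs.name_eq]

/-- Subsigning is recursively enumerable: it is a chain of steps each of which is decidable. -/
theorem rePred_subsign : REPred fun x : ℕ × ℕ => (sOf x.1).Subsign (sOf x.2) := by
  have hc := hs.computable
  -- equality of closures is admitted as a step, since a closure has several indices
  have h : REPred fun x : ℕ × ℕ => (sOf x.1).ImmSub (sOf x.2) ∨ sOf x.1 = sOf x.2 := by
    refine ComputablePred.to_re (.or (.and ?_ ?_) hs.computablePred_eq)
    · exact hs.computablePred_env_subset.comp (f := fun x : ℕ × ℕ => (x.2, x.1)) (by fun_prop)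
    · refine (computablePred_mem (f := fun x : ℕ × ℕ => (s x.2).1)
        (l := fun x : ℕ × ℕ => rootSupers (s x.1)) (Computable.fst.comp (hc.comp .snd))
        (primrec_rootSupers.to_comp.comp (hc.comp .fst))).of_eq fun x => ?_
      rw [hs.mem_rootSupers, hs.name_eq]
  refine (REPred.reflTransGen (r := fun i j => (sOf i).ImmSub (sOf j) ∨ sOf i = sOf j) h).of_eq
    fun x => ⟨fun h => ?_, fun h => ?_⟩
  · generalize x.2 = j at h
    induction h with
    | refl => exact .refl
    | tail _ hbc ih =>
      rcases hbc with hbc | hbc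
      · exact ih.tail hbc
      · rwa [← hbc]
  · have : ∀ y, ReflTransGen SigClosure.ImmSub (sOf x.1) y → ∀ j, sOf j = y →
        ReflTransGen (fun i j => (sOf i).ImmSub (sOf j) ∨ sOf i = sOf j) x.1 j := by
      intro y hy
      induction hy with
      | refl => exact fun j hj => .single (.inr hj.symm)
      | @tail b c _ hbc ih =>
        intro j hj
        obtain ⟨i, rfl⟩ := hs.surjective b
        exact (ih i rfl).tail (.inl (hj ▸ hbc))
    exact this _ h _ rfl

/-- Subsigning the closure of a bound name, in terms of the indices of signature closures. -/
theorem subsign_closAt_iff {k i : ℕ} {n : N} (hn : ∃ t ∈ (sOf i).env, t.name = n) :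
    (sOf k).Subsign ((sOf i).closAt n) ↔
      ∃ j, ((s j).1 = n ∧ (sOf j).env ⊆ (sOf i).env) ∧ (sOf k).Subsign (sOf j) := by
  constructor
  · intro h
    obtain ⟨j, hj⟩ := hs.surjective ((sOf i).closAt n)
    rw [← hj] at h
    refine ⟨j, ?_, h⟩
    rw [← hs.name_eq, hj]
    exact (sOf i).closAt_of_bound hn
  · rintro ⟨j, ⟨rfl, h1⟩, h2⟩
    rwa [← hs.name_eq, SigClosure.closAt_eq h1]

/-- The pairs of a signature closure and a name in the environment of another one, such that the
former subsigns the closure of that name, are recursively enumerable; the closure need not be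
computed, it is found by searching. -/
theorem rePred_subsign_closAt : REPred fun x : ℕ × ℕ × N =>
    ∃ j, ((s j).1 = x.2.2 ∧ (sOf j).env ⊆ (sOf x.2.1).env) ∧ (sOf x.1).Subsign (sOf j) := by
  have hc := hs.computable
  refine REPred.exists (p := fun (x : ℕ × ℕ × N) j =>
    ((s j).1 = x.2.2 ∧ (sOf j).env ⊆ (sOf x.2.1).env) ∧ (sOf x.1).Subsign (sOf j))
    (.and (ComputablePred.to_re (.and (NOOP.computablePred_eq
      (Computable.fst.comp (hc.comp .snd)) (by fun_prop)) ?_)) ?_)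
  · exact hs.computablePred_env_subset.comp (f := fun y : (ℕ × ℕ × N) × ℕ => (y.2, y.1.2.1))
      (by fun_prop)
  · exact hs.rePred_subsign.comp (f := fun y : (ℕ × ℕ × N) × ℕ => (y.1.1, y.2)) (by fun_prop)

theorem computablePred_hdrOf_eq :
    ComputablePred fun q : ℕ × ℕ => hdrOf sOf q.1 = hdrOf sOf q.2 := by
  have h1 : Computable (hdrCode L) := primrec_hdrCode.to_comp
  have hA : ∀ {f : ℕ → List L}, Computable f → ComputablePred fun q : ℕ × ℕ =>
      (∀ a ∈ f q.1, a ∈ f q.2) ∧ ∀ a ∈ f q.2, a ∈ f q.1 := fun hf =>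
    (computablePred_forall_mem_mem (hf.comp .fst) (hf.comp .snd)).and
      (computablePred_forall_mem_mem (hf.comp .snd) (hf.comp .fst))
  refine ((hs.computablePred_eq.comp (f := fun q : ℕ × ℕ => ((hdrCode L q.1).1, (hdrCode L q.2).1))
    (by fun_prop)).and ((hA (f := fun k => (hdrCode L k).2.1) (by fun_prop)).and
      (hA (f := fun k => (hdrCode L k).2.2) (by fun_prop)))).of_eq fun q => ?_
  simp only [hdrOf, Prod.mk.injEq, Finset.ext_iff, List.mem_toFinset, ← forall_and,
    ← iff_iff_implies_and_implies]

omit hs [Primcodable N] in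
theorem computablePred_allowed :
    ComputablePred fun q : ℕ × Slot L => q.2.Allowed (hdrOf sOf q.1) := by
  have h1 : Computable (hdrCode L) := primrec_hdrCode.to_comp
  refine ((ComputablePred.exists_mem (p := fun (q : ℕ × Slot L) a =>
    a ∈ (hdrCode L q.1).2.1 ∧ q.2.2 = 0) (.and (computablePred_mem .snd (by fun_prop))
      (NOOP.computablePred_eq (by fun_prop) (by fun_prop)))
      (l := fun q => leftList q.2.1) (primrec_leftList.to_comp.comp (by fun_prop))).or
    (ComputablePred.exists_mem (p := fun (q : ℕ × Slot L) b => b ∈ (hdrCode L q.1).2.2)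
      (computablePred_mem .snd (by fun_prop)) (l := fun q => rightList q.2.1)
      (primrec_rightList.to_comp.comp (by fun_prop)))).of_eq ?_
  rintro ⟨k, a | b, n⟩ <;> simp [leftList, rightList, Slot.Allowed, hdrOf]

theorem rePred_good : REPred fun y => (sigSpec N L).good (hdrOf sOf (hdCode L y)) := by
  have hc := hs.computable
  have h1 : Computable (hdrCode L) := primrec_hdrCode.to_comp
  have h2 : Computable (hdCode L) := primrec_hdCode.to_comp
  have key : ∀ {β : Type} [Primcodable β] {A : ℕ → List L} {F : ℕ → List (L × β)},
      Computable A → Computable F → ComputablePred fun y =>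
        (∀ a ∈ A y, ∃ f ∈ F y, f.1 = a) ∧ ∀ f ∈ F y, f.1 ∈ A y := by
    intro β _ A F hA hF
    refine (ComputablePred.forall_mem (p := fun y a => ∃ f ∈ F y, f.1 = a)
      (ComputablePred.exists_mem (p := fun (z : ℕ × L) (f : L × β) => f.1 = z.2)
        (NOOP.computablePred_eq (by fun_prop) (by fun_prop)) (hF.comp .fst)) hA).and
      (ComputablePred.forall_mem (p := fun y (f : L × β) => f.1 ∈ A y)
        (computablePred_mem (by fun_prop) (hA.comp .fst)) hF)
  refine ((key (A := fun y => (hdrCode L (hdCode L y)).2.1)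
    (F := fun y => rootFields (s (hdrCode L (hdCode L y)).1)) (by fun_prop)
    (primrec_rootFields.to_comp.comp (hc.comp (by fun_prop)))).and
    (key (A := fun y => (hdrCode L (hdCode L y)).2.2)
    (F := fun y => rootMethods (s (hdrCode L (hdCode L y)).1)) (by fun_prop)
    (primrec_rootMethods.to_comp.comp (hc.comp (by fun_prop))))).to_re.of_eq fun y => ?_
  refine and_congr ?_ ?_
  · simp only [hs.mem_rootFields, hdrOf, Set.ext_iff, Finset.mem_coe, List.mem_toFinset,
      SigClosure.fieldShape, Set.mem_ofPred_eq]
    exact ⟨fun h a => ⟨h.1 a, fun ⟨f, hf, e⟩ => e ▸ h.2 f hf⟩,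
      fun h => ⟨fun a => (h a).1, fun f hf => (h f.1).2 ⟨f, hf, rfl⟩⟩⟩
  · simp only [hs.mem_rootMethods, hdrOf, Set.ext_iff, Finset.mem_coe, List.mem_toFinset,
      SigClosure.methodShape, Set.mem_ofPred_eq]
    exact ⟨fun h a => ⟨h.1 a, fun ⟨f, hf, e⟩ => e ▸ h.2 f hf⟩,
      fun h => ⟨fun a => (h a).1, fun f hf => (h f.1).2 ⟨f, hf, rfl⟩⟩⟩

theorem rePred_okAt : REPred (OkAt (sigSpec N L) (hdrOf sOf)) := by
  have hc := hs.computable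
  have h1 : Computable (hdrCode L) := primrec_hdrCode.to_comp
  have h2 : Computable (hdCode L) := primrec_hdCode.to_comp
  have hlen : Computable (List.length : List N → ℕ) := Computable.list_length
  have hF : Computable fun y => rootFields (s (hdrCode L (hdCode L y)).1) :=
    primrec_rootFields.to_comp.comp (hc.comp (by fun_prop))
  have hM : Computable fun y => rootMethods (s (hdrCode L (hdCode L y)).1) :=
    primrec_rootMethods.to_comp.comp (hc.comp (by fun_prop))
  have hl : Computable (leftList : L ⊕ L → List L) := primrec_leftList.to_comp
  have hr : Computable (rightList : L ⊕ L → List L) := primrec_rightList.to_comp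
  refine (ComputablePred.exists_mem (p := fun y (σ : Slot L) =>
    (∃ a ∈ leftList σ.1, σ.2 = 0 ∧
      ∃ f ∈ rootFields (s (hdrCode L (hdCode L y)).1), f.1 = a) ∨
    ∃ b ∈ rightList σ.1, ∃ m ∈ rootMethods (s (hdrCode L (hdCode L y)).1),
      m.1 = b ∧ σ.2 = m.2.1.length + 1) (.or ?_ ?_)
    (Primrec.optionToList.comp primrec_slotOf).to_comp).to_re.of_eq fun y => ?_
  · refine ComputablePred.exists_mem (p := fun (x : ℕ × Slot L) a => x.2.2 = 0 ∧
      ∃ f ∈ rootFields (s (hdrCode L (hdCode L x.1)).1), f.1 = a)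
      (.and (NOOP.computablePred_eq (by fun_prop) (by fun_prop))
        (ComputablePred.exists_mem (p := fun (z : (ℕ × Slot L) × L) (f : L × N) => f.1 = z.2)
          (NOOP.computablePred_eq (by fun_prop) (by fun_prop)) (hF.comp (by fun_prop))))
      (hl.comp (by fun_prop))
  · refine ComputablePred.exists_mem (p := fun (x : ℕ × Slot L) b =>
      ∃ m ∈ rootMethods (s (hdrCode L (hdCode L x.1)).1), m.1 = b ∧ x.2.2 = m.2.1.length + 1)
      (ComputablePred.exists_mem (p := fun (z : (ℕ × Slot L) × L) (m : L × List N × N) =>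
        m.1 = z.2 ∧ z.1.2.2 = m.2.1.length + 1)
        (.and (NOOP.computablePred_eq (by fun_prop) (by fun_prop))
          (NOOP.computablePred_eq (by fun_prop)
            (Computable.succ.comp (hlen.comp (by fun_prop))))) (hM.comp (by fun_prop)))
      (hr.comp (by fun_prop))
  · simp only [Option.mem_toList, hs.mem_rootFields, hs.mem_rootMethods]
    refine exists_congr fun σ => and_congr_right fun _ => ?_
    obtain ⟨a | b, n⟩ := σ <;> simp [leftList, rightList, hdrOf, sigSpec]

theorem rePred_resAt :
    REPred fun q : ℕ × ℕ => ResAt (sigSpec N L) (hdrOf sOf) q.1 q.2 := by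
  have hc := hs.computable
  have h1 : Computable (hdrCode L) := primrec_hdrCode.to_comp
  have h2 : Computable (hdCode L) := primrec_hdCode.to_comp
  have hF : Computable fun y => rootFields (s (hdrCode L (hdCode L y)).1) :=
    primrec_rootFields.to_comp.comp (hc.comp (by fun_prop))
  have hM : Computable fun y => rootMethods (s (hdrCode L (hdCode L y)).1) :=
    primrec_rootMethods.to_comp.comp (hc.comp (by fun_prop))
  have hl : Computable (leftList : L ⊕ L → List L) := primrec_leftList.to_comp
  have hr : Computable (rightList : L ⊕ L → List L) := primrec_rightList.to_comp
  let R : ℕ → ℕ → N → Prop := fun y z n => ∃ j,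
    ((s j).1 = n ∧ (sOf j).env ⊆ (sOf (hdrCode L (hdCode L y)).1).env) ∧
      (sOf (hdrCode L (hdCode L z)).1).Subsign (sOf j)
  have hR : REPred fun x : ℕ × ℕ × N => R x.1 x.2.1 x.2.2 := hs.rePred_subsign_closAt.comp
    (f := fun x : ℕ × ℕ × N =>
      ((hdrCode L (hdCode L x.2.1)).1, (hdrCode L (hdCode L x.1)).1, x.2.2)) (by fun_prop)
  refine (REPred.exists_mem (p := fun (q : ℕ × ℕ) (σ : Slot L) =>
    (∃ a ∈ leftList σ.1, ∃ f ∈ rootFields (s (hdrCode L (hdCode L q.1)).1),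
      f.1 = a ∧ R q.1 q.2 f.2) ∨
    ∃ b ∈ rightList σ.1, ∃ m ∈ rootMethods (s (hdrCode L (hdCode L q.1)).1),
      m.1 = b ∧ R q.1 q.2 m.2.2) (.or ?_ ?_)
    ((Primrec.optionToList.comp primrec_slotOf).to_comp.comp .fst)).of_eq fun q => ?_
  · refine REPred.exists_mem (p := fun (x : (ℕ × ℕ) × Slot L) a =>
      ∃ f ∈ rootFields (s (hdrCode L (hdCode L x.1.1)).1), f.1 = a ∧ R x.1.1 x.1.2 f.2)
      (REPred.exists_mem (p := fun (z : ((ℕ × ℕ) × Slot L) × L) (f : L × N) =>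
        f.1 = z.2 ∧ R z.1.1.1 z.1.1.2 f.2)
        (.and (NOOP.computablePred_eq (by fun_prop) (by fun_prop)).to_re
          (hR.comp (f := fun w : (((ℕ × ℕ) × Slot L) × L) × (L × N) =>
            (w.1.1.1.1, w.1.1.1.2, w.2.2)) (by fun_prop))) (hF.comp (by fun_prop)))
      (hl.comp (by fun_prop))
  · refine REPred.exists_mem (p := fun (x : (ℕ × ℕ) × Slot L) b =>
      ∃ m ∈ rootMethods (s (hdrCode L (hdCode L x.1.1)).1), m.1 = b ∧ R x.1.1 x.1.2 m.2.2)
      (REPred.exists_mem (p := fun (z : ((ℕ × ℕ) × Slot L) × L) (m : L × List N × N) =>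
        m.1 = z.2 ∧ R z.1.1.1 z.1.1.2 m.2.2)
        (.and (NOOP.computablePred_eq (by fun_prop) (by fun_prop)).to_re
          (hR.comp (f := fun w : (((ℕ × ℕ) × Slot L) × L) × (L × List N × N) =>
            (w.1.1.1.1, w.1.1.1.2, w.2.2.2)) (by fun_prop))) (hM.comp (by fun_prop)))
      (hr.comp (by fun_prop))
  · simp only [Option.mem_toList, hs.mem_rootFields, hs.mem_rootMethods]
    refine exists_congr fun σ => and_congr_right fun _ => ?_
    -- all names that occur in the root are bound, so that `closAt` has no junk values here
    have hb : ∀ {n : N}, n ∈ (sOf (hdrCode L (hdCode L q.1)).1).root.refs →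
        (R q.1 q.2 n ↔ (sOf (hdrCode L (hdCode L q.2)).1).Subsign
          ((sOf (hdrCode L (hdCode L q.1)).1).closAt n)) := fun hn =>
      (hs.subsign_closAt_iff (SigClosure.bound_of_mem_refs _ hn)).symm
    obtain ⟨a | b, n⟩ := σ
    · simp only [leftList, rightList, Sum.elim_inl, List.mem_singleton, exists_eq_left,
        List.not_mem_nil, false_and, exists_false, or_false]
      exact exists_congr fun f => and_congr_right fun hf => and_congr_right fun _ =>
        hb (.inr (.inl ⟨f, hf, rfl⟩))
    · simp only [leftList, rightList, Sum.elim_inr, List.mem_singleton, exists_eq_left,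
        List.not_mem_nil, false_and, exists_false, false_or]
      exact exists_congr fun m => and_congr_right fun hm => and_congr_right fun _ =>
        hb (.inr (.inr ⟨m, hm, .inr rfl⟩))

theorem rePred_accAt :
    REPred fun q : ℕ × ℕ × ℕ => AccAt (sigSpec N L) (hdrOf sOf) q.1 q.2.1 q.2.2 := by
  have hc := hs.computable
  have h1 : Computable (hdrCode L) := primrec_hdrCode.to_comp
  have h2 : Computable (hdCode L) := primrec_hdCode.to_comp
  have hM : Computable fun y => rootMethods (s (hdrCode L (hdCode L y)).1) :=
    primrec_rootMethods.to_comp.comp (hc.comp (by fun_prop))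
  have hl : Computable (leftList : L ⊕ L → List L) := primrec_leftList.to_comp
  have hr : Computable (rightList : L ⊕ L → List L) := primrec_rightList.to_comp
  let R : ℕ → ℕ → N → Prop := fun y z n => ∃ j,
    ((s j).1 = n ∧ (sOf j).env ⊆ (sOf (hdrCode L (hdCode L y)).1).env) ∧
      (sOf (hdrCode L (hdCode L z)).1).Subsign (sOf j)
  have hR : REPred fun x : ℕ × ℕ × N => R x.1 x.2.1 x.2.2 := hs.rePred_subsign_closAt.comp
    (f := fun x : ℕ × ℕ × N =>
      ((hdrCode L (hdCode L x.2.1)).1, (hdrCode L (hdCode L x.1)).1, x.2.2)) (by fun_prop)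
  refine (REPred.exists_mem (p := fun (q : ℕ × ℕ × ℕ) (σ : Slot L) =>
    (∃ a ∈ leftList σ.1, True) ∨
    ∃ b ∈ rightList σ.1, ∃ m ∈ rootMethods (s (hdrCode L (hdCode L q.1)).1),
      m.1 = b ∧ ∃ n ∈ (((s (hdrCode L (hdCode L q.1)).1).1 :: m.2.1)[q.2.1]?).toList,
        R q.1 q.2.2 n) (.or ?_ ?_)
    ((Primrec.optionToList.comp primrec_slotOf).to_comp.comp .fst)).of_eq fun q => ?_
  · exact REPred.exists_mem (p := fun (_ : (ℕ × ℕ × ℕ) × Slot L) (_ : L) => True)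
      (computablePred_const True).to_re (hl.comp (by fun_prop))
  · refine REPred.exists_mem (p := fun (x : (ℕ × ℕ × ℕ) × Slot L) b =>
      ∃ m ∈ rootMethods (s (hdrCode L (hdCode L x.1.1)).1), m.1 = b ∧
        ∃ n ∈ (((s (hdrCode L (hdCode L x.1.1)).1).1 :: m.2.1)[x.1.2.1]?).toList,
          R x.1.1 x.1.2.2 n)
      (REPred.exists_mem (p := fun (z : ((ℕ × ℕ × ℕ) × Slot L) × L) (m : L × List N × N) =>
        m.1 = z.2 ∧ ∃ n ∈ (((s (hdrCode L (hdCode L z.1.1.1)).1).1 :: m.2.1)[z.1.1.2.1]?).toList,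
          R z.1.1.1 z.1.1.2.2 n)
        (.and (NOOP.computablePred_eq (by fun_prop) (by fun_prop)).to_re
          (REPred.exists_mem (p := fun (w : (((ℕ × ℕ × ℕ) × Slot L) × L) × (L × List N × N)) n =>
            R w.1.1.1.1 w.1.1.1.2.2 n)
            (hR.comp (f := fun w : ((((ℕ × ℕ × ℕ) × Slot L) × L) × (L × List N × N)) × N =>
              (w.1.1.1.1.1, w.1.1.1.1.2.2, w.2)) (by fun_prop))
            (Primrec.optionToList.to_comp.comp (Computable.list_getElem?.comp
              (Computable.list_cons.comp (Computable.fst.comp (hc.comp (by fun_prop)))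
                (by fun_prop)) (by fun_prop))))) (hM.comp (by fun_prop)))
      (hr.comp (by fun_prop))
  · simp only [Option.mem_toList, hs.mem_rootMethods]
    refine exists_congr fun σ => and_congr_right fun _ => ?_
    obtain ⟨a | b, n⟩ := σ
    · simp [leftList, rightList, sigSpec]
    · simp only [leftList, rightList, Sum.elim_inr, List.mem_singleton, exists_eq_left,
        List.not_mem_nil, false_and, exists_false, false_or]
      refine exists_congr fun m => and_congr_right fun hm => and_congr_right fun _ => ?_
      -- the first argument is the receiver, whose prescribed closure is that of the object itself
      have hb : ∀ {n : N}, n ∈ (sOf (hdrCode L (hdCode L q.1)).1).name :: m.2.1 →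
          (R q.1 q.2.2 n ↔ (sOf (hdrCode L (hdCode L q.2.2)).1).Subsign
            ((sOf (hdrCode L (hdCode L q.1)).1).closAt n)) := fun {n} hn => by
        refine (hs.subsign_closAt_iff ?_).symm
        rcases List.mem_cons.1 hn with rfl | hn
        · exact ⟨_, (sOf _).root_spec⟩
        · exact SigClosure.bound_of_mem_refs _ (.inr (.inr ⟨m, hm, .inl hn⟩))
      simp only [argSigs, List.getElem?_map, Option.map_eq_some_iff, ← hs.name_eq, hdrOf]
      constructor
      · rintro ⟨n, hn, h⟩
        exact ⟨_, ⟨n, hn, rfl⟩, (hb (List.mem_of_getElem? hn)).1 h⟩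
      · rintro ⟨_, ⟨n, hn, rfl⟩, h⟩
        exact ⟨n, hn, (hb (List.mem_of_getElem? hn)).2 h⟩

end IsSigCoding

end Enumeration

/-! ### Filtering is computable -/

variable {N L : Type} [Countable N] [Countable L]

local notation "O" => Obj N L

/-- The raw objects have an effective presentation with respect to which filtering is computable. -/
theorem exists_isEffectivePresentation : ∃ e : ℕ → O, IsEffectivePresentation e ∧
    IsComputableMap e (filter (sigSpec N L) : StrictFun O O) := by
  obtain ⟨_⟩ := exists_primcodable N
  obtain ⟨_⟩ := exists_primcodable L
  have : Countable (SigClosure N L) := SigClosure.countable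
  have hF := isFinitaryProjection_filter (sigSpec N L)
  rcases isEmpty_or_nonempty (SigClosure N L) with hS | hS
  · -- without signature closures, bottom is the only object
    have hbot : ∀ x : O, x = ⊥ := eq_bot_of_isEmpty
    have hsub : Subsingleton O := ⟨fun x y => (hbot x).trans (hbot y).symm⟩
    have hle : ∀ x y : O, x ≤ y := fun x y => (Subsingleton.elim x y).le
    refine ⟨fun _ => ⊥, ⟨?_, ?_, ?_⟩, ?_⟩
    · ext c
      refine ⟨fun _ => ?_, fun _ => ⟨0, Subsingleton.elim _ _⟩⟩
      exact fun s u hne _ _ _ => ⟨_, hne.some_mem, hle _ _⟩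
    · exact (computablePred_const True).of_eq fun _ =>
        (iff_true_intro ⟨⊥, fun x _ => hle x _⟩).symm
    · exact (computablePred_const True).of_eq fun _ =>
        (iff_true_intro ⟨fun x _ => hle x _, fun x _ => hle _ x⟩).symm
    · exact (computablePred_const True).to_re.of_eq fun _ => (iff_true_intro (hle _ _)).symm
  · obtain ⟨s, sOf, hs⟩ := exists_isSigCoding (N := N) (L := L)
    have hEq := hs.computablePred_hdrOf_eq
    have hAl := IsSigCoding.computablePred_allowed (sOf := sOf)
    exact ⟨_, isEffectivePresentation_join hs.surjective_hdrOf hEq hAl,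
      isComputableMap_of_below hEq hAl (rePred_below (unfolds_filter (sigSpec N L)) hF.le_self
        hF.continuous.monotone hEq hAl hs.rePred_good hs.rePred_okAt hs.rePred_accAt
        hs.rePred_resAt)⟩

end NOOP

theorem mainTheorem4 (N L : Type) [Countable N] [Countable L] :
    NOOP.IsScottDomain (NOOP.Obj N L) ∧
    ∃ filter : NOOP.Obj N L → NOOP.Obj N L,
      NOOP.IsFilter filter ∧
      NOOP.IsFinitaryProjection filter ∧
      (∀ o, o ∈ Set.range filter ↔ NOOP.ValidClauses (Set.range filter) o) ∧
      (∀ o, IsCompactElement o → (o ∈ Set.range filter ↔ NOOP.IndValid o)) ∧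
      NOOP.IsSubdomain (Set.range filter) ∧
      (∃ e : ℕ → NOOP.Obj N L, NOOP.IsEffectivePresentation e ∧ NOOP.IsComputableMap e filter ∧
        NOOP.IsComputableSubdomain e (Set.range filter)) ∧
      ∃ X : Set NOOP.Universal, NOOP.IsSubdomain X ∧ Nonempty (Set.range filter ≃o X) := by
  have : Countable (NOOP.SigClosure N L) := NOOP.SigClosure.countable
  have hD : NOOP.IsScottDomain (NOOP.Obj N L) := NOOP.PreObj.isScottDomain
  have hF := NOOP.PreObj.isFinitaryProjection_filter (NOOP.sigSpec N L)
  have hV : ∀ o : NOOP.Obj N L, o ∈ Set.range (NOOP.PreObj.filter (NOOP.sigSpec N L)) ↔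
      NOOP.ValidClauses (Set.range (NOOP.PreObj.filter (NOOP.sigSpec N L))) o := fun o =>
    NOOP.PreObj.mem_range_filter_iff.trans NOOP.validClauses_iff_slotValid.symm
  have hX := hF.isSubdomain hD
  refine ⟨hD, NOOP.PreObj.filter (NOOP.sigSpec N L), NOOP.isFilter_filter, hF, hV,
    fun o ho => ⟨fun h V hV' => ?_, fun h => h _ fun p hp => (hV p).2 hp⟩, hX, ?_,
    hX.isScottDomain.exists_universal⟩
  · exact NOOP.PreObj.mem_of_closed (fun p hp => hV' p (NOOP.validClauses_iff_slotValid.2 hp)) ho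
      ((NOOP.mem_range_iff_of_idem hF.idem).1 h)
  · obtain ⟨e, he, hep⟩ := NOOP.exists_isEffectivePresentation (N := N) (L := L)
    exact ⟨e, he, hep, hF.isComputableSubdomain hD he hep⟩
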